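/- Let $k$ be an algebraically closed field of characteristic zero, $n\ge 0$, $q\ge 1$, $S=k[x_0,\dots,x_n]$, let $\mathfrak g_q$ be the free nilpotent Lie $k$-algebra of index $q$ on $x_0,\dots,x_n$ (the quotient of the free Lie algebra by the term $\mathfrak L^{(q+1)}$ of its lower central series, $\mathfrak L^{(1)}=\mathfrak L$), and let $S_q=\mathcal U(\mathfrak g_q)$. Let $\mathbf y=(y_1,\dots,y_r)$ be a basis of $[\mathfrak g_q,\mathfrak g_q]$ of homogeneous elements (for example a Hall basis), $\deg y_u$ being the length of the Lie monomials in $y_u$, and put $\langle\alpha\rangle=\sum_u\alpha_u\deg y_u$. The ordered monomials $\mathbf x^\beta\mathbf y^\alpha$ form a basis of $S_q$. Write $S^e\otimes R_q^m\langle\mathbf y\rangle$ for the span of those with $|\beta|=e$, $\langle\alpha\rangle=m$; $S\otimes R_q^m\langle\mathbf y\rangle=\bigoplus_e S^e\otimes R_q^m\langle\mathbf y\rangle$, an $S$-module by commutative multiplication of the coefficients in $S$; $S_q^d=\bigoplus_{m=0}^d S^{d-m}\otimes R_q^m\langle\mathbf y\rangle$; and $\mathcal J_s=\bigoplus_{m\ge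 s}S\otimes R_q^m\langle\mathbf y\rangle$, a two-sided ideal. For a homogeneous $h\in S$ of positive degree let $h(\mathbf x)\in S_q$ be its value with ordered monomials, and let $S_{q,h(\mathbf x)}=\varprojlim_s (S_q/\mathcal J_s)[h(\mathbf x)^{-1}]$ be the topological localization, with the inverse limit topology of discrete algebras. As a topological vector space it is identified with $\prod_{m\ge0}S_h\otimes R_q^m\langle\mathbf y\rangle$: the (commutative) multiplication operators by elements of $S$ on $S_q$ extend continuously to $S_{q,h(\mathbf x)}$, $h$ becomes invertible, and $S_h\otimes R_q^m\langle\mathbf y\rangle$ consists of the commutative fractions $a/h^l$, $a\in S\otimes R_q^m\langle\mathbf y\rangle$. For $d\in\mathbb Z$ put $S_{q,h(\mathbf x)}^d=\prod_m S_h^{d-m}\otimes R_q^m\langle\mathbf y\rangle$. Let $I$ be an NC-graded ideal of $S_q$, that is, a two-sided ideal with $I=\bigoplus_d I^d$, $I^d=I\cap S_q^d$, and $I^d=\bigoplus_{m=0}^d I^d\cap(S^{d-m}\otimes R_q^m\langle\mathbf y\rangle)$ for all $d$. Put $I_m=\bigoplus_e I^{e+m}\cap(S^e\otimes R_q^m\langle\mathbf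 y\rangle)$, $I_{m,h}=\{a/h^l: a\in I_m,\ l\ge0\}$, $I_{m,h}^e=I_{m,h}\cap (S_h^e\otimes R_q^m\langle\mathbf y\rangle)$, $M=\prod_{m\ge0}I_{m,h}\subseteq S_{q,h(\mathbf x)}$ and $M^d=\prod_{m\ge0}I_{m,h}^{d-m}$. Let $I_{h(\mathbf x)}$ be the closure in $S_{q,h(\mathbf x)}$ of the linear span of all $a\cdot h(\mathbf x)^{-d}$, $a\in I$, $d\ge0$. Then: (1) $M$ is a closed two-sided ideal of $S_{q,h(\mathbf x)}$; (2) $M$ is graded: the subspaces $M^d=M\cap S_{q,h(\mathbf x)}^d$ $(d\in\mathbb Z)$ are closed and linearly independent, their algebraic sum is dense in $M$, and $S_{q,h(\mathbf x)}^t\cdot M^d\subseteq M^{t+d}$, $M^d\cdot S_{q,h(\mathbf x)}^t\subseteq M^{t+d}$ for all $t,d\in\mathbb Z$; (3) $M=I_{h(\mathbf x)}$. -/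

import Mathlib

noncomputable section

namespace NCProj

universe u

/-! ## Localization of a noncommutative algebra at one element -/

section Loc

/-- The relations presenting the algebra obtained from the `k`-algebra `B` by adjoining a
two-sided inverse (the generator `none`) of the element `b`. -/
inductive InvRel (k : Type u) [Field k] {B : Type u} [Ring B] [Algebra k B] (b : B) :
    FreeAlgebra k (Option B) → FreeAlgebra k (Option B) → Prop
  | add (x y : B) : InvRel k b (FreeAlgebra.ι k (some (x + y)))
      (FreeAlgebra.ι k (some x) + FreeAlgebra.ι k (some y))
  | mul (x y : B) : InvRel k b (FreeAlgebra.ι k (some (x * y)))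
      (FreeAlgebra.ι k (some x) * FreeAlgebra.ι k (some y))
  | algebraMap (r : k) : InvRel k b (FreeAlgebra.ι k (some (algebraMap k B r)))
      (algebraMap k (FreeAlgebra k (Option B)) r)
  | mul_inv : InvRel k b (FreeAlgebra.ι k (some b) * FreeAlgebra.ι k none) 1
  | inv_mul : InvRel k b (FreeAlgebra.ι k none * FreeAlgebra.ι k (some b)) 1

/-- The localization `B[b⁻¹]`: the universal `k`-algebra under `B` in which `b` is invertible. If
the powers of `b` form an Ore set, it is the algebra of fractions. -/
def InvLoc (k : Type u) [Field k] {B : Type u} [Ring B] [Algebra k B] (b : B) : Type u :=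
  RingQuot (InvRel k b)

variable (k : Type u) [Field k] {B : Type u} [Ring B] [Algebra k B] (b : B)

instance : Ring (InvLoc k b) := inferInstanceAs (Ring (RingQuot (InvRel k b)))

instance : Algebra k (InvLoc k b) := inferInstanceAs (Algebra k (RingQuot (InvRel k b)))

/-- The quotient map of the presentation. -/
def InvLoc.quot : FreeAlgebra k (Option B) →ₐ[k] InvLoc k b := RingQuot.mkAlgHom k (InvRel k b)

/-- The canonical homomorphism `B → B[b⁻¹]`. -/
def InvLoc.of : B →ₐ[k] InvLoc k b :=
  AlgHom.ofLinearMap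
    { toFun := fun x => InvLoc.quot k b (FreeAlgebra.ι k (some x))
      map_add' := fun x y => by
        rw [← map_add]; exact RingQuot.mkAlgHom_rel k (InvRel.add x y)
      map_smul' := fun r x => by
        rw [RingHom.id_apply, Algebra.smul_def r x, Algebra.smul_def r, ← AlgHom.commutes
          (InvLoc.quot k b), ← map_mul]
        refine (RingQuot.mkAlgHom_rel k (InvRel.mul _ x)).trans ?_
        rw [map_mul, map_mul]
        exact congrArg (· * InvLoc.quot k b (FreeAlgebra.ι k (some x)))
          (RingQuot.mkAlgHom_rel k (InvRel.algebraMap (b := b) r)) }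
    (by
      have h := RingQuot.mkAlgHom_rel k (InvRel.algebraMap (k := k) (b := b) 1)
      rw [map_one, map_one, map_one] at h
      exact h)
    (fun x y => by
      have h := RingQuot.mkAlgHom_rel k (InvRel.mul (k := k) (b := b) x y)
      rw [map_mul] at h
      exact h)

/-- The inverse of `b` in `B[b⁻¹]`. -/
def InvLoc.inv : InvLoc k b := InvLoc.quot k b (FreeAlgebra.ι k none)

theorem InvLoc.of_mul_inv : InvLoc.of k b b * InvLoc.inv k b = 1 := by
  have h := RingQuot.mkAlgHom_rel k (InvRel.mul_inv (k := k) (b := b))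
  rw [map_mul, map_one] at h
  exact h

theorem InvLoc.inv_mul_of : InvLoc.inv k b * InvLoc.of k b b = 1 := by
  have h := RingQuot.mkAlgHom_rel k (InvRel.inv_mul (k := k) (b := b))
  rw [map_mul, map_one] at h
  exact h

/-- The universal property of `B[b⁻¹]`. -/
def InvLoc.lift {C : Type u} [Ring C] [Algebra k C] (f : B →ₐ[k] C) (c : C) (h₁ : f b * c = 1)
    (h₂ : c * f b = 1) : InvLoc k b →ₐ[k] C :=
  RingQuot.liftAlgHom k ⟨FreeAlgebra.lift k (fun o => Option.elim o c f), by
    intro x y h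
    cases h <;> simp [h₁, h₂]⟩

theorem InvLoc.lift_of {C : Type u} [Ring C] [Algebra k C] (f : B →ₐ[k] C) (c : C)
    (h₁ : f b * c = 1) (h₂ : c * f b = 1) (x : B) :
    InvLoc.lift k b f c h₁ h₂ (InvLoc.of k b x) = f x := by
  refine (RingQuot.liftAlgHom_mkAlgHom_apply k _ _ _).trans ?_
  simp

theorem InvLoc.lift_inv {C : Type u} [Ring C] [Algebra k C] (f : B →ₐ[k] C) (c : C)
    (h₁ : f b * c = 1) (h₂ : c * f b = 1) :
    InvLoc.lift k b f c h₁ h₂ (InvLoc.inv k b) = c := by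
  refine (RingQuot.liftAlgHom_mkAlgHom_apply k _ _ _).trans ?_
  simp

theorem InvLoc.algHom_ext {C : Type u} [Ring C] [Algebra k C] {f g : InvLoc k b →ₐ[k] C}
    (h : ∀ x, f (InvLoc.of k b x) = g (InvLoc.of k b x)) : f = g := by
  have hi : f (InvLoc.inv k b) = g (InvLoc.inv k b) := by
    have h₁ : g (InvLoc.of k b b) * g (InvLoc.inv k b) = 1 := by
      rw [← map_mul, InvLoc.of_mul_inv, map_one]
    have h₂ : f (InvLoc.inv k b) * g (InvLoc.of k b b) = 1 := by
      rw [← h, ← map_mul, InvLoc.inv_mul_of, map_one]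
    exact left_inv_eq_right_inv h₂ h₁
  refine RingQuot.ringQuot_ext' (S := k) f g (FreeAlgebra.hom_ext ?_)
  funext o
  cases o with
  | none => exact hi
  | some x => exact h x

end Loc

/-! ## The dual numbers over a noncommutative algebra -/

section Dual

variable {k : Type u} [Field k] {B C : Type u} [Ring B] [Algebra k B] [Ring C] [Algebra k C]

/-- An algebra homomorphism `B → C` induces one `B[ε] → C[ε]`. -/
def dualMap (f : B →ₐ[k] C) : DualNumber B →ₐ[k] DualNumber C :=
  AlgHom.ofLinearMap
    { toFun := fun x => TrivSqZeroExt.inl (f x.fst) + TrivSqZeroExt.inr (f x.snd)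
      map_add' := fun x y => by ext <;> simp
      map_smul' := fun r x => by ext <;> simp }
    (by ext <;> simp)
    (fun x y => by ext <;> simp)

@[simp] theorem fst_dualMap (f : B →ₐ[k] C) (x : DualNumber B) :
    (dualMap f x).fst = f x.fst := by
  change (TrivSqZeroExt.inl (f x.fst) + TrivSqZeroExt.inr (f x.snd) : DualNumber C).fst = _
  simp

@[simp] theorem snd_dualMap (f : B →ₐ[k] C) (x : DualNumber B) :
    (dualMap f x).snd = f x.snd := by
  change (TrivSqZeroExt.inl (f x.fst) + TrivSqZeroExt.inr (f x.snd) : DualNumber C).snd = _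
  simp

/-- The inverse `t - ε t z₁ t` of `z = z₀ + ε z₁`, where `t` is the inverse of `z₀`. -/
def dualInv (z : DualNumber C) (t : C) : DualNumber C :=
  TrivSqZeroExt.inl t - TrivSqZeroExt.inr (t * z.snd * t)

theorem mul_dualInv (z : DualNumber C) (t : C) (h : z.fst * t = 1) : z * dualInv z t = 1 := by
  ext
  · simp [dualInv, h]
  · simp [dualInv, ← mul_assoc, h]

theorem dualInv_mul (z : DualNumber C) (t : C) (h : t * z.fst = 1) : dualInv z t * z = 1 := by
  ext
  · simp [dualInv, h]
  · simp [dualInv, mul_assoc, h]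

end Dual

/-! ## Ordered calculus -/

section Ordered

variable {B : Type u} [Ring B]

/-- The ordered monomial `x₀ ^ β₀ ⋯ xₚ₋₁ ^ βₚ₋₁`. -/
def orderedMonomial {p : ℕ} (x : Fin p → B) (β : Fin p → ℕ) : B :=
  (List.ofFn fun i => x i ^ β i).prod

/-- The ordered functional calculus: the linear map that sends the monomial `x ^ β` to the ordered
monomial in the given noncommuting elements. -/
def orderedCalc (k : Type u) [Field k] [Algebra k B] {p : ℕ} (x : Fin p → B) :
    MvPolynomial (Fin p) k →ₗ[k] B :=
  (MvPolynomial.basisMonomials (Fin p) k).constr k fun β => orderedMonomial x β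

end Ordered

/-! ## The free nilpotent Lie algebra and its enveloping algebra -/

section Lie

variable (k : Type u) [Field k] (n q : ℕ)

/-- The free nilpotent Lie algebra of index `q` in `x₀, …, xₙ`. (Mathlib numbers the lower central
series from `0`.) -/
abbrev NilLie : Type u :=
  FreeLieAlgebra k (Fin (n + 1)) ⧸
    LieModule.lowerCentralSeries k (FreeLieAlgebra k (Fin (n + 1)))
      (FreeLieAlgebra k (Fin (n + 1))) q

/-- The generators. -/
def lieGen (j : Fin (n + 1)) : NilLie k n q := LieSubmodule.Quotient.mk (FreeLieAlgebra.of k j)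

/-- `IsLieMonomial k n q i w`: `w` is a Lie monomial of length `i` in the generators. -/
inductive IsLieMonomial : ℕ → NilLie k n q → Prop
  | gen (j : Fin (n + 1)) : IsLieMonomial 1 (lieGen k n q j)
  | lie (a b : ℕ) (v w : NilLie k n q) (hv : IsLieMonomial a v) (hw : IsLieMonomial b w) :
      IsLieMonomial (a + b) ⁅v, w⁆

/-- The homogeneous component of degree `i` of the free nilpotent Lie algebra. -/
def lieComp (i : ℕ) : Submodule k (NilLie k n q) :=
  Submodule.span k {w | IsLieMonomial k n q i w}

/-- A system of radical variables `y`: a finite basis of the derived algebra that consists of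
homogeneous elements, together with their degrees. Hall bases are of this kind. -/
structure RadicalBasis (r : ℕ) where
  vec : Fin r → NilLie k n q
  deg : Fin r → ℕ
  two_le_deg : ∀ u, 2 ≤ deg u
  vec_mem : ∀ u, vec u ∈ lieComp k n q (deg u)
  linearIndependent : LinearIndependent k vec
  span_eq : Submodule.span k (Set.range vec) =
    (LieModule.lowerCentralSeries k (NilLie k n q) (NilLie k n q) 1).toSubmodule

/-- The algebra `S_q`. -/
abbrev Sq : Type u := UniversalEnvelopingAlgebra k (NilLie k n q)

/-- The variable `x_j` of `S_q`. -/
def X (j : Fin (n + 1)) : Sq k n q := UniversalEnvelopingAlgebra.ι k (lieGen k n q j)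

variable {k n q}

/-- The variable `y_u` of `S_q`. -/
def RadicalBasis.Y {r : ℕ} (y : RadicalBasis k n q r) (u : Fin r) : Sq k n q :=
  UniversalEnvelopingAlgebra.ι k (y.vec u)

/-- The weighted degree `⟨α⟩` of `y ^ α`. -/
def RadicalBasis.weight {r : ℕ} (y : RadicalBasis k n q r) (α : Fin r → ℕ) : ℕ :=
  ∑ u, α u * y.deg u

/-- The ordered monomial `x ^ β y ^ α` of `S_q`. -/
def RadicalBasis.mon {r : ℕ} (y : RadicalBasis k n q r) (β : Fin (n + 1) → ℕ) (α : Fin r → ℕ) :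
    Sq k n q :=
  orderedMonomial (X k n q) β * orderedMonomial y.Y α

/-- The subspace `S ⊗ R_q^m⟨y⟩` of `S_q`. -/
def RadicalBasis.piece {r : ℕ} (y : RadicalBasis k n q r) (m : ℕ) : Submodule k (Sq k n q) :=
  Submodule.span k {a | ∃ β α, y.weight α = m ∧ a = y.mon β α}

/-- The subspace `S^e ⊗ R_q^m⟨y⟩` of `S_q`. -/
def RadicalBasis.bipiece {r : ℕ} (y : RadicalBasis k n q r) (e m : ℕ) :
    Submodule k (Sq k n q) :=
  Submodule.span k {a | ∃ β α, ∑ j, β j = e ∧ y.weight α = m ∧ a = y.mon β α}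

/-- The homogeneous component `S_q^d = ⨁ₘ S^(d-m) ⊗ R_q^m⟨y⟩` of `S_q`. -/
def RadicalBasis.comp {r : ℕ} (y : RadicalBasis k n q r) (d : ℕ) : Submodule k (Sq k n q) :=
  ⨆ m ∈ Finset.range (d + 1), y.bipiece (d - m) m

/-- The ideal `J_s(x) = ⨁_{m ≥ s} S ⊗ R_q^m⟨y⟩` of the NC-filtration of `S_q`. -/
def RadicalBasis.J {r : ℕ} (y : RadicalBasis k n q r) (s : ℕ) : Submodule k (Sq k n q) :=
  Submodule.span k {a | ∃ β α, s ≤ y.weight α ∧ a = y.mon β α}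

theorem RadicalBasis.J_anti {r : ℕ} (y : RadicalBasis k n q r) {s t : ℕ} (h : s ≤ t) :
    y.J t ≤ y.J s := by
  refine Submodule.span_mono ?_
  rintro a ⟨β, α, hα, rfl⟩
  exact ⟨β, α, h.trans hα, rfl⟩

/-- The underlying `k`-subspace of a two-sided ideal. -/
def idealSubspace {B : Type u} [Ring B] [Algebra k B] (I : TwoSidedIdeal B) : Submodule k B :=
  I.asIdeal.restrictScalars k

/-- An NC-graded ideal: a two-sided ideal `I` with `I = ⨁ I^d`, where `I^d = I ∩ S_q^d`, and
`I^d = ⨁ₘ I^d ∩ (S^(d-m) ⊗ R_q^m⟨y⟩)` for every `d`. -/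
structure RadicalBasis.IsNCGraded {r : ℕ} (y : RadicalBasis k n q r)
    (I : TwoSidedIdeal (Sq k n q)) : Prop where
  graded : idealSubspace I = ⨆ d, idealSubspace I ⊓ y.comp d
  nc_graded : ∀ d, idealSubspace I ⊓ y.comp d =
    ⨆ m ∈ Finset.range (d + 1), idealSubspace I ⊓ y.comp d ⊓ y.bipiece (d - m) m

/-- The subspace `I_m = ⨁ₑ I^(e+m) ∩ (S^e ⊗ R_q^m⟨y⟩)` attached to an ideal `I`. -/
def RadicalBasis.idealPiece {r : ℕ} (y : RadicalBasis k n q r) (I : TwoSidedIdeal (Sq k n q))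
    (m : ℕ) : Submodule k (Sq k n q) :=
  ⨆ e, idealSubspace I ⊓ y.comp (e + m) ⊓ y.bipiece e m

end Lie

/-! ## The partial derivatives of `S_q` -/

section Deriv

attribute [local instance 100] LieRing.ofAssociativeRing

variable (k : Type u) [Field k] (n q : ℕ)

/-- The linear functional on the free Lie algebra with `x_i ↦ δ_ij` that vanishes on brackets. -/
def coordFree (j : Fin (n + 1)) : FreeLieAlgebra k (Fin (n + 1)) →ₗ⁅k⁆ k :=
  FreeLieAlgebra.lift k (Pi.single j 1)

theorem coordFree_lie (j : Fin (n + 1)) (v w : FreeLieAlgebra k (Fin (n + 1))) :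
    coordFree k n j ⁅v, w⁆ = 0 := by
  rw [LieHom.map_lie, LieRing.of_associative_ring_bracket, mul_comm, sub_self]

theorem coordFree_lcs (hq : q ≠ 0) (j : Fin (n + 1)) :
    (LieModule.lowerCentralSeries k (FreeLieAlgebra k (Fin (n + 1)))
      (FreeLieAlgebra k (Fin (n + 1))) q).toSubmodule ≤
      LinearMap.ker (coordFree k n j : FreeLieAlgebra k (Fin (n + 1)) →ₗ[k] k) := by
  obtain ⟨p, rfl⟩ := Nat.exists_eq_succ_of_ne_zero hq
  rw [Nat.succ_eq_add_one, LieModule.lowerCentralSeries_succ,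
    LieSubmodule.lieIdeal_oper_eq_linear_span', Submodule.span_le]
  rintro _ ⟨v, _, w, _, rfl⟩
  exact coordFree_lie k n j v w

variable [NeZero q]

/-- The linear functional on the free nilpotent Lie algebra with `x_i ↦ δ_ij` that vanishes on
brackets. -/
def coord (j : Fin (n + 1)) : NilLie k n q →ₗ[k] k :=
  Submodule.liftQ _ _ (coordFree_lcs k n q (NeZero.ne q) j)

theorem coord_lie (j : Fin (n + 1)) (v w : NilLie k n q) : coord k n q j ⁅v, w⁆ = 0 := by
  obtain ⟨v, rfl⟩ := LieSubmodule.Quotient.surjective_mk' _ v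
  obtain ⟨w, rfl⟩ := LieSubmodule.Quotient.surjective_mk' _ w
  exact coordFree_lie k n j v w

/-- The Lie algebra homomorphism `w ↦ w + ε ∂_j w` into the dual numbers over `S_q`. -/
def lieDual (j : Fin (n + 1)) : NilLie k n q →ₗ⁅k⁆ DualNumber (Sq k n q) where
  toFun w := TrivSqZeroExt.inl (UniversalEnvelopingAlgebra.ι k w) +
    TrivSqZeroExt.inr (coord k n q j w • (1 : Sq k n q))
  map_add' v w := by ext <;> simp [add_smul]
  map_smul' r w := by ext <;> simp [mul_smul]
  map_lie' {v w} := by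
    ext
    · simp [LieRing.of_associative_ring_bracket]
    · simp [LieRing.of_associative_ring_bracket, coord_lie, add_comm]

/-- The algebra homomorphism `a ↦ a + ε ∂_j a`, where `∂_j` is the derivation of `S_q` with
`∂_j x_i = δ_ij` and `∂_j y_u = 0`. -/
def partialHom (j : Fin (n + 1)) : Sq k n q →ₐ[k] DualNumber (Sq k n q) :=
  UniversalEnvelopingAlgebra.lift k (lieDual k n q j)

theorem partialHom_ι (j : Fin (n + 1)) (w : NilLie k n q) :
    partialHom k n q j (UniversalEnvelopingAlgebra.ι k w) =
      TrivSqZeroExt.inl (UniversalEnvelopingAlgebra.ι k w) +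
        TrivSqZeroExt.inr (coord k n q j w • (1 : Sq k n q)) :=
  UniversalEnvelopingAlgebra.lift_ι_apply k (lieDual k n q j) w

theorem fst_partialHom (j : Fin (n + 1)) (a : Sq k n q) : (partialHom k n q j a).fst = a := by
  have h : (TrivSqZeroExt.fstHom k (Sq k n q) (Sq k n q)).comp (partialHom k n q j) =
      AlgHom.id k (Sq k n q) := by
    refine UniversalEnvelopingAlgebra.hom_ext k (LieHom.ext fun w => ?_)
    change (partialHom k n q j (UniversalEnvelopingAlgebra.ι k w)).fst = _
    rw [partialHom_ι]
    simp
  exact DFunLike.congr_fun h a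

variable {k n q}

theorem coord_vec {r : ℕ} (y : RadicalBasis k n q r) (j : Fin (n + 1)) (u : Fin r) :
    coord k n q j (y.vec u) = 0 := by
  have h : y.vec u ∈ (LieModule.lowerCentralSeries k (NilLie k n q) (NilLie k n q) 1).toSubmodule :=
    y.span_eq ▸ Submodule.subset_span (Set.mem_range_self u)
  have h' : (LieModule.lowerCentralSeries k (NilLie k n q) (NilLie k n q) 1).toSubmodule ≤
      LinearMap.ker (coord k n q j) := by
    have h1 := LieModule.lowerCentralSeries_succ k (NilLie k n q) (NilLie k n q) 0
    rw [zero_add] at h1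
    rw [h1, LieSubmodule.lieIdeal_oper_eq_linear_span', Submodule.span_le]
    rintro _ ⟨v, _, w, _, rfl⟩
    exact coord_lie k n q j v w
  exact h' h

theorem partialHom_orderedMonomial {r : ℕ} (y : RadicalBasis k n q r) (j : Fin (n + 1))
    (α : Fin r → ℕ) :
    partialHom k n q j (orderedMonomial y.Y α) = TrivSqZeroExt.inl (orderedMonomial y.Y α) := by
  have hY : ∀ u, partialHom k n q j (y.Y u) = TrivSqZeroExt.inl (y.Y u) := fun u => by
    rw [RadicalBasis.Y, partialHom_ι, coord_vec]
    simp
  have hl := map_list_prod (TrivSqZeroExt.inlHom (Sq k n q) (Sq k n q))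
    (List.ofFn fun i => y.Y i ^ α i)
  rw [orderedMonomial, map_list_prod]
  refine Eq.trans ?_ hl.symm
  simp only [List.map_ofFn]
  congr 2
  funext u
  simp [hY]

end Deriv

/-! ## The topological localization -/

section TopLoc

variable {k : Type u} [Field k] {n q : ℕ} {r : ℕ} (y : RadicalBasis k n q r)
  (h : MvPolynomial (Fin (n + 1)) k)

/-- The NC-nilpotent quotient `S_q / J_s(x)`. -/
abbrev NilQuot (s : ℕ) : Type u := RingQuot fun a b : Sq k n q => a ∈ y.J s ∧ b = 0

/-- The quotient map `S_q → S_q / J_s(x)`. -/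
def NilQuot.mk (s : ℕ) : Sq k n q →ₐ[k] NilQuot y s :=
  RingQuot.mkAlgHom k fun a b : Sq k n q => a ∈ y.J s ∧ b = 0

theorem NilQuot.mk_eq_zero {s : ℕ} {a : Sq k n q} (ha : a ∈ y.J s) : NilQuot.mk y s a = 0 :=
  (RingQuot.mkAlgHom_rel k ⟨ha, rfl⟩).trans (map_zero _)

/-- The universal property of `S_q / J_s(x)`. -/
def NilQuot.lift {C : Type u} [Ring C] [Algebra k C] (s : ℕ) (f : Sq k n q →ₐ[k] C)
    (hf : ∀ a ∈ y.J s, f a = 0) : NilQuot y s →ₐ[k] C :=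
  RingQuot.liftAlgHom k ⟨f, by
    rintro a b ⟨ha, rfl⟩
    rw [hf a ha, map_zero]⟩

theorem NilQuot.lift_mk {C : Type u} [Ring C] [Algebra k C] (s : ℕ) (f : Sq k n q →ₐ[k] C)
    (hf : ∀ a ∈ y.J s, f a = 0) (a : Sq k n q) :
    NilQuot.lift y s f hf (NilQuot.mk y s a) = f a :=
  RingQuot.liftAlgHom_mkAlgHom_apply k _ _ _

/-- The value `h(x)` of the ordered calculus in `S_q`. -/
def hx : Sq k n q := orderedCalc k (X k n q) h

/-- The localization of `S_q / J_s(x)` at `h(x)`. -/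
abbrev Q (s : ℕ) : Type u := InvLoc k (NilQuot.mk y s (hx h))

/-- The canonical homomorphism from `S_q` to the localization of `S_q / J_s(x)`. -/
def Q.of (s : ℕ) : Sq k n q →ₐ[k] Q y h s :=
  (InvLoc.of k (NilQuot.mk y s (hx h))).comp (NilQuot.mk y s)

/-- The inverse of `h(x)` in the localization of `S_q / J_s(x)`. -/
def Q.inv (s : ℕ) : Q y h s := InvLoc.inv k (NilQuot.mk y s (hx h))

theorem Q.of_mul_inv (s : ℕ) : Q.of y h s (hx h) * Q.inv y h s = 1 := InvLoc.of_mul_inv k _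

theorem Q.inv_mul_of (s : ℕ) : Q.inv y h s * Q.of y h s (hx h) = 1 := InvLoc.inv_mul_of k _

theorem Q.of_eq_zero {s : ℕ} {a : Sq k n q} (ha : a ∈ y.J s) : Q.of y h s a = 0 := by
  rw [Q.of, AlgHom.comp_apply, NilQuot.mk_eq_zero y ha, map_zero]

/-- The universal property of the localization of `S_q / J_s(x)`. -/
def Q.lift {C : Type u} [Ring C] [Algebra k C] (s : ℕ) (f : Sq k n q →ₐ[k] C)
    (hf : ∀ a ∈ y.J s, f a = 0) (c : C) (h₁ : f (hx h) * c = 1) (h₂ : c * f (hx h) = 1) :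
    Q y h s →ₐ[k] C :=
  InvLoc.lift k _ (NilQuot.lift y s f hf) c (by rw [NilQuot.lift_mk, h₁])
    (by rw [NilQuot.lift_mk, h₂])

theorem Q.lift_of {C : Type u} [Ring C] [Algebra k C] (s : ℕ) (f : Sq k n q →ₐ[k] C)
    (hf : ∀ a ∈ y.J s, f a = 0) (c : C) (h₁ : f (hx h) * c = 1) (h₂ : c * f (hx h) = 1)
    (a : Sq k n q) : Q.lift y h s f hf c h₁ h₂ (Q.of y h s a) = f a := by
  rw [Q.lift, Q.of, AlgHom.comp_apply, InvLoc.lift_of, NilQuot.lift_mk]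

theorem Q.lift_inv {C : Type u} [Ring C] [Algebra k C] (s : ℕ) (f : Sq k n q →ₐ[k] C)
    (hf : ∀ a ∈ y.J s, f a = 0) (c : C) (h₁ : f (hx h) * c = 1) (h₂ : c * f (hx h) = 1) :
    Q.lift y h s f hf c h₁ h₂ (Q.inv y h s) = c := by
  rw [Q.lift, Q.inv, InvLoc.lift_inv]

theorem Q.algHom_ext {C : Type u} [Ring C] [Algebra k C] {s : ℕ} {f g : Q y h s →ₐ[k] C}
    (hfg : ∀ a, f (Q.of y h s a) = g (Q.of y h s a)) : f = g := by
  refine InvLoc.algHom_ext k _ fun b => ?_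
  obtain ⟨a, rfl⟩ := RingQuot.mkAlgHom_surjective k _ b
  exact hfg a

/-- The transition homomorphism of the inverse system of localizations. -/
def Q.trans (s : ℕ) : Q y h (s + 1) →ₐ[k] Q y h s :=
  Q.lift y h (s + 1) (Q.of y h s) (fun _ ha => Q.of_eq_zero y h (y.J_anti s.le_succ ha))
    (Q.inv y h s) (Q.of_mul_inv y h s) (Q.inv_mul_of y h s)

theorem Q.trans_of (s : ℕ) (a : Sq k n q) :
    Q.trans y h s (Q.of y h (s + 1) a) = Q.of y h s a :=
  Q.lift_of y h _ _ _ _ _ _ a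

/-- The algebras of the inverse system are discrete. -/
instance (s : ℕ) : TopologicalSpace (Q y h s) := ⊥

instance (s : ℕ) : DiscreteTopology (Q y h s) := ⟨rfl⟩

/-- The topological localization `S_{q,h(x)}`: the inverse limit of the localizations at `h(x)` of
the NC-nilpotent quotients `S_q / J_s(x)`, with the inverse limit topology. -/
def topLoc : Subalgebra k (∀ s, Q y h s) where
  carrier := {u | ∀ s, Q.trans y h s (u (s + 1)) = u s}
  mul_mem' := fun {u v} hu hv s => by
    rw [Pi.mul_apply, map_mul, hu s, hv s, Pi.mul_apply]
  add_mem' := fun {u v} hu hv s => by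
    rw [Pi.add_apply, map_add, hu s, hv s, Pi.add_apply]
  algebraMap_mem' := fun a s => by
    rw [Pi.algebraMap_apply, Pi.algebraMap_apply, AlgHom.commutes]

/-- The canonical homomorphism `S_q → S_{q,h(x)}`. -/
def topLoc.of : Sq k n q →ₐ[k] topLoc y h :=
  AlgHom.codRestrict (AlgHom.pi fun s => Q.of y h s) (topLoc y h) fun a _ =>
    Q.lift_of y h _ _ _ _ _ _ a

/-- The inverse of `h(x)` in `S_{q,h(x)}`. -/
def topLoc.inv : topLoc y h :=
  ⟨fun s => Q.inv y h s, fun _ => Q.lift_inv y h _ _ _ _ _ _⟩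

/-- The topological localization `I_{h(x)}` of an ideal: the closure of the linear span of the
noncommutative right fractions `a * h(x) ^ (-d)`. -/
def idealTopLoc (I : TwoSidedIdeal (Sq k n q)) : Submodule k (topLoc y h) :=
  (Submodule.span k {u | ∃ a ∈ I, ∃ d : ℕ, u = topLoc.of y h a * topLoc.inv y h ^ d}
    ).topologicalClosure

/-- The product `∏ₘ C m` of subspaces `C m` of `S_{q,h(x)}`: the space of all sums of convergent
series `∑ₘ u m` with `u m ∈ C m`. -/
def prodSubspace (C : ℕ → Submodule k (topLoc y h)) : Submodule k (topLoc y h) where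
  carrier := {u | ∃ f : ℕ → topLoc y h, (∀ m, f m ∈ C m) ∧ HasSum f u}
  zero_mem' := ⟨fun _ => 0, fun m => (C m).zero_mem, hasSum_zero⟩
  add_mem' := by
    rintro u v ⟨f, hf, hu⟩ ⟨g, hg, hv⟩
    exact ⟨fun m => f m + g m, fun m => (C m).add_mem (hf m) (hg m), hu.add hv⟩
  smul_mem' := by
    rintro c u ⟨f, hf, hu⟩
    exact ⟨fun m => c • f m, fun m => (C m).smul_mem c (hf m), hu.const_smul c⟩

end TopLoc

/-! ## Commutative fractions -/

section Fractions

variable {k : Type u} [Field k] {n q : ℕ} [NeZero q] {r : ℕ} (y : RadicalBasis k n q r)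
  (h : MvPolynomial (Fin (n + 1)) k)

/-- The homomorphism `a ↦ a + ε ∂_j a` from `S_q` to the dual numbers over the localization of
`S_q / J_s(x)`. -/
def Q.preDual (s : ℕ) (j : Fin (n + 1)) : Sq k n q →ₐ[k] DualNumber (Q y h s) :=
  (dualMap (Q.of y h s)).comp (partialHom k n q j)

theorem Q.fst_preDual (s : ℕ) (j : Fin (n + 1)) (a : Sq k n q) :
    (Q.preDual y h s j a).fst = Q.of y h s a := by
  rw [Q.preDual, AlgHom.comp_apply, fst_dualMap, fst_partialHom]

theorem Q.snd_preDual (s : ℕ) (j : Fin (n + 1)) (a : Sq k n q) :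
    (Q.preDual y h s j a).snd = Q.of y h s (partialHom k n q j a).snd := by
  rw [Q.preDual, AlgHom.comp_apply, snd_dualMap]

theorem Q.preDual_eq_zero (s : ℕ) (j : Fin (n + 1)) (a : Sq k n q) (ha : a ∈ y.J s) :
    Q.preDual y h s j a = 0 := by
  refine Submodule.span_induction (p := fun a _ => Q.preDual y h s j a = 0) ?_ (map_zero _)
    ?_ ?_ ha
  · rintro a ⟨β, α, hα, rfl⟩
    have h0 : Q.of y h s (orderedMonomial y.Y α) = 0 := by
      refine Q.of_eq_zero y h (Submodule.subset_span ⟨0, α, hα, ?_⟩)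
      simp [RadicalBasis.mon, orderedMonomial]
    rw [RadicalBasis.mon, map_mul]
    refine mul_eq_zero_of_right _ ?_
    refine TrivSqZeroExt.ext ?_ ?_
    · rw [Q.fst_preDual, h0, TrivSqZeroExt.fst_zero]
    · rw [Q.snd_preDual, partialHom_orderedMonomial, TrivSqZeroExt.snd_inl, map_zero,
        TrivSqZeroExt.snd_zero]
  · intro a b _ _ ha hb
    rw [map_add, ha, hb, add_zero]
  · intro c a _ ha
    rw [map_smul, ha, smul_zero]

/-- The homomorphism `u ↦ u + ε ∂_j u`, where `∂_j` is the unique extension to the localization of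
`S_q / J_s(x)` of the derivation `∂_j` of `S_q`. -/
def Q.partialHom (s : ℕ) (j : Fin (n + 1)) : Q y h s →ₐ[k] DualNumber (Q y h s) :=
  Q.lift y h s (Q.preDual y h s j) (Q.preDual_eq_zero y h s j)
    (dualInv (Q.preDual y h s j (hx h)) (Q.inv y h s))
    (mul_dualInv _ _ (by rw [Q.fst_preDual, Q.of_mul_inv]))
    (dualInv_mul _ _ (by rw [Q.fst_preDual, Q.inv_mul_of]))

theorem Q.partialHom_of (s : ℕ) (j : Fin (n + 1)) (a : Sq k n q) :
    Q.partialHom y h s j (Q.of y h s a) = Q.preDual y h s j a :=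
  Q.lift_of y h _ _ _ _ _ _ a

theorem Q.partialHom_trans (s : ℕ) (j : Fin (n + 1)) (u : Q y h (s + 1)) :
    dualMap (Q.trans y h s) (Q.partialHom y h (s + 1) j u) =
      Q.partialHom y h s j (Q.trans y h s u) := by
  have H : (dualMap (Q.trans y h s)).comp (Q.partialHom y h (s + 1) j) =
      (Q.partialHom y h s j).comp (Q.trans y h s) := by
    refine Q.algHom_ext y h fun a => ?_
    have e1 := Q.partialHom_of y h (s + 1) j a
    have e2 := Q.trans_of y h s a
    have e3 := Q.partialHom_of y h s j a
    have e4 : dualMap (Q.trans y h s) (Q.preDual y h (s + 1) j a) = Q.preDual y h s j a := by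
      refine TrivSqZeroExt.ext ?_ ?_
      · exact ((fst_dualMap _ _).trans (congrArg _ (Q.fst_preDual y h (s + 1) j a))).trans
          (e2.trans (Q.fst_preDual y h s j a).symm)
      · exact ((snd_dualMap _ _).trans (congrArg _ (Q.snd_preDual y h (s + 1) j a))).trans
          ((Q.trans_of y h s _).trans (Q.snd_preDual y h s j a).symm)
    exact ((congrArg (dualMap (Q.trans y h s)) e1).trans e4).trans
      ((congrArg (Q.partialHom y h s j) e2).trans e3).symm
  exact DFunLike.congr_fun H u

/-- The partial derivative `∂_j` on `S_{q,h(x)}`. -/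
def partialD (j : Fin (n + 1)) : Module.End k (topLoc y h) where
  toFun u := ⟨fun s => (Q.partialHom y h s j (u.1 s)).snd, fun s => by
    have h1 := congrArg TrivSqZeroExt.snd (Q.partialHom_trans y h s j (u.1 (s + 1)))
    rw [snd_dualMap, u.2 s] at h1
    exact h1⟩
  map_add' u v := by
    ext s
    simp
  map_smul' c u := by
    ext s
    simp

/-- The diagonal operator on `S_{q,h(x)} = ∏ₘ S_h ⊗ R_q^m⟨y⟩` given by the commutative
multiplication by `x_j`: it sends an ordered monomial `x ^ β y ^ α` to `x ^ (β + e_j) y ^ α`. In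
terms of the multiplication of `S_{q,h(x)}` it is
`u ↦ ∑ (1 / i!) ad(x₀) ^ i₀ ⋯ ad(x_{j-1}) ^ i_{j-1} (x_j) * ∂₀ ^ i₀ ⋯ ∂_{j-1} ^ i_{j-1} u`,
where the terms with some `i_t ≥ q` vanish because the Lie algebra is nilpotent. -/
def diagX (j : Fin (n + 1)) : Module.End k (topLoc y h) :=
  ∑ i : Fin j → Fin q, (∏ t, ((i t : ℕ).factorial : k))⁻¹ •
    (LinearMap.mulLeft k (topLoc.of y h (UniversalEnvelopingAlgebra.ι k
        ((List.ofFn fun t : Fin j => LieAlgebra.ad k (NilLie k n q)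
          (lieGen k n q (t.castLE j.is_lt.le)) ^ (i t : ℕ)).prod (lieGen k n q j)))) *
      orderedMonomial (fun t : Fin j => partialD y h (t.castLE j.is_lt.le)) fun t => (i t : ℕ))

/-- The diagonal operator on `S_{q,h(x)} = ∏ₘ S_h ⊗ R_q^m⟨y⟩` given by the commutative
multiplication by `h`. -/
def diagH : Module.End k (topLoc y h) := orderedCalc k (diagX y h) h

/-- The commutative localization `N_h` in `S_{q,h(x)} = ∏ₘ S_h ⊗ R_q^m⟨y⟩` of an `S`-submodule `N`
of `S_q`: the space of the commutative fractions `u = a / h ^ l`, `a ∈ N`, that is, of the `u`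
such that the commutative product of `h ^ l` and `u` is `a`. -/
def commLoc (N : Submodule k (Sq k n q)) : Submodule k (topLoc y h) :=
  Submodule.span k {u | ∃ l : ℕ, ∃ a ∈ N, (diagH y h ^ l) u = topLoc.of y h a}

/-- The subspace `S_h^e ⊗ R_q^m⟨y⟩` of `S_{q,h(x)}`, for a homogeneous `h`. -/
def locBipiece (e : ℤ) (m : ℕ) : Submodule k (topLoc y h) :=
  Submodule.span k {u | ∃ l d : ℕ, (d : ℤ) = e + l * h.totalDegree ∧
    ∃ a ∈ y.bipiece d m, (diagH y h ^ l) u = topLoc.of y h a}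

/-- The homogeneous component `S_{q,h(x)}^d = ∏ₘ S_h^(d-m) ⊗ R_q^m⟨y⟩`. -/
def locComp (d : ℤ) : Submodule k (topLoc y h) :=
  prodSubspace y h fun m => locBipiece y h (d - m) m

/-- The subspace `I_{m,h}`. -/
def idealPieceLoc (I : TwoSidedIdeal (Sq k n q)) (m : ℕ) : Submodule k (topLoc y h) :=
  commLoc y h (y.idealPiece I m)

/-- The subspace `M = ∏ₘ I_{m,h}`. -/
def prodIdeal (I : TwoSidedIdeal (Sq k n q)) : Submodule k (topLoc y h) :=
  prodSubspace y h (idealPieceLoc y h I)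

/-- The subspace `M^d = ∏ₘ I_{m,h}^(d-m)`, where
`I_{m,h}^e = I_{m,h} ∩ (S_h^e ⊗ R_q^m⟨y⟩)`. -/
def prodIdealComp (I : TwoSidedIdeal (Sq k n q)) (d : ℤ) : Submodule k (topLoc y h) :=
  prodSubspace y h fun m => idealPieceLoc y h I m ⊓ locBipiece y h (d - m) m

end Fractions

end NCProj

end

noncomputable section

namespace NCProj

universe u

set_option linter.unusedSectionVars false

/-! ## Ordered monomials -/

section OrderedMonomial

variable {B C : Type u} [Ring B] [Ring C]

/-! Let $F_s$ be the kernel of the projection of $S_{q,h(\mathbf x)}$ to the localization of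
$S_q/\mathcal J_s$. The $F_s$ form a complete separated filtration. Commutative multiplication by
$h$ is the operator $D$ (`diagH`), a differential operator with coefficients in $S_q$. Commutators
with the $x_j$ raise the weight, so $D$ agrees with left and with right multiplication by $h(\mathbf
x)$ up to operators that raise the filtration by one. As $h(\mathbf x)$ is invertible, completeness
makes $D$ bijective (`D_bijective`), and successive approximation expands every element in a series
of commutative fractions with one term for each weight (`exists_isSum`).

Uniqueness of expansions and directness of sums are obtained from two operators and not from a PBW
basis. The endomorphism $x_j\mapsto 2x_j$ has eigenvalue $2^{e+m}$ on bidegree $(e,m)$, and the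
Euler operator $\sum x_j\partial_j$ has eigenvalue $e$. In characteristic zero the two eigenvalues
determine $(e,m)$, and a subspace stable under both operators contains the summands of any sum of
joint eigenvectors that it contains (`eigenvector_mem_of_sum_mem`). Applied to $0$ in $S_q$ this
gives the bigrading. Applied to the $F_s$ it gives uniqueness of expansions (`IsSum.unique`), and
with it the closedness of products. The component of degree $d$ is where scaling acts by $2^d$, and
scaling is multiplicative, so degrees add.

For the ideal property, an NC-graded $I$ is stable under $D$, because the commutative product of
$x_j$ with a bihomogeneous $a\in I$ is the component of lowest weight of $x_ja\in I$ (`diagXU_mem`).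
Left and right multiplications by elements of $S_q$ are ad-nilpotent with respect to $D$
(`L_mem_adNil`, `R_mem_adNil`). Hence such a multiplication $P$ satisfies an Ore identity
$D^LP=P'D^l$ with $P'$ preserving $I$, and so it preserves the commutative fractions of $I$.
Multiplication by $h(\mathbf x)^{-1}$ is compared with $D^{-1}$. On fractions with numerators in
$I\cap\mathcal J_t$ the two differ, modulo any $F_N$, by fractions with numerators in $I\cap\mathcal
J_{t+1}$ (`inv_sub_mem`). So $M$, which is the intersection over $N$ of the sums of the commutative
fractions of $I$ and $F_N$ (`mem_prodPieces_iff`), is a two-sided ideal. The same comparison turns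
commutative fractions into right fractions and gives $M=I_{h(\mathbf x)}$.

Identities between differential operators on the localization are checked on $S_q$. Each operator
has a normal form $\sum a_\beta\partial^\beta$, and action on the monomials $\mathbf x^s$ detects
its coefficients (`eq_zero_of_act_eq_zero`). On $S_q$ itself the operators act on $p$ in $p(\mathbf
x)\mathbf y^\alpha$ as in the commutative polynomial ring (`diagXU_ev_mul`). -/

theorem orderedMonomial_zero_vars (x : Fin 0 → B) (β : Fin 0 → ℕ) : orderedMonomial x β = 1 := by
  simp [orderedMonomial]

theorem orderedMonomial_succ {p : ℕ} (x : Fin (p + 1) → B) (β : Fin (p + 1) → ℕ) :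
    orderedMonomial x β =
      x 0 ^ β 0 * orderedMonomial (fun i => x i.succ) (fun i => β i.succ) := by
  simp [orderedMonomial, List.ofFn_succ]

theorem orderedMonomial_zero {p : ℕ} (x : Fin p → B) : orderedMonomial x 0 = 1 := by
  simp [orderedMonomial]

theorem map_orderedMonomial {F : Type*} [FunLike F B C] [RingHomClass F B C] (f : F) {p : ℕ}
    (x : Fin p → B) (β : Fin p → ℕ) :
    f (orderedMonomial x β) = orderedMonomial (fun i => f (x i)) β := by
  simp only [orderedMonomial, map_list_prod, List.map_ofFn]
  congr 2
  funext i
  simp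

theorem orderedMonomial_mem {S : Type*} [SetLike S B] [SubmonoidClass S B] (s : S) {p : ℕ}
    {x : Fin p → B} (hx : ∀ i, x i ∈ s) (β : Fin p → ℕ) : orderedMonomial x β ∈ s := by
  refine list_prod_mem fun a ha => ?_
  obtain ⟨i, rfl⟩ := (List.mem_ofFn' _ _).1 ha
  exact pow_mem (hx i) _

theorem commute_orderedMonomial {p : ℕ} {x : Fin p → B} {a : B} (hx : ∀ i, Commute a (x i))
    (β : Fin p → ℕ) : Commute a (orderedMonomial x β) := by
  refine Commute.list_prod_right _ _ fun b hb => ?_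
  obtain ⟨i, rfl⟩ := (List.mem_ofFn' _ _).1 hb
  exact (hx i).pow_right _

/-- Ordered monomials in commuting elements. -/
theorem orderedMonomial_add_single {p : ℕ} {x : Fin p → B} (hx : ∀ i j, Commute (x i) (x j))
    (β : Fin p → ℕ) (j : Fin p) :
    orderedMonomial x (β + Pi.single j 1) = x j * orderedMonomial x β := by
  induction p with
  | zero => exact j.elim0
  | succ p ih =>
    rw [orderedMonomial_succ, orderedMonomial_succ]
    cases j using Fin.cases with
    | zero =>
      have h : (fun i : Fin p => (β + Pi.single 0 1 : Fin (p + 1) → ℕ) i.succ) = fun i => β i.succ := by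
        funext i
        simp
      rw [h, Pi.add_apply, Pi.single_eq_same, pow_succ', mul_assoc]
    | succ j =>
      have h : (fun i : Fin p => (β + Pi.single j.succ 1 : Fin (p + 1) → ℕ) i.succ) =
          (fun i => β i.succ) + Pi.single j 1 := by
        funext i
        simp [Pi.single_apply]
      rw [h, ih (fun a b => hx _ _), Pi.add_apply, Pi.single_eq_of_ne (Fin.succ_ne_zero j).symm,
        add_zero, ← mul_assoc, ← mul_assoc, ((hx 0 j.succ).pow_left _).eq]

/-- The factor of an ordered monomial after the variable `j`. -/
def orderedTail {p : ℕ} (x : Fin p → B) (β : Fin p → ℕ) (j : Fin p) : B :=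
  ((List.ofFn fun i => x i ^ β i).drop (j + 1)).prod

theorem orderedMonomial_split {p : ℕ} (x : Fin p → B) (β : Fin p → ℕ) (j : Fin p) :
    orderedMonomial x β = orderedMonomial (fun t : Fin j => x (t.castLE j.is_lt.le))
      (fun t => β (t.castLE j.is_lt.le)) * (x j ^ β j * orderedTail x β j) := by
  have h1 : (List.ofFn fun i => x i ^ β i).take j =
      List.ofFn fun t : Fin j => x (t.castLE j.is_lt.le) ^ β (t.castLE j.is_lt.le) := by
    refine List.ext_getElem (by simp) fun i h1 h2 => ?_
    simp [Fin.castLE]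
  rw [orderedMonomial, ← List.prod_take_mul_prod_drop _ (j : ℕ), h1, orderedMonomial, orderedTail]
  congr 1
  rw [List.drop_eq_getElem_cons (by simp), List.prod_cons]
  simp

theorem orderedTail_congr {p : ℕ} (x : Fin p → B) {β γ : Fin p → ℕ} (j : Fin p)
    (h : ∀ i, j < i → β i = γ i) : orderedTail x β j = orderedTail x γ j := by
  rw [orderedTail, orderedTail]
  congr 1
  refine List.ext_getElem (by simp) fun i h1 h2 => ?_
  simp only [List.getElem_drop, List.getElem_ofFn]
  rw [h]
  simp only [Fin.lt_def]
  omega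

variable {k : Type u} [Field k] [Algebra k B] [Algebra k C]

theorem orderedCalc_monomial {p : ℕ} (x : Fin p → B) (β : Fin p →₀ ℕ) :
    orderedCalc k x (MvPolynomial.monomial β 1) = orderedMonomial x β := by
  have h : MvPolynomial.monomial β (1 : k) = MvPolynomial.basisMonomials (Fin p) k β := by simp
  rw [orderedCalc, h, Module.Basis.constr_basis]

theorem mvPolynomial_induction_monomial {p : ℕ} {P : MvPolynomial (Fin p) k → Prop}
    (h1 : ∀ β, P (MvPolynomial.monomial β 1)) (h2 : ∀ f g, P f → P g → P (f + g))
    (h3 : ∀ (c : k) f, P f → P (c • f)) (f : MvPolynomial (Fin p) k) : P f := by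
  refine MvPolynomial.induction_on' f (fun β c => ?_) h2
  have := h3 c _ (h1 β)
  rwa [MvPolynomial.smul_monomial, smul_eq_mul, mul_one] at this

theorem map_orderedCalc (f : B →ₐ[k] C) {p : ℕ} (x : Fin p → B) (g : MvPolynomial (Fin p) k) :
    f (orderedCalc k x g) = orderedCalc k (fun i => f (x i)) g := by
  induction g using mvPolynomial_induction_monomial with
  | h1 β => rw [orderedCalc_monomial, orderedCalc_monomial, map_orderedMonomial]
  | h2 f g hf hg => simp only [map_add, hf, hg]
  | h3 c f hf => simp only [map_smul, hf]

theorem orderedCalc_mem (S : Subalgebra k B) {p : ℕ} {x : Fin p → B} (hx : ∀ i, x i ∈ S)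
    (g : MvPolynomial (Fin p) k) : orderedCalc k x g ∈ S := by
  induction g using mvPolynomial_induction_monomial with
  | h1 β => rw [orderedCalc_monomial]; exact orderedMonomial_mem S hx _
  | h2 f g hf hg => rw [map_add]; exact add_mem hf hg
  | h3 c f hf => rw [map_smul]; exact S.smul_mem hf c

theorem derivation_one {δ : Module.End k B} (hδ : ∀ a b, δ (a * b) = δ a * b + a * δ b) :
    δ 1 = 0 := by
  simpa using hδ 1 1

theorem derivation_orderedMonomial_eq_zero {p : ℕ} {x : Fin p → B} {δ : Module.End k B}
    (hδ : ∀ a b, δ (a * b) = δ a * b + a * δ b) (hx : ∀ i, δ (x i) = 0) (β : Fin p → ℕ) :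
    δ (orderedMonomial x β) = 0 := by
  let K : Submonoid B :=
    { carrier := {a | δ a = 0}
      one_mem' := derivation_one hδ
      mul_mem' := fun {a b} (ha : δ a = 0) (hb : δ b = 0) => by
        change δ (a * b) = 0
        rw [hδ, ha, hb, zero_mul, mul_zero, add_zero] }
  exact orderedMonomial_mem K hx β

/-- A derivation acts on ordered monomials as a partial derivative. -/
theorem derivation_orderedMonomial {p : ℕ} {x : Fin p → B} {δ : Module.End k B}
    (hδ : ∀ a b, δ (a * b) = δ a * b + a * δ b) (j : Fin p)
    (hx : ∀ i, δ (x i) = if i = j then 1 else 0) (β : Fin p → ℕ) :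
    δ (orderedMonomial x β) = (β j : k) • orderedMonomial x (β - Pi.single j 1) := by
  have h1 : δ 1 = 0 := derivation_one hδ
  have hpow0 : ∀ a, δ a = 0 → ∀ b : ℕ, δ (a ^ b) = 0 := fun a ha b => by
    induction b with
    | zero => rw [pow_zero, h1]
    | succ b ih => rw [pow_succ, hδ, ih, ha, zero_mul, mul_zero, add_zero]
  have hpow1 : ∀ a, δ a = 1 → ∀ b : ℕ, δ (a ^ b) = (b : k) • a ^ (b - 1) := fun a ha b => by
    induction b with
    | zero => simp [h1]
    | succ b ih =>
      rw [pow_succ, hδ, ih, ha, mul_one, smul_mul_assoc]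
      cases b with
      | zero => simp
      | succ b => simp [← pow_succ, add_smul]
  induction p with
  | zero => exact j.elim0
  | succ p ih =>
    rw [orderedMonomial_succ, orderedMonomial_succ, hδ]
    cases j using Fin.cases with
    | zero =>
      have h : (fun i : Fin p => (β - Pi.single 0 1 : Fin (p + 1) → ℕ) i.succ) = fun i => β i.succ := by
        funext i
        simp
      have h0 : δ (orderedMonomial (fun i => x i.succ) fun i => β i.succ) = 0 :=
        derivation_orderedMonomial_eq_zero hδ
          (fun i => by rw [hx, if_neg (Fin.succ_ne_zero i)]) _
      rw [h, h0, hpow1 _ (by rw [hx, if_pos rfl])]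
      simp
    | succ j =>
      have h : (fun i : Fin p => (β - Pi.single j.succ 1 : Fin (p + 1) → ℕ) i.succ) =
          (fun i => β i.succ) - Pi.single j 1 := by
        funext i
        simp [Pi.single_apply]
      rw [h, ih j (fun i => by simp [hx]), hpow0 _ (by
        rw [hx, if_neg (Fin.succ_ne_zero j).symm])]
      simp

end OrderedMonomial

/-! ## Eigenvectors modulo an invariant subspace -/

section Eigen

variable {K V : Type*} [Field K] [AddCommGroup V] [Module K V]

/-- The operator `f a - μ a i` preserves `F`, removes the summand `v i`, and multiplies `v₀` by a
nonzero scalar when `a` separates `i` from `i₀`. The other summands remain eigenvectors, so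
induction on `s` applies. -/
theorem smul_add_sum_eigenvectors_mem {ι κ : Type*} [DecidableEq ι] (f : κ → Module.End K V)
    (μ : κ → ι → K) (F : Submodule K V) (hF : ∀ a, ∀ v ∈ F, f a v ∈ F) (i₀ : ι) (s : Finset ι)
    (hs : ∀ i ∈ s, ∃ a, μ a i ≠ μ a i₀) (v₀ : V) (h₀ : ∀ a, f a v₀ = μ a i₀ • v₀) (v : ι → V)
    (hv : ∀ a i, f a (v i) = μ a i • v i) (h : v₀ + ∑ i ∈ s, v i ∈ F) : v₀ ∈ F := by
  induction s using Finset.induction_on generalizing v v₀ with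
  | empty => simpa using h
  | insert i s hi ih =>
    obtain ⟨a, ha⟩ := hs i (Finset.mem_insert_self _ _)
    have h1 := F.sub_mem (hF a _ h) (F.smul_mem (μ a i) h)
    have h2 : f a (v₀ + ∑ j ∈ insert i s, v j) - μ a i • (v₀ + ∑ j ∈ insert i s, v j) =
        (μ a i₀ - μ a i) • v₀ + ∑ j ∈ s, (μ a j - μ a i) • v j := by
      rw [Finset.sum_insert hi]
      simp only [map_add, map_sum, h₀, hv, sub_smul, smul_add, Finset.smul_sum,
        Finset.sum_sub_distrib]
      abel
    rw [h2] at h1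
    have h3 := ih (fun j hj => hs j (Finset.mem_insert_of_mem hj)) _
      (fun b => by rw [map_smul, h₀, smul_comm]) (fun j => (μ a j - μ a i) • v j)
      (fun b j => by rw [map_smul, hv, smul_comm]) h1
    exact (F.smul_mem_iff (sub_ne_zero.2 ha.symm)).1 h3

/-- If a sum of joint eigenvectors with distinct eigenvalues lies in an invariant subspace, so do
the summands. -/
theorem eigenvector_mem_of_sum_mem {ι κ : Type*} (f : κ → Module.End K V)
    (μ : κ → ι → K) (hμ : ∀ i j, i ≠ j → ∃ a, μ a i ≠ μ a j) (F : Submodule K V)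
    (hF : ∀ a, ∀ v ∈ F, f a v ∈ F) (s : Finset ι) (v : ι → V)
    (hv : ∀ a i, f a (v i) = μ a i • v i) (h : ∑ i ∈ s, v i ∈ F) (i : ι) (hi : i ∈ s) :
    v i ∈ F := by
  classical
  rw [← Finset.add_sum_erase s v hi] at h
  exact smul_add_sum_eigenvectors_mem f μ F hF i (s.erase i)
    (fun j hj => hμ j i (Finset.ne_of_mem_erase hj)) (v i) (fun a => hv a i) v hv h

/-- The case `F = ⊥` of the previous theorem. Directness of the bigrading and of the grading by
degree both come from here. -/
theorem iSupIndep_of_eigenvectors {ι κ : Type*} (f : κ → Module.End K V)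
    (μ : κ → ι → K) (hμ : ∀ i j, i ≠ j → ∃ a, μ a i ≠ μ a j) (W : ι → Submodule K V)
    (hW : ∀ a i, ∀ v ∈ W i, f a v = μ a i • v) : iSupIndep W := by
  classical
  rw [iSupIndep_iff_finsetSum_eq_zero_imp_eq_zero]
  intro s v hv h i hi
  have := eigenvector_mem_of_sum_mem f μ hμ ⊥ (by simp) s (fun i => if i ∈ s then v i else 0)
    (fun a i => by
      split_ifs with his
      · exact hW a i _ (hv i his)
      · simp) (by
        rw [Submodule.mem_bot, ← h]
        exact Finset.sum_congr rfl fun i hi => if_pos hi) i hi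
  simpa [hi] using this

end Eigen

/-! ## Words in elements with small commutators -/

section Words

variable {k : Type*} [Field k] {A : Type*} [Ring A] [Algebra k A] {κ : Type*}

/-- The span of the words of weight at least `s` and length at most `l`. -/
def wordSpan (k : Type*) [Field k] {A : Type*} [Ring A] [Algebra k A] {κ : Type*} (b : κ → A)
    (ω : κ → ℕ) (s l : ℕ) : Submodule k A :=
  Submodule.span k {a | ∃ w : List κ, s ≤ (w.map ω).sum ∧ w.length ≤ l ∧ a = (w.map b).prod}

variable {b : κ → A} {ω : κ → ℕ}

theorem wordSpan_mul {s t l m : ℕ} {x z : A} (hx : x ∈ wordSpan k b ω s l)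
    (hz : z ∈ wordSpan k b ω t m) : x * z ∈ wordSpan k b ω (s + t) (l + m) := by
  have := Submodule.mul_mem_mul hx hz
  rw [wordSpan, wordSpan, Submodule.span_mul_span] at this
  refine Submodule.span_mono ?_ this
  rintro _ ⟨_, ⟨v, hv, hv', rfl⟩, _, ⟨w, hw, hw', rfl⟩, rfl⟩
  exact ⟨v ++ w, by simp; omega, by simp; omega, by simp⟩

theorem word_mem_wordSpan (w : List κ) :
    (w.map b).prod ∈ wordSpan k b ω (w.map ω).sum w.length :=
  Submodule.subset_span ⟨w, le_rfl, le_rfl, rfl⟩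

/-- A transposition of neighbours costs a commutator, which by `hb` is a combination of words of
length at most one and no smaller weight. The error is therefore strictly shorter and at least as
heavy, and errors add up along a composition of permutations. -/
theorem perm_sub_mem_wordSpan
    (hb : ∀ i j, b i * b j - b j * b i ∈ wordSpan k b ω (ω i + ω j) 1) {v w : List κ}
    (h : v.Perm w) :
    (v.map b).prod - (w.map b).prod ∈ wordSpan k b ω (v.map ω).sum (v.length - 1) := by
  induction h with
  | nil => simp
  | @cons i v w h ih =>
    -- With truncated subtraction, `1 + (v.length - 1) = v.length` needs a nonempty tail. For an
    -- empty tail the difference is zero.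
    cases v with
    | nil => rw [List.nil_perm.1 h]; simp
    | cons j v =>
      have h1 := wordSpan_mul (word_mem_wordSpan (k := k) (b := b) (ω := ω) [i]) ih
      rw [mul_sub] at h1
      simpa [add_comm] using h1
  | swap i j v =>
    have h1 := wordSpan_mul (hb j i) (word_mem_wordSpan (k := k) (b := b) (ω := ω) v)
    rw [sub_mul, add_comm (ω j)] at h1
    simpa [mul_assoc, add_assoc, add_comm, add_left_comm] using h1
  | @trans u v w h1 h2 ih1 ih2 =>
    rw [← h1.length_eq, ← (h1.map ω).sum_eq] at ih2
    simpa using add_mem ih1 ih2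

/-- Straightening: representatives of the words up to permutation span all words. -/
theorem word_mem_span_of_perm
    (hb : ∀ i j, b i * b j - b j * b i ∈ wordSpan k b ω (ω i + ω j) 1) (R : Set (List κ))
    (hR : ∀ w : List κ, ∃ v ∈ R, w.Perm v) (s l : ℕ) :
    wordSpan k b ω s l ≤
      Submodule.span k {a | ∃ v ∈ R, s ≤ (v.map ω).sum ∧ a = (v.map b).prod} := by
  induction l with
  | zero =>
    refine Submodule.span_le.2 ?_
    rintro _ ⟨w, hw, hw', rfl⟩
    obtain ⟨v, hv, h⟩ := hR w
    rw [List.length_eq_zero_iff.1 (Nat.le_zero.1 hw')] at h hw ⊢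
    rw [List.nil_perm.1 h] at hv
    exact Submodule.subset_span ⟨[], hv, hw, rfl⟩
  | succ l ih =>
    refine Submodule.span_le.2 ?_
    rintro _ ⟨w, hw, hw', rfl⟩
    obtain ⟨v, hv, h⟩ := hR w
    have h1 := perm_sub_mem_wordSpan hb h
    have h2 : (w.map b).prod - (v.map b).prod ∈ wordSpan k b ω s l := by
      refine Submodule.span_mono ?_ h1
      rintro a ⟨u, hu, hu', rfl⟩
      exact ⟨u, hw.trans hu, by omega, rfl⟩
    have h3 : (v.map b).prod ∈
        Submodule.span k {a | ∃ v ∈ R, s ≤ (v.map ω).sum ∧ a = (v.map b).prod} :=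
      Submodule.subset_span ⟨v, hv, hw.trans (h.map ω).sum_eq.le, rfl⟩
    simpa using add_mem (ih h2) h3

end Words

/-! ## Ad-nilpotent elements -/

section AdNil

variable {k : Type u} [Field k] {A : Type u} [Ring A] [Algebra k A]

/-- The inner derivation `P ↦ D * P - P * D`. -/
def innerDer (k : Type u) [Field k] {A : Type u} [Ring A] [Algebra k A] (D : A) : Module.End k A :=
  LinearMap.mulLeft k D - LinearMap.mulRight k D

theorem innerDer_apply (D P : A) : innerDer k D P = D * P - P * D := rfl

theorem innerDer_mul (D P Q : A) :
    innerDer k D (P * Q) = innerDer k D P * Q + P * innerDer k D Q := by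
  simp only [innerDer_apply]
  noncomm_ring

theorem innerDer_pow_succ (D P : A) (p : ℕ) :
    (innerDer k D ^ (p + 1)) P = (innerDer k D ^ p) (innerDer k D P) := by
  rw [pow_succ, Module.End.mul_apply]

theorem innerDer_pow_mono {D P : A} {p r : ℕ} (h : p ≤ r) (hP : (innerDer k D ^ p) P = 0) :
    (innerDer k D ^ r) P = 0 := by
  obtain ⟨t, rfl⟩ := Nat.exists_eq_add_of_le h
  rw [add_comm, pow_add, Module.End.mul_apply, hP, map_zero]

/-- By the Leibniz rule one application of the derivation lowers the nilpotency order of one of the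
two factors. -/
theorem innerDer_pow_mul_eq_zero {D : A} (N p r : ℕ) (hN : p + r ≤ N) {P Q : A}
    (hP : (innerDer k D ^ p) P = 0) (hQ : (innerDer k D ^ r) Q = 0) :
    (innerDer k D ^ N) (P * Q) = 0 := by
  induction N generalizing p r P Q with
  | zero =>
    obtain ⟨rfl, rfl⟩ : p = 0 ∧ r = 0 := by omega
    rw [pow_zero, Module.End.one_apply] at hP
    rw [hP, zero_mul, map_zero]
  | succ N ih =>
    rw [innerDer_pow_succ, innerDer_mul, map_add]
    have e1 : (innerDer k D ^ N) (innerDer k D P * Q) = 0 := by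
      cases p with
      | zero =>
        rw [pow_zero, Module.End.one_apply] at hP
        rw [hP, map_zero, zero_mul, map_zero]
      | succ p => exact ih p r (by omega) (by rwa [← innerDer_pow_succ]) hQ
    have e2 : (innerDer k D ^ N) (P * innerDer k D Q) = 0 := by
      cases r with
      | zero =>
        rw [pow_zero, Module.End.one_apply] at hQ
        rw [hQ, map_zero, mul_zero, map_zero]
      | succ r => exact ih p r (by omega) hP (by rwa [← innerDer_pow_succ])
    rw [e1, e2, add_zero]

/-- The subalgebra of elements on which `ad D` is nilpotent. -/
def adNil (k : Type u) [Field k] {A : Type u} [Ring A] [Algebra k A] (D : A) : Subalgebra k A where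
  carrier := {P | ∃ p : ℕ, (innerDer k D ^ p) P = 0}
  mul_mem' := by
    rintro P Q ⟨p, hp⟩ ⟨r, hr⟩
    exact ⟨p + r, innerDer_pow_mul_eq_zero _ p r le_rfl hp hr⟩
  add_mem' := by
    rintro P Q ⟨p, hp⟩ ⟨r, hr⟩
    refine ⟨max p r, ?_⟩
    rw [map_add, innerDer_pow_mono (le_max_left _ _) hp, innerDer_pow_mono (le_max_right _ _) hr,
      add_zero]
  algebraMap_mem' c := ⟨1, by
    rw [pow_one, innerDer_apply, Algebra.commutes, sub_self]⟩

theorem mem_adNil_of_innerDer_mem {D P : A} (h : innerDer k D P ∈ adNil k D) : P ∈ adNil k D := by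
  obtain ⟨p, hp⟩ := h
  exact ⟨p + 1, by rwa [innerDer_pow_succ]⟩

theorem mem_adNil_of_commute {D P : A} (h : Commute D P) : P ∈ adNil k D :=
  ⟨1, by rw [pow_one, innerDer_apply, h.eq, sub_self]⟩

/-- If `D` is an ordered polynomial in elements commuting with `D`, then ad-nilpotency of the
commutators with these elements suffices. -/
theorem mem_adNil_of_forall {p : ℕ} (x : Fin p → A) (g : MvPolynomial (Fin p) k) {P : A}
    (hx : ∀ j, Commute (orderedCalc k x g) (x j))
    (hP : ∀ j, x j * P - P * x j ∈ adNil k (orderedCalc k x g)) :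
    P ∈ adNil k (orderedCalc k x g) := by
  set D := orderedCalc k x g with hD
  -- Ad-nilpotent elements whose commutator with `P` is also ad-nilpotent form a subalgebra. It
  -- contains every `x j`, hence it contains `D`, and then $[D,P]$ is ad-nilpotent.
  let Z : Subalgebra k A :=
    { carrier := {z | z ∈ adNil k D ∧ z * P - P * z ∈ adNil k D}
      mul_mem' := by
        rintro a b ⟨ha, ha'⟩ ⟨hb, hb'⟩
        refine ⟨mul_mem ha hb, ?_⟩
        have : a * b * P - P * (a * b) = a * (b * P - P * b) + (a * P - P * a) * b := by
          noncomm_ring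
        rw [this]
        exact add_mem (mul_mem ha hb') (mul_mem ha' hb)
      add_mem' := by
        rintro a b ⟨ha, ha'⟩ ⟨hb, hb'⟩
        refine ⟨add_mem ha hb, ?_⟩
        have : (a + b) * P - P * (a + b) = (a * P - P * a) + (b * P - P * b) := by
          noncomm_ring
        rw [this]
        exact add_mem ha' hb'
      algebraMap_mem' := fun c => ⟨Subalgebra.algebraMap_mem _ c, by
        rw [Algebra.commutes, sub_self]
        exact zero_mem _⟩ }
  refine mem_adNil_of_innerDer_mem ?_
  have : D ∈ Z := by
    rw [hD]
    exact orderedCalc_mem Z (fun j => ⟨mem_adNil_of_commute (hx j), hP j⟩) g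
  exact this.2

/-- The Ore condition for an ad-nilpotent element, inside a subspace stable under multiplication
by `D`. -/
theorem exists_pow_mul_eq_mul_pow {D : A} (S : Submodule k A) (h1 : ∀ P ∈ S, D * P ∈ S)
    (h2 : ∀ P ∈ S, P * D ∈ S) {P : A} (hP : P ∈ S) (hn : P ∈ adNil k D) (l : ℕ) :
    ∃ L : ℕ, ∃ P' ∈ S, D ^ L * P = P' * D ^ l := by
  have h1' : ∀ (m : ℕ), ∀ P ∈ S, D ^ m * P ∈ S := fun m P hP => by
    induction m with
    | zero => rwa [pow_zero, one_mul]
    | succ m ih => rw [pow_succ', mul_assoc]; exact h1 _ ih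
  obtain ⟨p, hp⟩ := hn
  induction p generalizing P l with
  | zero =>
    rw [pow_zero, Module.End.one_apply] at hp
    exact ⟨0, 0, S.zero_mem, by rw [hp, mul_zero, zero_mul]⟩
  | succ p ih =>
    induction l with
    | zero => exact ⟨0, P, hP, by simp⟩
    | succ l ihl =>
      obtain ⟨L, P₁, hP₁, e1⟩ := ihl
      obtain ⟨M, P₂, hP₂, e2⟩ := ih (P := innerDer k D P) (S.sub_mem (h1 _ hP) (h2 _ hP)) (l + 1)
        (by rwa [← innerDer_pow_succ])
      -- From $DP=PD+[D,P]$ one gets $D^{L+M+1}P=D^M(D^LP)D+D^L(D^M[D,P])$. The first summand is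
      -- handled by induction on `l`, the second by induction on the nilpotency order.
      refine ⟨L + M + 1, D ^ M * P₁ + D ^ L * P₂, add_mem (h1' _ _ hP₁) (h1' _ _ hP₂), ?_⟩
      have e3 : D * P = P * D + innerDer k D P := by rw [innerDer_apply]; abel
      calc D ^ (L + M + 1) * P = D ^ M * (D ^ L * P) * D + D ^ L * (D ^ M * innerDer k D P) := by
            rw [pow_succ, mul_assoc, e3, mul_add, ← mul_assoc, ← mul_assoc, ← mul_assoc,
              ← pow_add, ← pow_add, add_comm M L]
        _ = _ := by
            rw [e1, e2, add_mul, pow_succ D l]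
            simp only [mul_assoc]

end AdNil

/-! ## Moving a variable to the left -/

section Taylor

variable {k : Type u} [Field k] {B : Type u} [Ring B] [Algebra k B] {𝔤 : Type u} [LieRing 𝔤]
  [LieAlgebra k 𝔤]

/-- Since $\delta^i(\xi v)=\xi\delta^iv+i\,\delta^{i-1}v$ and
$\iota(\mathrm{ad}(\xi)w)=[\iota\xi,\iota w]$, the sum telescopes. Only a boundary term with
$\mathrm{ad}(\xi)^q w=0$ is left. Thus the Taylor-type operator commutes with left multiplication by
$\xi$. -/
theorem sum_ad_mul_derivation [CharZero k] (ι : 𝔤 →ₗ[k] B)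
    (hι : ∀ v w, ι ⁅v, w⁆ = ι v * ι w - ι w * ι v) (ξ : 𝔤) (δ : Module.End k B)
    (hδ : ∀ a b, δ (a * b) = δ a * b + a * δ b) (hξ : δ (ι ξ) = 1) (q : ℕ) (w : 𝔤)
    (hq : (LieAlgebra.ad k 𝔤 ξ ^ q) w = 0) (v : B) :
    ∑ i ∈ Finset.range q, ((i.factorial : k))⁻¹ •
        (ι ((LieAlgebra.ad k 𝔤 ξ ^ i) w) * (δ ^ i) (ι ξ * v)) =
      ι ξ * ∑ i ∈ Finset.range q, ((i.factorial : k))⁻¹ •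
        (ι ((LieAlgebra.ad k 𝔤 ξ ^ i) w) * (δ ^ i) v) := by
  have hpow : ∀ i : ℕ, (δ ^ i) (ι ξ * v) = ι ξ * (δ ^ i) v + (i : k) • (δ ^ (i - 1)) v := by
    intro i
    induction i with
    | zero => simp
    | succ i ih =>
      rw [pow_succ', Module.End.mul_apply, ih, map_add, hδ, hξ, one_mul, map_smul,
        Module.End.mul_apply]
      cases i with
      | zero => simp [add_comm]
      | succ i =>
        rw [Nat.add_sub_cancel, Nat.add_sub_cancel, Nat.cast_succ (i + 1), add_smul, one_smul,
          ← Module.End.mul_apply δ (δ ^ i), ← pow_succ']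
        abel
  -- The truncated identity with its explicit error term.
  have key : ∀ m : ℕ, ∑ i ∈ Finset.range (m + 1), ((i.factorial : k))⁻¹ •
        (ι ((LieAlgebra.ad k 𝔤 ξ ^ i) w) * (δ ^ i) (ι ξ * v)) =
      ι ξ * (∑ i ∈ Finset.range (m + 1), ((i.factorial : k))⁻¹ •
        (ι ((LieAlgebra.ad k 𝔤 ξ ^ i) w) * (δ ^ i) v)) -
      ((m.factorial : k))⁻¹ • (ι ((LieAlgebra.ad k 𝔤 ξ ^ (m + 1)) w) * (δ ^ m) v) := by
    intro m
    induction m with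
    | zero =>
      simp [hι]
      noncomm_ring
    | succ m ih =>
      rw [Finset.sum_range_succ, ih, Finset.sum_range_succ _ (m + 1), hpow,
        pow_succ' _ (m + 1), Module.End.mul_apply, LieAlgebra.ad_apply, hι, Nat.add_sub_cancel]
      have hf : ((m + 1).factorial : k)⁻¹ * ((m + 1 : ℕ) : k) = (m.factorial : k)⁻¹ := by
        have hm1 : ((m + 1 : ℕ) : k) ≠ 0 := Nat.cast_ne_zero.2 m.succ_ne_zero
        rw [Nat.factorial_succ, Nat.cast_mul, mul_inv, mul_right_comm, inv_mul_cancel₀ hm1, one_mul]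
      rw [mul_add, mul_smul_comm, smul_add, smul_smul, hf, mul_add, sub_mul, smul_sub,
        mul_smul_comm, mul_assoc, mul_assoc]
      abel
  cases q with
  | zero => simp
  | succ q => rw [key q, hq]; simp

/-- The expansion of `x ^ β * w * v` into `∑ (1 / i!) ad(x) ^ i (w) * ∂ ^ i (x ^ β * v)`. -/
theorem sum_ad_mul_orderedMonomial [CharZero k] (ι : 𝔤 →ₗ[k] B)
    (hι : ∀ v w, ι ⁅v, w⁆ = ι v * ι w - ι w * ι v) (q : ℕ) (hq0 : 0 < q) {p : ℕ} (ξ : Fin p → 𝔤)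
    (δ : Fin p → Module.End k B) (hδ : ∀ t a b, δ t (a * b) = δ t a * b + a * δ t b)
    (hξ : ∀ t s, δ t (ι (ξ s)) = if s = t then 1 else 0) (hc : ∀ s t, Commute (δ s) (δ t))
    (hq : ∀ t w, (LieAlgebra.ad k 𝔤 (ξ t) ^ q) w = 0) (w : 𝔤) (β : Fin p → ℕ) (v : B)
    (hv : ∀ t, δ t v = 0) :
    ∑ i : Fin p → Fin q, (∏ t, ((i t : ℕ).factorial : k))⁻¹ •
        (ι ((List.ofFn fun t => LieAlgebra.ad k 𝔤 (ξ t) ^ (i t : ℕ)).prod w) *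
          orderedMonomial δ (fun t => (i t : ℕ)) (orderedMonomial (fun t => ι (ξ t)) β * v)) =
      orderedMonomial (fun t => ι (ξ t)) β * (ι w * v) := by
  induction p with
  | zero => simp [orderedMonomial_zero_vars]
  | succ p ih =>
    have ih' := ih (fun t => ξ t.succ) (fun t => δ t.succ) (fun t => hδ _)
      (fun t s => by simp [hξ]) (fun s t => hc _ _) (fun t => hq _) (fun t => β t.succ)
      (fun t => hv _)
    set z := orderedMonomial (fun t : Fin p => ι (ξ t.succ)) (fun t => β t.succ) * v with hz
    have hz0 : δ 0 z = 0 := by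
      rw [hz, hδ, hv, mul_zero, add_zero, derivation_orderedMonomial_eq_zero (hδ 0) (fun i => by
        rw [hξ, if_neg (Fin.succ_ne_zero i)]), zero_mul]
    have hD : ∀ (γ : Fin p → ℕ), orderedMonomial (fun t => δ t.succ) γ (ι (ξ 0) ^ β 0 * z) =
        ι (ξ 0) ^ β 0 * orderedMonomial (fun t => δ t.succ) γ z := fun γ => by
      have hcm : ∀ t : Fin p, Commute (LinearMap.mulLeft k (ι (ξ 0))) (δ t.succ) := fun t => by
        refine LinearMap.ext fun a => ?_
        simp [hδ, hξ, (Fin.succ_ne_zero t).symm]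
      have h1 := commute_orderedMonomial (fun t => (hcm t).pow_left (β 0)) γ
      rw [LinearMap.pow_mulLeft] at h1
      exact (LinearMap.congr_fun h1 z).symm
    have hD0 : ∀ (γ : Fin p → ℕ), δ 0 (orderedMonomial (fun t => δ t.succ) γ z) = 0 := fun γ => by
      have h1 := commute_orderedMonomial (fun t : Fin p => hc 0 t.succ) γ
      rw [← Module.End.mul_apply, h1, Module.End.mul_apply, hz0, map_zero]
    have hpow : ∀ (b : ℕ) (u : 𝔤) (a : B), ∑ i : Fin q, (((i : ℕ).factorial : k))⁻¹ •
        (ι ((LieAlgebra.ad k 𝔤 (ξ 0) ^ (i : ℕ)) u) * (δ 0 ^ (i : ℕ)) (ι (ξ 0) ^ b * a)) =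
        ι (ξ 0) ^ b * ∑ i : Fin q, (((i : ℕ).factorial : k))⁻¹ •
        (ι ((LieAlgebra.ad k 𝔤 (ξ 0) ^ (i : ℕ)) u) * (δ 0 ^ (i : ℕ)) a) := fun b u a => by
      induction b with
      | zero => simp
      | succ b ihb =>
        have := sum_ad_mul_derivation ι hι (ξ 0) (δ 0) (hδ 0) (by rw [hξ, if_pos rfl]) q u
          (hq 0 u) (ι (ξ 0) ^ b * a)
        rw [Finset.sum_range, Finset.sum_range] at this
        rw [pow_succ', mul_assoc, this, ihb, mul_assoc]
    -- The index of the first variable is split off and summed innermost, so that the one-variable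
    -- identity `hpow` moves $x_0^{\beta_0}$ to the front.
    rw [← (Fin.consEquiv fun _ => Fin q).sum_comp, Fintype.sum_prod_type, Finset.sum_comm,
      orderedMonomial_succ, mul_assoc, mul_assoc, ← ih', Finset.mul_sum]
    refine Finset.sum_congr rfl fun i' _ => ?_
    have hs : ∀ i₀ : Fin q, (∏ t, ((((Fin.consEquiv fun _ => Fin q) (i₀, i')) t : ℕ).factorial : k))⁻¹ •
        (ι ((List.ofFn fun t => LieAlgebra.ad k 𝔤 (ξ t) ^
            (((Fin.consEquiv fun _ => Fin q) (i₀, i')) t : ℕ)).prod w) *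
          orderedMonomial δ (fun t => (((Fin.consEquiv fun _ => Fin q) (i₀, i')) t : ℕ))
            (ι (ξ 0) ^ β 0 * z)) =
        (∏ t, ((i' t : ℕ).factorial : k))⁻¹ • (((i₀ : ℕ).factorial : k)⁻¹ •
          (ι ((LieAlgebra.ad k 𝔤 (ξ 0) ^ (i₀ : ℕ))
            ((List.ofFn fun t => LieAlgebra.ad k 𝔤 (ξ t.succ) ^ (i' t : ℕ)).prod w)) *
          (δ 0 ^ (i₀ : ℕ)) (ι (ξ 0) ^ β 0 *
            orderedMonomial (fun t => δ t.succ) (fun t => (i' t : ℕ)) z))) := fun i₀ => by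
      rw [Fin.prod_univ_succ, List.ofFn_succ, orderedMonomial_succ, smul_smul, ← mul_inv, mul_comm]
      simp only [Fin.consEquiv_apply, Fin.cons_zero, Fin.cons_succ, List.prod_cons,
        Module.End.mul_apply, hD]
    rw [Finset.sum_congr rfl fun i₀ _ => hs i₀, ← Finset.smul_sum, hpow, mul_smul_comm]
    congr 2
    -- Once $x_0^{\beta_0}$ is in front, $\partial_0$ kills the remaining factor, which contains
    -- only later variables and `v`. So only the term of index zero survives.
    rw [Finset.sum_eq_single (⟨0, hq0⟩ : Fin q)]
    · simp
    · intro b _ hb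
      have : (b : ℕ) ≠ 0 := fun h => hb (Fin.ext h)
      obtain ⟨m, hm⟩ := Nat.exists_eq_succ_of_ne_zero this
      rw [hm, pow_succ (δ 0), Module.End.mul_apply _ (δ 0), hD0, map_zero, mul_zero, smul_zero]
    · simp

end Taylor

/-! ## The grading of the free nilpotent Lie algebra -/

section LieGrading

variable (k : Type u) [Field k] (n q : ℕ)

/-- The quotient map to the free nilpotent Lie algebra. -/
def nilMk : FreeLieAlgebra k (Fin (n + 1)) →ₗ⁅k⁆ NilLie k n q where
  toFun := LieSubmodule.Quotient.mk
  map_add' _ _ := rfl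
  map_smul' _ _ := rfl
  map_lie' {_ _} := rfl

theorem nilMk_surjective : Function.Surjective (nilMk k n q) :=
  LieSubmodule.Quotient.surjective_mk' _

/-- The endomorphism of the free Lie algebra with `x_j ↦ 2 x_j`. -/
def freeScale : FreeLieAlgebra k (Fin (n + 1)) →ₗ⁅k⁆ FreeLieAlgebra k (Fin (n + 1)) :=
  FreeLieAlgebra.lift k fun j => (2 : k) • FreeLieAlgebra.of k j

theorem freeScale_lcs :
    (LieModule.lowerCentralSeries k (FreeLieAlgebra k (Fin (n + 1)))
      (FreeLieAlgebra k (Fin (n + 1))) q).toSubmodule ≤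
    (LieModule.lowerCentralSeries k (FreeLieAlgebra k (Fin (n + 1)))
      (FreeLieAlgebra k (Fin (n + 1))) q).toSubmodule.comap
      (freeScale k n : FreeLieAlgebra k (Fin (n + 1)) →ₗ[k] FreeLieAlgebra k (Fin (n + 1))) :=
  fun _ hw => LieIdeal.map_lowerCentralSeries_le (f := freeScale k n) q (LieIdeal.mem_map hw)

/-- The endomorphism of the free nilpotent Lie algebra with `x_j ↦ 2 x_j`. Its eigenspaces are the
homogeneous components. -/
def nilScale : NilLie k n q →ₗ⁅k⁆ NilLie k n q where
  toLinearMap := Submodule.mapQ _ _ _ (freeScale_lcs k n q)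
  map_lie' {v w} := by
    obtain ⟨v, rfl⟩ := nilMk_surjective k n q v
    obtain ⟨w, rfl⟩ := nilMk_surjective k n q w
    exact congrArg (nilMk k n q) (LieHom.map_lie (freeScale k n) v w)

theorem nilScale_gen (j : Fin (n + 1)) :
    nilScale k n q (lieGen k n q j) = (2 : k) • lieGen k n q j :=
  congrArg (nilMk k n q) (FreeLieAlgebra.lift_of_apply _ j)

theorem mem_lieSubalgebra_of_gen (S : LieSubalgebra k (NilLie k n q))
    (hS : ∀ j, lieGen k n q j ∈ S) (w : NilLie k n q) : w ∈ S := by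
  obtain ⟨v, rfl⟩ := nilMk_surjective k n q w
  let f : FreeLieAlgebra k (Fin (n + 1)) →ₗ⁅k⁆ S :=
    FreeLieAlgebra.lift k fun j => ⟨lieGen k n q j, hS j⟩
  have h : S.incl.comp f = nilMk k n q := FreeLieAlgebra.hom_ext fun j => by
    change S.incl (f (FreeLieAlgebra.of k j)) = _
    rw [FreeLieAlgebra.lift_of_apply]
    rfl
  rw [← h]
  exact (f v).2

theorem lowerCentralSeries_nilLie_eq_bot :
    LieModule.lowerCentralSeries k (NilLie k n q) (NilLie k n q) q = ⊥ := by
  rw [← LieIdeal.lowerCentralSeries_map_eq q (nilMk_surjective k n q), eq_bot_iff,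
    LieIdeal.map_le_iff_le_comap]
  intro v hv
  exact (LieSubmodule.Quotient.mk_eq_zero').2 hv

theorem lie_mem_lowerCentralSeries_succ {i : ℕ} (v : NilLie k n q) {w : NilLie k n q}
    (hw : w ∈ LieModule.lowerCentralSeries k (NilLie k n q) (NilLie k n q) i) :
    ⁅v, w⁆ ∈ LieModule.lowerCentralSeries k (NilLie k n q) (NilLie k n q) (i + 1) := by
  rw [LieModule.lowerCentralSeries_succ]
  exact LieSubmodule.lie_mem_lie (LieSubmodule.mem_top v) hw

theorem ad_pow_eq_zero (v w : NilLie k n q) : (LieAlgebra.ad k (NilLie k n q) v ^ q) w = 0 := by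
  have h : ∀ i : ℕ, (LieAlgebra.ad k (NilLie k n q) v ^ i) w ∈
      LieModule.lowerCentralSeries k (NilLie k n q) (NilLie k n q) i := by
    intro i
    induction i with
    | zero => exact LieSubmodule.mem_top _
    | succ i ih =>
      rw [pow_succ', Module.End.mul_apply]
      exact lie_mem_lowerCentralSeries_succ k n q v ih
  have := h q
  rwa [lowerCentralSeries_nilLie_eq_bot, LieSubmodule.mem_bot] at this

variable {k n q}

theorem lie_mem_span_of_forall {L : Type*} [LieRing L] [LieAlgebra k L] {A B C : Set L}
    (h : ∀ a ∈ A, ∀ b ∈ B, ⁅a, b⁆ ∈ C) {v w : L} (hv : v ∈ Submodule.span k A)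
    (hw : w ∈ Submodule.span k B) : ⁅v, w⁆ ∈ Submodule.span k C := by
  induction hv using Submodule.span_induction with
  | mem v hv =>
    induction hw using Submodule.span_induction with
    | mem w hw => exact Submodule.subset_span (h v hv w hw)
    | zero => rw [lie_zero]; exact zero_mem _
    | add x y _ _ hx hy => rw [lie_add]; exact add_mem hx hy
    | smul c x _ hx => rw [lie_smul]; exact Submodule.smul_mem _ c hx
  | zero => rw [zero_lie]; exact zero_mem _
  | add x y _ _ hx hy => rw [add_lie]; exact add_mem hx hy
  | smul c x _ hx => rw [smul_lie]; exact Submodule.smul_mem _ c hx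

theorem lie_mem_lieComp {a b : ℕ} {v w : NilLie k n q} (hv : v ∈ lieComp k n q a)
    (hw : w ∈ lieComp k n q b) : ⁅v, w⁆ ∈ lieComp k n q (a + b) :=
  lie_mem_span_of_forall (fun v hv w hw => IsLieMonomial.lie a b v w hv hw) hv hw

theorem nilScale_apply_of_mem {a : ℕ} {v : NilLie k n q} (hv : v ∈ lieComp k n q a) :
    nilScale k n q v = (2 : k) ^ a • v := by
  induction hv using Submodule.span_induction with
  | mem v hv =>
    induction hv with
    | gen j => rw [nilScale_gen, pow_one]
    | lie a b v w _ _ hv hw =>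
      rw [LieHom.map_lie, hv, hw, smul_lie, lie_smul, smul_smul, pow_add]
  | zero => rw [map_zero, smul_zero]
  | add x y _ _ hx hy => rw [map_add, hx, hy, smul_add]
  | smul c x _ hx => rw [map_smul, hx, smul_comm]

variable {r : ℕ} (y : RadicalBasis k n q r)

/-- The generators `x_j` together with the radical variables. -/
def RadicalBasis.gvec : Fin (n + 1) ⊕ Fin r → NilLie k n q := Sum.elim (lieGen k n q) y.vec

/-- The degrees of the basis elements. -/
def RadicalBasis.gdeg : Fin (n + 1) ⊕ Fin r → ℕ := Sum.elim (fun _ => 1) y.deg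

/-- The weights of the basis elements. -/
def RadicalBasis.gweight : Fin (n + 1) ⊕ Fin r → ℕ := Sum.elim (fun _ => 0) y.deg

theorem RadicalBasis.gvec_mem (i : Fin (n + 1) ⊕ Fin r) : y.gvec i ∈ lieComp k n q (y.gdeg i) := by
  cases i with
  | inl j => exact Submodule.subset_span (IsLieMonomial.gen j)
  | inr u => exact y.vec_mem u

/-- Every bracket lies in the derived algebra, which is spanned by the radical variables. The span
is therefore a Lie subalgebra that contains the generators. -/
theorem RadicalBasis.mem_span_gvec (w : NilLie k n q) :
    w ∈ Submodule.span k (Set.range y.gvec) := by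
  have hl : ∀ v w : NilLie k n q, ⁅v, w⁆ ∈ Submodule.span k (Set.range y.gvec) := fun v w => by
    have h : ⁅v, w⁆ ∈ Submodule.span k (Set.range y.vec) := by
      rw [y.span_eq]
      exact lie_mem_lowerCentralSeries_succ k n q v (i := 0) (LieSubmodule.mem_top w)
    refine Submodule.span_mono ?_ h
    rintro _ ⟨u, rfl⟩
    exact ⟨Sum.inr u, rfl⟩
  let S : LieSubalgebra k (NilLie k n q) :=
    { Submodule.span k (Set.range y.gvec) with
      lie_mem' := fun {v w} _ _ => hl v w }
  exact mem_lieSubalgebra_of_gen k n q S (fun j => Submodule.subset_span ⟨Sum.inl j, rfl⟩) w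

theorem two_pow_injective [CharZero k] : Function.Injective fun d : ℕ => (2 : k) ^ d := by
  intro a b h
  have h' : ((2 ^ a : ℕ) : k) = ((2 ^ b : ℕ) : k) := by simpa using h
  exact Nat.pow_right_injective le_rfl (Nat.cast_injective h')

/-- The bracket is an eigenvector of scaling with eigenvalue $2^d$, where $d$ is the sum of the
degrees. It is a combination of the independent eigenvectors `y.vec u`, so only those with
eigenvalue $2^d$, that is of degree $d$, can occur. -/
theorem RadicalBasis.lie_gvec_mem [CharZero k] (i j : Fin (n + 1) ⊕ Fin r) :
    ⁅y.gvec i, y.gvec j⁆ ∈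
      Submodule.span k {v | ∃ u, y.deg u = y.gdeg i + y.gdeg j ∧ v = y.vec u} := by
  have h1 := nilScale_apply_of_mem (lie_mem_lieComp (y.gvec_mem i) (y.gvec_mem j))
  have h2 : ⁅y.gvec i, y.gvec j⁆ ∈ Submodule.span k (Set.range y.vec) := by
    rw [y.span_eq]
    exact lie_mem_lowerCentralSeries_succ k n q _ (i := 0) (LieSubmodule.mem_top _)
  obtain ⟨c, hc⟩ := (Submodule.mem_span_range_iff_exists_fun k).1 h2
  set d := y.gdeg i + y.gdeg j
  have h3 : ∑ u, (c u * ((2 : k) ^ y.deg u - 2 ^ d)) • y.vec u = 0 := by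
    rw [← hc, map_sum, Finset.smul_sum, ← sub_eq_zero, ← Finset.sum_sub_distrib] at h1
    rw [← h1]
    refine Finset.sum_congr rfl fun u _ => ?_
    rw [map_smul, nilScale_apply_of_mem (y.vec_mem u), smul_smul, smul_smul, mul_sub, sub_smul,
      mul_comm (2 ^ d : k)]
  have h4 := Fintype.linearIndependent_iff.1 y.linearIndependent _ h3
  rw [← hc]
  refine Submodule.sum_mem _ fun u _ => ?_
  by_cases hu : y.deg u = d
  · exact Submodule.smul_mem _ _ (Submodule.subset_span ⟨u, hu, rfl⟩)
  · have : (2 : k) ^ y.deg u - 2 ^ d ≠ 0 := sub_ne_zero.2 fun h => hu (two_pow_injective h)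
    rw [(mul_eq_zero.1 (h4 u)).resolve_right this, zero_smul]
    exact zero_mem _

end LieGrading

/-! ## The NC-filtration -/

section Filtration

variable {k : Type u} [Field k] {n q r : ℕ} (y : RadicalBasis k n q r)

/-- The variables `x_j`, `y_u` of `S_q`. -/
def RadicalBasis.var (i : Fin (n + 1) ⊕ Fin r) : Sq k n q :=
  UniversalEnvelopingAlgebra.ι k (y.gvec i)

attribute [local instance 100] LieRing.ofAssociativeRing in
theorem ι_lie (v w : NilLie k n q) : UniversalEnvelopingAlgebra.ι k ⁅v, w⁆ =
    UniversalEnvelopingAlgebra.ι k v * UniversalEnvelopingAlgebra.ι k w -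
      UniversalEnvelopingAlgebra.ι k w * UniversalEnvelopingAlgebra.ι k v := by
  rw [LieHom.map_lie, LieRing.of_associative_ring_bracket]

theorem mem_subalgebra_of_ι (S : Subalgebra k (Sq k n q))
    (hS : ∀ w, UniversalEnvelopingAlgebra.ι k w ∈ S) (a : Sq k n q) : a ∈ S := by
  obtain ⟨t, rfl⟩ : ∃ t, UniversalEnvelopingAlgebra.mkAlgHom k (NilLie k n q) t = a :=
    RingCon.mkₐ_surjective _ a
  have ht : t ∈ Algebra.adjoin k (Set.range (TensorAlgebra.ι k (M := NilLie k n q))) := by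
    rw [TensorAlgebra.adjoin_range_ι]
    trivial
  have : Algebra.adjoin k (Set.range (TensorAlgebra.ι k (M := NilLie k n q))) ≤
      S.comap (UniversalEnvelopingAlgebra.mkAlgHom k (NilLie k n q)) := by
    refine Algebra.adjoin_le ?_
    rintro _ ⟨w, rfl⟩
    exact hS w
  exact this ht

theorem RadicalBasis.mem_subalgebra_of_var (S : Subalgebra k (Sq k n q)) (hS : ∀ i, y.var i ∈ S)
    (a : Sq k n q) : a ∈ S := by
  refine mem_subalgebra_of_ι S (fun w => ?_) a
  have := y.mem_span_gvec w
  induction this using Submodule.span_induction with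
  | mem v hv =>
    obtain ⟨i, rfl⟩ := hv
    exact hS i
  | zero => rw [map_zero]; exact zero_mem _
  | add v w _ _ hv hw => rw [map_add]; exact add_mem hv hw
  | smul c v _ hv => rw [map_smul]; exact S.smul_mem hv c

attribute [local instance 100] LieRing.ofAssociativeRing in
-- The lower bound uses degrees, where $x_j$ counts one, and not weights, where it counts zero. This
-- gain makes $x_j$ central to leading order for the NC-filtration.
theorem RadicalBasis.commutator_mem [CharZero k] (i j : Fin (n + 1) ⊕ Fin r) :
    y.var i * y.var j - y.var j * y.var i ∈ wordSpan k y.var y.gweight (y.gdeg i + y.gdeg j) 1 := by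
  rw [var, var, ← ι_lie]
  have h := Submodule.mem_map_of_mem
    (f := (UniversalEnvelopingAlgebra.ι k : NilLie k n q →ₗ⁅k⁆ Sq k n q).toLinearMap)
    (y.lie_gvec_mem i j)
  rw [Submodule.map_span] at h
  refine Submodule.span_mono ?_ h
  rintro _ ⟨_, ⟨u, hu, rfl⟩, rfl⟩
  exact ⟨[Sum.inr u], by simp [gweight, hu], by simp, by simp [var, gvec]⟩

theorem wordSpan_mono {A : Type*} [Ring A] [Algebra k A] {κ : Type*} (b : κ → A) (ω : κ → ℕ)
    {s t : ℕ} (h : s ≤ t) (l : ℕ) : wordSpan k b ω t l ≤ wordSpan k b ω s l := by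
  refine Submodule.span_mono ?_
  rintro a ⟨w, hw, hw', rfl⟩
  exact ⟨w, h.trans hw, hw', rfl⟩

theorem RadicalBasis.gweight_le_gdeg (i : Fin (n + 1) ⊕ Fin r) : y.gweight i ≤ y.gdeg i := by
  cases i <;> simp [gweight, gdeg]

/-- The ordered word with given exponents. -/
def orderedWord {n r : ℕ} (β : Fin n → ℕ) (α : Fin r → ℕ) : List (Fin n ⊕ Fin r) :=
  (List.ofFn fun j => List.replicate (β j) (Sum.inl j)).flatten ++
    (List.ofFn fun u => List.replicate (α u) (Sum.inr u)).flatten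

theorem exists_perm_orderedWord {n r : ℕ} (w : List (Fin n ⊕ Fin r)) :
    ∃ β α, w.Perm (orderedWord β α) := by
  induction w with
  | nil => exact ⟨0, 0, by simp [orderedWord]⟩
  | cons i w ih =>
    obtain ⟨β, α, h⟩ := ih
    have key : ∀ {m : ℕ} {κ : Type} (f : Fin m → κ) (γ : Fin m → ℕ) (j : Fin m),
        (f j :: (List.ofFn fun j => List.replicate (γ j) (f j)).flatten).Perm
          (List.ofFn fun t => List.replicate ((γ + Pi.single j 1 : Fin m → ℕ) t) (f t)).flatten := by
      intro m
      induction m with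
      | zero => intro κ f γ j; exact j.elim0
      | succ m ih =>
        intro κ f γ j
        rw [List.ofFn_succ, List.ofFn_succ, List.flatten_cons, List.flatten_cons]
        cases j using Fin.cases with
        | zero => simp [List.replicate_succ]
        | succ j =>
          have := ih (fun t => f t.succ) (fun t => γ t.succ) j
          refine List.perm_middle.symm.trans ?_
          simpa [Pi.single_apply] using this.append_left (List.replicate (γ 0) (f 0))
    cases i with
    | inl j =>
      refine ⟨β + Pi.single j 1, α, (h.cons _).trans ?_⟩
      exact (key Sum.inl β j).append_right _
    | inr u =>
      refine ⟨β, α + Pi.single u 1, (h.cons _).trans (List.perm_middle.symm.trans ?_)⟩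
      exact (key Sum.inr α u).append_left _

theorem RadicalBasis.prod_orderedWord (β : Fin (n + 1) → ℕ) (α : Fin r → ℕ) :
    ((orderedWord β α).map y.var).prod = y.mon β α := by
  rw [orderedWord, List.map_append, List.prod_append, List.map_flatten, List.map_flatten,
    List.prod_flatten, List.prod_flatten, mon, orderedMonomial, orderedMonomial]
  simp only [List.map_ofFn]
  congr 3
  · funext j
    simp [var, gvec, X]
  · funext j
    simp [var, gvec, Y]

theorem RadicalBasis.sum_orderedWord (β : Fin (n + 1) → ℕ) (α : Fin r → ℕ) :
    ((orderedWord β α).map y.gweight).sum = y.weight α := by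
  rw [orderedWord, List.map_append, List.sum_append, List.map_flatten, List.map_flatten,
    List.sum_flatten, List.sum_flatten]
  simp only [List.map_ofFn, List.sum_ofFn]
  simp [gweight, weight]

/-- Straightening into ordered words never lowers the weight. This gives multiplicativity of the
filtration and the spanning half of PBW. -/
theorem RadicalBasis.wordSpan_le_J [CharZero k] (s l : ℕ) :
    wordSpan k y.var y.gweight s l ≤ y.J s := by
  refine (word_mem_span_of_perm (fun i j => wordSpan_mono _ _
    (add_le_add (y.gweight_le_gdeg i) (y.gweight_le_gdeg j)) 1 (y.commutator_mem i j))
    {w | ∃ β α, w = orderedWord β α} (fun w => ?_) s l).trans (Submodule.span_mono ?_)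
  · obtain ⟨β, α, h⟩ := exists_perm_orderedWord w
    exact ⟨_, ⟨β, α, rfl⟩, h⟩
  · rintro _ ⟨_, ⟨β, α, rfl⟩, h, rfl⟩
    exact ⟨β, α, by rwa [sum_orderedWord] at h, y.prod_orderedWord β α⟩

theorem RadicalBasis.word_mem_J [CharZero k] (w : List (Fin (n + 1) ⊕ Fin r)) :
    (w.map y.var).prod ∈ y.J (w.map y.gweight).sum :=
  y.wordSpan_le_J _ _ (word_mem_wordSpan w)

theorem RadicalBasis.var_mem_J [CharZero k] (i : Fin (n + 1) ⊕ Fin r) :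
    y.var i ∈ y.J (y.gweight i) := by
  have := y.word_mem_J [i]
  rwa [List.map_singleton (f := y.var), List.prod_singleton, List.map_singleton,
    List.sum_singleton] at this

theorem RadicalBasis.J_mul_mem [CharZero k] {s t : ℕ} {a b : Sq k n q} (ha : a ∈ y.J s)
    (hb : b ∈ y.J t) : a * b ∈ y.J (s + t) := by
  have := Submodule.mul_mem_mul ha hb
  rw [J, J, Submodule.span_mul_span] at this
  refine Submodule.span_le.2 ?_ this
  rintro _ ⟨_, ⟨β, α, h, rfl⟩, _, ⟨β', α', h', rfl⟩, rfl⟩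
  rw [← y.sum_orderedWord β] at h
  rw [← y.sum_orderedWord β'] at h'
  change y.mon β α * y.mon β' α' ∈ _
  rw [← y.prod_orderedWord, ← y.prod_orderedWord]
  rw [← List.prod_append, ← List.map_append]
  exact y.J_anti (by simpa using add_le_add h h') (y.word_mem_J _)

theorem RadicalBasis.J_zero [CharZero k] : y.J 0 = ⊤ := by
  let S : Subalgebra k (Sq k n q) :=
    { carrier := {a | a ∈ y.J 0}
      add_mem' := fun {a b} ha hb => (y.J 0).add_mem ha hb
      mul_mem' := fun {a b} ha hb => y.J_mul_mem (s := 0) (t := 0) ha hb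
      algebraMap_mem' := fun c => by
        rw [Algebra.algebraMap_eq_smul_one]
        refine (y.J 0).smul_mem _ ?_
        have := y.word_mem_J []
        rwa [List.map_nil (f := y.var), List.prod_nil] at this }
  refine eq_top_iff.2 fun a _ => y.mem_subalgebra_of_var S (fun i => ?_) a
  exact y.J_anti (Nat.zero_le _) (y.var_mem_J i)

theorem RadicalBasis.mul_mem_J_left [CharZero k] {s : ℕ} (a : Sq k n q) {b : Sq k n q}
    (hb : b ∈ y.J s) : a * b ∈ y.J s := by
  have := y.J_mul_mem (s := 0) (a := a) (by rw [J_zero]; trivial) hb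
  rwa [zero_add] at this

theorem RadicalBasis.mul_mem_J_right [CharZero k] {s : ℕ} {a : Sq k n q} (b : Sq k n q)
    (ha : a ∈ y.J s) : a * b ∈ y.J s :=
  y.J_mul_mem (t := 0) ha (by rw [J_zero]; trivial)

theorem RadicalBasis.X_commutator_word_mem_J [CharZero k] (j : Fin (n + 1))
    (w : List (Fin (n + 1) ⊕ Fin r)) :
    X k n q j * (w.map y.var).prod - (w.map y.var).prod * X k n q j ∈
      y.J ((w.map y.gweight).sum + 1) := by
  induction w with
  | nil => simp
  | cons i w ih =>
    have h1 := y.wordSpan_le_J _ _ (y.commutator_mem (Sum.inl j) i)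
    have e : ∀ a b c : Sq k n q, a * (b * c) - b * c * a =
        (a * b - b * a) * c + b * (a * c - c * a) := fun a b c => by noncomm_ring
    rw [List.map_cons (f := y.var), List.prod_cons, e]
    refine add_mem ?_ ?_
    · refine y.J_anti ?_ (y.J_mul_mem h1 (y.word_mem_J w))
      have := y.gweight_le_gdeg i
      simp only [gdeg, Sum.elim_inl, List.map_cons, List.sum_cons] at this ⊢
      omega
    · refine y.J_anti ?_ (y.J_mul_mem (y.var_mem_J i) ih)
      simp [add_assoc]

theorem RadicalBasis.X_commutator_mem_J [CharZero k] (j : Fin (n + 1)) {s : ℕ} {a : Sq k n q}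
    (ha : a ∈ y.J s) : X k n q j * a - a * X k n q j ∈ y.J (s + 1) := by
  induction ha using Submodule.span_induction with
  | mem a ha =>
    obtain ⟨β, α, h, rfl⟩ := ha
    rw [← y.sum_orderedWord β] at h
    rw [← y.prod_orderedWord]
    exact y.J_anti (by omega) (y.X_commutator_word_mem_J j _)
  | zero => simp
  | add a b _ _ ha hb =>
    rw [mul_add, add_mul, add_sub_add_comm]
    exact add_mem ha hb
  | smul c a _ ha =>
    rw [mul_smul_comm, smul_mul_assoc, ← smul_sub]
    exact Submodule.smul_mem _ c ha

/-- The elements whose commutators raise the filtration by one form a subalgebra, which contains the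
$x_j$. This is the source of every comparison of left and right multiplication by $h(\mathbf x)$. -/
theorem RadicalBasis.hx_commutator_mem_J [CharZero k] (h : MvPolynomial (Fin (n + 1)) k) {s : ℕ}
    {a : Sq k n q} (ha : a ∈ y.J s) :
    hx (q := q) h * a - a * hx h ∈ y.J (s + 1) := by
  let Z : Subalgebra k (Sq k n q) :=
    { carrier := {z | ∀ s, ∀ a ∈ y.J s, z * a - a * z ∈ y.J (s + 1)}
      mul_mem' := fun {z w} hz hw s a ha => by
        have e : z * w * a - a * (z * w) = z * (w * a - a * w) + (z * a - a * z) * w := by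
          noncomm_ring
        rw [e]
        exact add_mem (y.mul_mem_J_left _ (hw s a ha)) (y.mul_mem_J_right _ (hz s a ha))
      add_mem' := fun {z w} hz hw s a ha => by
        have e : (z + w) * a - a * (z + w) = (z * a - a * z) + (w * a - a * w) := by
          noncomm_ring
        rw [e]
        exact add_mem (hz s a ha) (hw s a ha)
      algebraMap_mem' := fun c s a _ => by
        rw [Algebra.commutes, sub_self]
        exact zero_mem _ }
  exact orderedCalc_mem Z (fun j s a ha => y.X_commutator_mem_J j ha) h s a ha

end Filtration

/-! ## The diagonal operators -/

section Diag

variable {k : Type u} [Field k] {n q : ℕ}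

theorem lowerCentralSeries_le_one {i : ℕ} (hi : 1 ≤ i) :
    LieModule.lowerCentralSeries k (NilLie k n q) (NilLie k n q) i ≤
      LieModule.lowerCentralSeries k (NilLie k n q) (NilLie k n q) 1 :=
  LieModule.antitone_lowerCentralSeries k (NilLie k n q) (NilLie k n q) hi

theorem ad_pow_mem_lieComp {a : ℕ} (j : Fin (n + 1)) (i : ℕ) {w : NilLie k n q}
    (hw : w ∈ lieComp k n q a) :
    (LieAlgebra.ad k (NilLie k n q) (lieGen k n q j) ^ i) w ∈ lieComp k n q (a + i) := by
  induction i with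
  | zero => exact hw
  | succ i ih =>
    rw [pow_succ', Module.End.mul_apply, LieAlgebra.ad_apply]
    have := lie_mem_lieComp (Submodule.subset_span (IsLieMonomial.gen j)) ih
    rwa [show 1 + (a + i) = a + (i + 1) by omega] at this

theorem adProd_mem_lieComp {a p : ℕ} (g : Fin p → Fin (n + 1)) (i : Fin p → ℕ)
    {w : NilLie k n q} (hw : w ∈ lieComp k n q a) :
    (List.ofFn fun t => LieAlgebra.ad k (NilLie k n q) (lieGen k n q (g t)) ^ i t).prod w ∈
      lieComp k n q (a + ∑ t, i t) := by
  induction p with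
  | zero => simpa using hw
  | succ p ih =>
    rw [List.ofFn_succ, List.prod_cons, Module.End.mul_apply, Fin.sum_univ_succ,
      add_comm (i 0), ← add_assoc]
    exact ad_pow_mem_lieComp _ _ (ih (fun t => g t.succ) fun t => i t.succ)

theorem adProd_mem_lowerCentralSeries {p : ℕ} (g : Fin p → NilLie k n q) (i : Fin p → ℕ)
    (hi : i ≠ 0) (w : NilLie k n q) :
    (List.ofFn fun t => LieAlgebra.ad k (NilLie k n q) (g t) ^ i t).prod w ∈
      LieModule.lowerCentralSeries k (NilLie k n q) (NilLie k n q) 1 := by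
  induction p with
  | zero => exact absurd (Subsingleton.elim _ _) hi
  | succ p ih =>
    rw [List.ofFn_succ, List.prod_cons, Module.End.mul_apply]
    cases h0 : i 0 with
    | zero =>
      rw [pow_zero, Module.End.one_apply]
      refine ih _ _ fun h => hi (funext fun t => ?_)
      cases t using Fin.cases with
      | zero => exact h0
      | succ t => exact congrFun h t
    | succ b =>
      rw [pow_succ', Module.End.mul_apply]
      exact lie_mem_lowerCentralSeries_succ k n q (i := 0) _ (LieSubmodule.mem_top _)

/-- The Lie monomial `ad(x₀) ^ i₀ ⋯ ad(x_{j-1}) ^ i_{j-1} (x_j)`. -/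
def adWord (k : Type u) [Field k] {n q : ℕ} (j : Fin (n + 1)) (i : Fin j → Fin q) :
    NilLie k n q :=
  (List.ofFn fun t : Fin j => LieAlgebra.ad k (NilLie k n q)
    (lieGen k n q (t.castLE j.is_lt.le)) ^ (i t : ℕ)).prod (lieGen k n q j)

theorem adWord_mem_lieComp (j : Fin (n + 1)) (i : Fin j → Fin q) :
    adWord k j i ∈ lieComp k n q (1 + ∑ t, (i t : ℕ)) :=
  adProd_mem_lieComp (fun t : Fin j => t.castLE j.is_lt.le) (fun t => (i t : ℕ))
    (Submodule.subset_span (IsLieMonomial.gen j))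

theorem adWord_mem_lowerCentralSeries [NeZero q] (j : Fin (n + 1)) {i : Fin j → Fin q}
    (hi : i ≠ 0) :
    adWord k j i ∈ LieModule.lowerCentralSeries k (NilLie k n q) (NilLie k n q) 1 :=
  adProd_mem_lowerCentralSeries _ _ (fun h => hi (funext fun t => Fin.ext (congrFun h t))) _

theorem adWord_zero [NeZero q] (j : Fin (n + 1)) : adWord k j (0 : Fin j → Fin q) = lieGen k n q j := by
  simp [adWord]

variable {A B : Type u} [Ring A] [Algebra k A] [Ring B] [Algebra k B]

/-- The diagonal operator formed from left multiplications `L` and partial derivatives `d`. -/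
def diagElt (L : Sq k n q →ₐ[k] A) (d : Fin (n + 1) → A) (j : Fin (n + 1)) : A :=
  ∑ i : Fin j → Fin q, (∏ t, ((i t : ℕ).factorial : k))⁻¹ •
    (L (UniversalEnvelopingAlgebra.ι k (adWord k j i)) *
      orderedMonomial (fun t : Fin j => d (t.castLE j.is_lt.le)) fun t => (i t : ℕ))

theorem map_diagElt (f : A →ₐ[k] B) (L : Sq k n q →ₐ[k] A) (d : Fin (n + 1) → A)
    (j : Fin (n + 1)) : f (diagElt L d j) = diagElt (f.comp L) (fun t => f (d t)) j := by
  simp only [diagElt, map_sum, map_smul, map_mul, map_orderedMonomial, AlgHom.comp_apply]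

theorem diagElt_mem (S : Subalgebra k A) {L : Sq k n q →ₐ[k] A} {d : Fin (n + 1) → A}
    (hL : ∀ a, L a ∈ S) (hd : ∀ j, d j ∈ S) (j : Fin (n + 1)) : diagElt L d j ∈ S :=
  sum_mem fun _ _ => S.smul_mem (mul_mem (hL _) (orderedMonomial_mem S (fun _ => hd _) _)) _

/-- The term with `i = 0` is `L (X k n q j)`. In all other terms the Lie monomial is a bracket, so
it lies in the derived algebra. -/
theorem diagElt_sub_mem [NeZero q] (R : Submodule k A) {L : Sq k n q →ₐ[k] A}
    {d : Fin (n + 1) → A} (j : Fin (n + 1))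
    (h : ∀ w ∈ LieModule.lowerCentralSeries k (NilLie k n q) (NilLie k n q) 1,
      ∀ (p : ℕ) (g : Fin p → Fin (n + 1)) (i : Fin p → ℕ),
        L (UniversalEnvelopingAlgebra.ι k w) * orderedMonomial (fun t => d (g t)) i ∈ R) :
    diagElt L d j - L (X k n q j) ∈ R := by
  rw [diagElt, ← Finset.add_sum_erase _ _ (Finset.mem_univ (0 : Fin j → Fin q)), adWord_zero]
  have h0 : orderedMonomial (fun t : Fin j => d (t.castLE j.is_lt.le))
      (fun t => ((0 : Fin j → Fin q) t : ℕ)) = 1 := by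
    simp [orderedMonomial]
  rw [h0, mul_one]
  have h1 : (∏ t : Fin j, ((((0 : Fin j → Fin q) t : ℕ)).factorial : k))⁻¹ = 1 := by simp
  rw [h1, one_smul, X, add_sub_cancel_left]
  refine R.sum_mem fun i hi => R.smul_mem _ ?_
  exact h _ (adWord_mem_lowerCentralSeries j (Finset.ne_of_mem_erase hi)) _ _ _

/-- If the variables agree modulo `R`, so do the values of the ordered calculus. -/
theorem orderedCalc_sub_mem (S : Subalgebra k A) (R : Submodule k A)
    (hl : ∀ a ∈ S, ∀ b ∈ R, a * b ∈ R) (hr : ∀ a ∈ R, ∀ b ∈ S, a * b ∈ R) {p : ℕ}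
    {x x' : Fin p → A} (hx : ∀ i, x i ∈ S) (hx' : ∀ i, x' i ∈ S) (h : ∀ i, x i - x' i ∈ R)
    (g : MvPolynomial (Fin p) k) : orderedCalc k x g - orderedCalc k x' g ∈ R := by
  let Z : Subalgebra k (A × A) :=
    { carrier := {a | a.1 ∈ S ∧ a.2 ∈ S ∧ a.1 - a.2 ∈ R}
      mul_mem' := by
        rintro ⟨a, b⟩ ⟨c, d⟩ ⟨h1, h2, h3⟩ ⟨h4, h5, h6⟩
        refine ⟨mul_mem h1 h4, mul_mem h2 h5, ?_⟩
        have e : a * c - b * d = a * (c - d) + (a - b) * d := by noncomm_ring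
        change a * c - b * d ∈ R
        rw [e]
        exact add_mem (hl _ h1 _ h6) (hr _ h3 _ h5)
      add_mem' := by
        rintro ⟨a, b⟩ ⟨c, d⟩ ⟨h1, h2, h3⟩ ⟨h4, h5, h6⟩
        refine ⟨add_mem h1 h4, add_mem h2 h5, ?_⟩
        change a + c - (b + d) ∈ R
        rw [add_sub_add_comm]
        exact add_mem h3 h6
      algebraMap_mem' := fun c => ⟨S.algebraMap_mem c, S.algebraMap_mem c, by
        rw [Prod.algebraMap_apply, sub_self]
        exact zero_mem _⟩ }
  have := orderedCalc_mem Z (x := fun i => (x i, x' i)) (fun i => ⟨hx i, hx' i, h i⟩) g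
  have h1 := map_orderedCalc (AlgHom.fst k A A) (fun i => (x i, x' i)) g
  have h2 := map_orderedCalc (AlgHom.snd k A A) (fun i => (x i, x' i)) g
  exact h1 ▸ h2 ▸ this.2.2

end Diag

/-! ## Operators compatible with a filtration -/

section FiltEnd

variable {k : Type u} [Field k] {V : Type u} [AddCommGroup V] [Module k V]

/-- The endomorphisms that raise the filtration `G` by `j`. -/
def filtEnd (G : ℕ → Submodule k V) (j : ℕ) : Submodule k (Module.End k V) where
  carrier := {P | ∀ t, ∀ v ∈ G t, P v ∈ G (t + j)}
  add_mem' hP hQ t v hv := add_mem (hP t v hv) (hQ t v hv)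
  zero_mem' _ _ _ := zero_mem _
  smul_mem' c _ hP t v hv := Submodule.smul_mem _ c (hP t v hv)

theorem filtEnd_mul_mem {G : ℕ → Submodule k V} {i j : ℕ} {P Q : Module.End k V}
    (hP : P ∈ filtEnd G i) (hQ : Q ∈ filtEnd G j) : P * Q ∈ filtEnd G (i + j) := fun t v hv => by
  have := hP _ _ (hQ t v hv)
  rwa [add_assoc, add_comm j] at this

/-- The endomorphisms that preserve the filtration `G`. -/
def filtEndAlg (G : ℕ → Submodule k V) : Subalgebra k (Module.End k V) where
  carrier := {P | P ∈ filtEnd G 0}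
  mul_mem' hP hQ := filtEnd_mul_mem (G := G) (i := 0) (j := 0) hP hQ
  add_mem' hP hQ := (filtEnd G 0).add_mem hP hQ
  algebraMap_mem' c t v hv := by
    rw [Module.algebraMap_end_apply]
    exact Submodule.smul_mem _ c hv

theorem orderedCalc_sub_mem_filtEnd {G : ℕ → Submodule k V} {p : ℕ}
    {x x' : Fin p → Module.End k V} (hx : ∀ i, x i ∈ filtEndAlg G) (hx' : ∀ i, x' i ∈ filtEndAlg G)
    (h : ∀ i, x i - x' i ∈ filtEnd G 1) (g : MvPolynomial (Fin p) k) :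
    orderedCalc k x g - orderedCalc k x' g ∈ filtEnd G 1 :=
  orderedCalc_sub_mem (filtEndAlg G) (filtEnd G 1)
    (fun _ ha _ hb => by simpa using filtEnd_mul_mem (i := 0) ha hb)
    (fun _ ha _ hb => by simpa using filtEnd_mul_mem (j := 0) ha hb) hx hx' h g

end FiltEnd

/-! ## The partial derivatives and the diagonal operators on `S_q` -/

section Operators

variable {k : Type u} [Field k] {n q : ℕ} [NeZero q]

/-- The partial derivative `∂_j` on `S_q`. -/
def pd (k : Type u) [Field k] (n q : ℕ) [NeZero q] (j : Fin (n + 1)) : Module.End k (Sq k n q) where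
  toFun a := (partialHom k n q j a).snd
  map_add' a b := by rw [map_add, TrivSqZeroExt.snd_add]
  map_smul' c a := by rw [map_smul, TrivSqZeroExt.snd_smul, RingHom.id_apply]

theorem pd_apply (j : Fin (n + 1)) (a : Sq k n q) :
    pd k n q j a = (partialHom k n q j a).snd := rfl

theorem pd_mul (j : Fin (n + 1)) (a b : Sq k n q) :
    pd k n q j (a * b) = pd k n q j a * b + a * pd k n q j b := by
  simp only [pd_apply, map_mul, TrivSqZeroExt.snd_mul, fst_partialHom]
  simp [add_comm]

theorem pd_ι (j : Fin (n + 1)) (w : NilLie k n q) :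
    pd k n q j (UniversalEnvelopingAlgebra.ι k w) = coord k n q j w • 1 := by
  rw [pd_apply, partialHom_ι]
  simp

attribute [local instance 100] LieRing.ofAssociativeRing in
theorem coord_lieGen (i j : Fin (n + 1)) :
    coord k n q j (lieGen k n q i) = if i = j then 1 else 0 := by
  change coordFree k n j (FreeLieAlgebra.of k i) = _
  rw [coordFree, FreeLieAlgebra.lift_of_apply, Pi.single_apply]

theorem coord_eq_zero (j : Fin (n + 1)) {w : NilLie k n q}
    (hw : w ∈ LieModule.lowerCentralSeries k (NilLie k n q) (NilLie k n q) 1) :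
    coord k n q j w = 0 := by
  have h' : (LieModule.lowerCentralSeries k (NilLie k n q) (NilLie k n q) 1).toSubmodule ≤
      LinearMap.ker (coord k n q j) := by
    have h1 := LieModule.lowerCentralSeries_succ k (NilLie k n q) (NilLie k n q) 0
    rw [zero_add] at h1
    rw [h1, LieSubmodule.lieIdeal_oper_eq_linear_span', Submodule.span_le]
    rintro _ ⟨v, _, w, _, rfl⟩
    exact coord_lie k n q j v w
  exact h' hw

theorem pd_X (i j : Fin (n + 1)) : pd k n q j (X k n q i) = if i = j then 1 else 0 := by
  rw [X, pd_ι, coord_lieGen]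
  split_ifs <;> simp

/-- Elements on which the two derivations commute form a subalgebra. It contains the Lie algebra
because first derivatives of Lie elements are scalars. -/
theorem pd_commute (i j : Fin (n + 1)) : Commute (pd k n q i) (pd k n q j) := by
  refine LinearMap.ext fun a => ?_
  let S : Subalgebra k (Sq k n q) :=
    { carrier := {a | pd k n q i (pd k n q j a) = pd k n q j (pd k n q i a)}
      mul_mem' := fun {a b} (ha : _ = _) (hb : _ = _) => by
        change pd k n q i (pd k n q j (a * b)) = pd k n q j (pd k n q i (a * b))
        simp only [pd_mul, map_add, ha, hb]
        abel
      add_mem' := fun {a b} (ha : _ = _) (hb : _ = _) => by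
        change pd k n q i (pd k n q j (a + b)) = pd k n q j (pd k n q i (a + b))
        simp only [map_add, ha, hb]
      algebraMap_mem' := fun c => by
        change pd k n q i (pd k n q j (algebraMap _ _ c)) = pd k n q j (pd k n q i _)
        simp only [Algebra.algebraMap_eq_smul_one, map_smul, derivation_one (pd_mul _),
          smul_zero, map_zero] }
  refine mem_subalgebra_of_ι S (fun w => ?_) a
  change pd k n q i (pd k n q j _) = pd k n q j (pd k n q i _)
  simp only [pd_ι, map_smul, derivation_one (pd_mul _), smul_zero]

/-- The value of a polynomial at the ordered variables `x`. -/
abbrev ev (k : Type u) [Field k] (n q : ℕ) : MvPolynomial (Fin (n + 1)) k →ₗ[k] Sq k n q :=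
  orderedCalc k (X k n q)

theorem pd_ev_mul (j : Fin (n + 1)) (p : MvPolynomial (Fin (n + 1)) k) {c : Sq k n q}
    (hc : pd k n q j c = 0) :
    pd k n q j (ev k n q p * c) = ev k n q (MvPolynomial.pderiv j p) * c := by
  rw [pd_mul, hc, mul_zero, add_zero]
  congr 1
  induction p using mvPolynomial_induction_monomial with
  | h1 β =>
    rw [orderedCalc_monomial, MvPolynomial.pderiv_monomial, one_mul,
      derivation_orderedMonomial (pd_mul j) j (fun i => pd_X i j)]
    have h : MvPolynomial.monomial (β - Finsupp.single j 1) ((β j : ℕ) : k) =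
        ((β j : ℕ) : k) • MvPolynomial.monomial (β - Finsupp.single j 1) 1 := by
      rw [MvPolynomial.smul_monomial, smul_eq_mul, mul_one]
    rw [h, map_smul, orderedCalc_monomial]
    congr 2
    funext t
    simp [Finsupp.single_apply, Pi.single_apply, eq_comm]
  | h2 f g hf hg => simp only [map_add, hf, hg]
  | h3 c f hf => rw [map_smul, map_smul, hf, Derivation.map_smul, map_smul]

/-- The diagonal operator on `S_q` given by the commutative multiplication by `x_j`. -/
def diagXU (k : Type u) [Field k] (n q : ℕ) [NeZero q] (j : Fin (n + 1)) :
    Module.End k (Sq k n q) :=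
  diagElt (Algebra.lmul k (Sq k n q)) (pd k n q) j

/-- The diagonal operator on `S_q` given by the commutative multiplication by `h`. -/
def diagHU (n q : ℕ) [NeZero q] (h : MvPolynomial (Fin (n + 1)) k) : Module.End k (Sq k n q) :=
  orderedCalc k (diagXU k n q) h

attribute [local instance 100] LieRing.ofAssociativeRing in
-- This justifies the formula defining the diagonal operators. The monomial is cut at the variable
-- `j`. The part from $x_j$ on, times `c`, is killed by the earlier partial derivatives, so
-- `sum_ad_mul_orderedMonomial` inserts $x_j$ right after $x_0^{\beta_0}\cdots
-- x_{j-1}^{\beta_{j-1}}$.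
theorem diagXU_ev_mul [CharZero k] (j : Fin (n + 1)) (p : MvPolynomial (Fin (n + 1)) k)
    {c : Sq k n q} (hc : ∀ j, pd k n q j c = 0) :
    diagXU k n q j (ev k n q p * c) = ev k n q (MvPolynomial.X j * p) * c := by
  induction p using mvPolynomial_induction_monomial with
  | h1 β =>
    have hm : MvPolynomial.X j * MvPolynomial.monomial β (1 : k) =
        MvPolynomial.monomial (Finsupp.single j 1 + β) 1 := by
      rw [MvPolynomial.X, MvPolynomial.monomial_mul, one_mul]
    rw [hm, orderedCalc_monomial, orderedCalc_monomial, orderedMonomial_split _ _ j,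
      orderedMonomial_split (X k n q) (⇑(Finsupp.single j 1 + β : Fin (n + 1) →₀ ℕ)) j]
    have e1 : (fun t : Fin j => (Finsupp.single j 1 + β : Fin (n + 1) →₀ ℕ) (t.castLE j.is_lt.le)) =
        fun t : Fin j => β (t.castLE j.is_lt.le) := by
      funext t
      have : j ≠ t.castLE j.is_lt.le := fun h => t.is_lt.ne (congrArg Fin.val h).symm
      simp [this]
    have e2 : orderedTail (X k n q) (⇑(Finsupp.single j 1 + β : Fin (n + 1) →₀ ℕ)) j = orderedTail (X k n q) β j :=
      orderedTail_congr _ _ fun i hi => by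
        simp [hi.ne]
    rw [e1, e2, Finsupp.add_apply, Finsupp.single_eq_same, add_comm 1, pow_succ']
    have hne : ∀ t : Fin j, j ≠ t.castLE j.is_lt.le :=
      fun t h => t.is_lt.ne (congrArg Fin.val h).symm
    -- The kernel of $\partial_t$ is closed under products, and the right part involves only
    -- variables with index at least `j`, which exceeds `t`.
    have hv : ∀ t : Fin j, pd k n q (t.castLE j.is_lt.le)
        (X k n q j ^ β j * orderedTail (X k n q) β j * c) = 0 := fun t => by
      let K : Submonoid (Sq k n q) :=
        { carrier := {a | pd k n q (t.castLE j.is_lt.le) a = 0}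
          one_mem' := derivation_one (pd_mul _)
          mul_mem' := fun {a b} (ha : _ = _) (hb : _ = _) => by
            change pd k n q _ (a * b) = 0
            rw [pd_mul, ha, hb, zero_mul, mul_zero, add_zero] }
      refine K.mul_mem (K.mul_mem (K.pow_mem ?_ _) (list_prod_mem fun a ha => ?_)) (hc _)
      · change pd k n q _ _ = 0
        rw [pd_X, if_neg (hne t)]
      · obtain ⟨i, hi, rfl⟩ := List.getElem_of_mem ha
        rw [List.getElem_drop, List.getElem_ofFn]
        refine K.pow_mem ?_ _
        change pd k n q _ _ = 0
        rw [pd_X, if_neg]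
        intro h
        have := congrArg Fin.val h
        simp only [Fin.val_castLE] at this
        have := t.is_lt
        omega
    have key := sum_ad_mul_orderedMonomial
      (UniversalEnvelopingAlgebra.ι k : NilLie k n q →ₗ⁅k⁆ Sq k n q).toLinearMap ι_lie q
      (NeZero.pos q) (fun t : Fin j => lieGen k n q (t.castLE j.is_lt.le))
      (fun t => pd k n q (t.castLE j.is_lt.le)) (fun t => pd_mul _) (fun t s => ?_)
      (fun s t => pd_commute _ _) (fun t w => ad_pow_eq_zero k n q _ w) (lieGen k n q j)
      (fun t => β (t.castLE j.is_lt.le)) _ hv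
    · rw [diagXU, diagElt, LinearMap.sum_apply, mul_assoc]
      refine Eq.trans ?_ (key.trans ?_)
      · exact Finset.sum_congr rfl fun i _ => rfl
      · rw [mul_assoc (X k n q j)]
        simp only [mul_assoc]
        rfl
    · refine (pd_X _ _).trans ?_
      simp [Fin.ext_iff]
  | h2 f g hf hg => simp only [map_add, add_mul, mul_add, hf, hg]
  | h3 c f hf => simp only [map_smul, smul_mul_assoc, mul_smul_comm, hf]

end Operators

/-! ### Operators acting through polynomial coefficients, and the bigrading of $S_q$ -/

section Pieces

theorem orderedCalc_X {k : Type u} [Field k] {p : ℕ} (h : MvPolynomial (Fin p) k) :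
    orderedCalc k (MvPolynomial.X : Fin p → MvPolynomial (Fin p) k) h = h := by
  induction h using mvPolynomial_induction_monomial with
  | h1 β =>
    rw [orderedCalc_monomial, MvPolynomial.monomial_eq, map_one, one_mul, orderedMonomial,
      List.prod_ofFn, Finsupp.prod_fintype _ _ fun i => pow_zero _]
  | h2 f g hf hg => rw [map_add, hf, hg]
  | h3 c f hf => rw [map_smul, hf]

variable {k : Type u} [Field k] {n q : ℕ} [NeZero q] {r : ℕ} (y : RadicalBasis k n q r)

theorem RadicalBasis.mon_eq (β : Fin (n + 1) →₀ ℕ) (α : Fin r → ℕ) :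
    y.mon β α = ev k n q (MvPolynomial.monomial β 1) * orderedMonomial y.Y α := by
  rw [orderedCalc_monomial]
  rfl

theorem RadicalBasis.pd_monomial_Y (j : Fin (n + 1)) (α : Fin r → ℕ) :
    pd k n q j (orderedMonomial y.Y α) = 0 := by
  rw [pd_apply, partialHom_orderedMonomial, TrivSqZeroExt.snd_inl]

/-- Only the spanning of $S_q$ by ordered monomials is needed here, not their independence. -/
theorem RadicalBasis.hom_ext [CharZero k] {V : Type*} [AddCommGroup V] [Module k V]
    {f g : Sq k n q →ₗ[k] V}
    (hfg : ∀ (p : MvPolynomial (Fin (n + 1)) k) (α : Fin r → ℕ),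
      f (ev k n q p * orderedMonomial y.Y α) = g (ev k n q p * orderedMonomial y.Y α)) : f = g := by
  refine LinearMap.ext fun a => ?_
  have ha : a ∈ y.J 0 := by rw [y.J_zero]; trivial
  induction ha using Submodule.span_induction with
  | mem a ha =>
    obtain ⟨β, α, -, rfl⟩ := ha
    have := hfg (MvPolynomial.monomial (Finsupp.equivFunOnFinite.symm β) 1) α
    rwa [← y.mon_eq] at this
  | zero => rw [map_zero, map_zero]
  | add a b _ _ ha hb => rw [map_add, map_add, ha, hb]
  | smul c a _ ha => rw [map_smul, map_smul, ha]

/-- An operator with `P (p(x) * c) = (f p)(x) * c` for monomials `c` in the radical variables. -/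
def RadicalBasis.ActsAs (P : Module.End k (Sq k n q))
    (f : Module.End k (MvPolynomial (Fin (n + 1)) k)) : Prop :=
  ∀ p (α : Fin r → ℕ), P (ev k n q p * orderedMonomial y.Y α) =
    ev k n q (f p) * orderedMonomial y.Y α

variable {y}

theorem RadicalBasis.ActsAs.mul {P Q : Module.End k (Sq k n q)}
    {f g : Module.End k (MvPolynomial (Fin (n + 1)) k)} (hP : y.ActsAs P f) (hQ : y.ActsAs Q g) :
    y.ActsAs (P * Q) (f * g) := fun p α => by
  rw [Module.End.mul_apply, hQ, hP, Module.End.mul_apply]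

theorem RadicalBasis.ActsAs.add {P Q : Module.End k (Sq k n q)}
    {f g : Module.End k (MvPolynomial (Fin (n + 1)) k)} (hP : y.ActsAs P f) (hQ : y.ActsAs Q g) :
    y.ActsAs (P + Q) (f + g) := fun p α => by
  rw [LinearMap.add_apply, hQ, hP, LinearMap.add_apply, map_add, add_mul]

theorem RadicalBasis.ActsAs.smul {P : Module.End k (Sq k n q)}
    {f : Module.End k (MvPolynomial (Fin (n + 1)) k)} (hP : y.ActsAs P f) (c : k) :
    y.ActsAs (c • P) (c • f) := fun p α => by
  rw [LinearMap.smul_apply, hP, LinearMap.smul_apply, map_smul, smul_mul_assoc]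

theorem RadicalBasis.ActsAs.unique [CharZero k] {P Q : Module.End k (Sq k n q)}
    {f : Module.End k (MvPolynomial (Fin (n + 1)) k)} (hP : y.ActsAs P f) (hQ : y.ActsAs Q f) :
    P = Q :=
  y.hom_ext fun p α => (hP p α).trans (hQ p α).symm

variable (y)

theorem RadicalBasis.actsAs_pd (j : Fin (n + 1)) :
    y.ActsAs (pd k n q j) (MvPolynomial.pderiv j).toLinearMap :=
  fun p α => pd_ev_mul j p (y.pd_monomial_Y j α)

theorem RadicalBasis.actsAs_diagXU [CharZero k] (j : Fin (n + 1)) :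
    y.ActsAs (diagXU k n q j) (LinearMap.mulLeft k (MvPolynomial.X j)) :=
  fun p α => diagXU_ev_mul j p (fun j => y.pd_monomial_Y j α)

/-- The pairs of an operator and a polynomial whose multiplication it realizes form a subalgebra, so
the ordered calculus can be carried out in both entries at once. -/
theorem RadicalBasis.actsAs_diagHU [CharZero k] (h : MvPolynomial (Fin (n + 1)) k) :
    y.ActsAs (diagHU n q h) (LinearMap.mulLeft k h) := by
  let Z : Subalgebra k (Module.End k (Sq k n q) × MvPolynomial (Fin (n + 1)) k) :=
    { carrier := {a | y.ActsAs a.1 (LinearMap.mulLeft k a.2)}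
      mul_mem' := fun {a b} (ha : y.ActsAs _ _) (hb : y.ActsAs _ _) => by
        change y.ActsAs (a.1 * b.1) (LinearMap.mulLeft k (a.2 * b.2))
        rw [LinearMap.mulLeft_mul]
        exact ha.mul hb
      add_mem' := fun {a b} (ha : y.ActsAs _ _) (hb : y.ActsAs _ _) => by
        have := ha.add hb
        intro p α
        rw [Prod.fst_add, this]
        simp [add_mul]
      algebraMap_mem' := fun c => by
        intro p α
        simp [Algebra.algebraMap_eq_smul_one] }
  have h0 := orderedCalc_mem Z (x := fun j => (diagXU k n q j, MvPolynomial.X j))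
    (fun j => y.actsAs_diagXU j) h
  have h1 := map_orderedCalc (AlgHom.fst k (Module.End k (Sq k n q)) (MvPolynomial (Fin (n + 1)) k))
    (fun j => (diagXU k n q j, MvPolynomial.X j)) h
  have h2 := map_orderedCalc (AlgHom.snd k (Module.End k (Sq k n q)) (MvPolynomial (Fin (n + 1)) k))
    (fun j => (diagXU k n q j, MvPolynomial.X j)) h
  have h4 : y.ActsAs (AlgHom.fst k _ _ _) (LinearMap.mulLeft k (AlgHom.snd k _ _ _)) := h0
  rw [h1, h2] at h4
  have h5 := orderedCalc_X h
  change y.ActsAs (orderedCalc k (diagXU k n q) h)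
    (LinearMap.mulLeft k (orderedCalc k MvPolynomial.X h)) at h4
  rwa [h5] at h4

/-- The Euler operator on `S_q` of the variables `x`. -/
def eulerU (k : Type u) [Field k] (n q : ℕ) [NeZero q] : Module.End k (Sq k n q) :=
  ∑ j, diagXU k n q j * pd k n q j

theorem RadicalBasis.actsAs_eulerU [CharZero k] :
    y.ActsAs (eulerU k n q)
      (∑ j, LinearMap.mulLeft k (MvPolynomial.X j) * (MvPolynomial.pderiv j).toLinearMap) :=
  fun p α => by
    simp only [eulerU, LinearMap.sum_apply, map_sum, Finset.sum_mul]
    exact Finset.sum_congr rfl fun j _ => ((y.actsAs_diagXU j).mul (y.actsAs_pd j)) p α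

theorem RadicalBasis.eulerU_ev_mul [CharZero k] {e : ℕ} {p : MvPolynomial (Fin (n + 1)) k}
    (hp : p.IsHomogeneous e) (α : Fin r → ℕ) :
    eulerU k n q (ev k n q p * orderedMonomial y.Y α) =
      (e : k) • (ev k n q p * orderedMonomial y.Y α) := by
  rw [y.actsAs_eulerU]
  simp only [LinearMap.sum_apply, Module.End.mul_apply, LinearMap.mulLeft_apply]
  have := hp.sum_X_mul_pderiv
  refine (congrArg (fun z => ev k n q z * orderedMonomial y.Y α) this).trans ?_
  rw [← Nat.cast_smul_eq_nsmul k, map_smul, smul_mul_assoc]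

theorem isHomogeneous_monomial_sum (β : Fin (n + 1) →₀ ℕ) (c : k) :
    (MvPolynomial.monomial β c).IsHomogeneous (∑ j, β j) :=
  MvPolynomial.isHomogeneous_monomial c (Finsupp.degree_eq_sum β)

theorem RadicalBasis.bipiece_eq (e m : ℕ) : y.bipiece e m =
    Submodule.span k {a | ∃ p : MvPolynomial (Fin (n + 1)) k, p.IsHomogeneous e ∧
      ∃ α, y.weight α = m ∧ a = ev k n q p * orderedMonomial y.Y α} := by
  refine le_antisymm (Submodule.span_mono ?_) (Submodule.span_le.2 ?_)
  · rintro _ ⟨β, α, hβ, hα, rfl⟩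
    refine ⟨_, hβ ▸ isHomogeneous_monomial_sum (Finsupp.equivFunOnFinite.symm β) 1, α, hα, ?_⟩
    rw [← y.mon_eq]
    rfl
  · rintro _ ⟨p, hp, α, hα, rfl⟩
    rw [p.as_sum, map_sum, Finset.sum_mul]
    refine Submodule.sum_mem _ fun β hβ => ?_
    have : MvPolynomial.monomial β (p.coeff β) = p.coeff β • MvPolynomial.monomial β 1 := by
      rw [MvPolynomial.smul_monomial, smul_eq_mul, mul_one]
    rw [this, map_smul, smul_mul_assoc, ← y.mon_eq]
    refine Submodule.smul_mem _ _ (Submodule.subset_span ⟨β, α, ?_, hα, rfl⟩)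
    rw [← Finsupp.degree_eq_sum, Finsupp.degree_eq_weight_one]
    exact hp (MvPolynomial.mem_support_iff.1 hβ)

theorem RadicalBasis.eulerU_apply [CharZero k] {e m : ℕ} {a : Sq k n q} (ha : a ∈ y.bipiece e m) :
    eulerU k n q a = (e : k) • a := by
  rw [bipiece_eq] at ha
  induction ha using Submodule.span_induction with
  | mem a ha =>
    obtain ⟨p, hp, α, -, rfl⟩ := ha
    exact y.eulerU_ev_mul hp α
  | zero => simp
  | add a b _ _ ha hb => rw [map_add, ha, hb, smul_add]
  | smul c a _ ha => rw [map_smul, ha, smul_comm]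

theorem RadicalBasis.diagXU_mem_bipiece [CharZero k] (j : Fin (n + 1)) {e m : ℕ} {a : Sq k n q}
    (ha : a ∈ y.bipiece e m) : diagXU k n q j a ∈ y.bipiece (e + 1) m := by
  rw [bipiece_eq] at ha
  induction ha using Submodule.span_induction with
  | mem a ha =>
    obtain ⟨p, hp, α, hα, rfl⟩ := ha
    rw [y.actsAs_diagXU, bipiece_eq]
    exact Submodule.subset_span
      ⟨_, add_comm 1 e ▸ (MvPolynomial.isHomogeneous_X k j).mul hp, α, hα, rfl⟩
  | zero => rw [map_zero]; exact zero_mem _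
  | add a b _ _ ha hb => rw [map_add]; exact add_mem ha hb
  | smul c a _ ha => rw [map_smul]; exact Submodule.smul_mem _ c ha

theorem RadicalBasis.bipiece_le_piece (e m : ℕ) : y.bipiece e m ≤ y.piece m :=
  Submodule.span_mono fun _ ⟨β, α, _, hα, h⟩ => ⟨β, α, hα, h⟩

theorem RadicalBasis.piece_eq_iSup (m : ℕ) : y.piece m = ⨆ e, y.bipiece e m := by
  refine le_antisymm (Submodule.span_le.2 ?_) (iSup_le fun e => y.bipiece_le_piece e m)
  rintro _ ⟨β, α, hα, rfl⟩
  exact Submodule.mem_iSup_of_mem _ (Submodule.subset_span ⟨β, α, rfl, hα, rfl⟩)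

theorem RadicalBasis.piece_le_J {s m : ℕ} (h : s ≤ m) : y.piece m ≤ y.J s :=
  Submodule.span_mono fun _ ⟨β, α, hα, h'⟩ => ⟨β, α, hα ▸ h, h'⟩

theorem RadicalBasis.J_eq_iSup (s : ℕ) :
    y.J s = ⨆ i : {i : ℕ × ℕ // s ≤ i.2}, y.bipiece i.1.1 i.1.2 := by
  refine le_antisymm (Submodule.span_le.2 ?_)
    (iSup_le fun i => (y.bipiece_le_piece _ _).trans (y.piece_le_J i.2))
  rintro _ ⟨β, α, hα, rfl⟩
  exact Submodule.mem_iSup_of_mem (⟨(_, _), hα⟩ : {i : ℕ × ℕ // s ≤ i.2})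
    (Submodule.subset_span ⟨β, α, rfl, rfl, rfl⟩)

theorem RadicalBasis.exists_piece_of_mem_J {s : ℕ} {a : Sq k n q} (ha : a ∈ y.J s) :
    ∃ b ∈ y.piece s, a - b ∈ y.J (s + 1) := by
  have : y.J s ≤ y.piece s ⊔ y.J (s + 1) := Submodule.span_le.2 (by
    rintro _ ⟨β, α, hα, rfl⟩
    rcases hα.eq_or_lt with h | h
    · exact Submodule.mem_sup_left (Submodule.subset_span ⟨β, α, h.symm, rfl⟩)
    · exact Submodule.mem_sup_right (Submodule.subset_span ⟨β, α, h, rfl⟩))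
  obtain ⟨b, hb, c, hc, rfl⟩ := Submodule.mem_sup.1 (this ha)
  exact ⟨b, hb, by simpa using hc⟩

/-! ### The scaling automorphism -/

attribute [local instance 100] LieRing.ofAssociativeRing in
/-- The endomorphism of `S_q` with `x_j ↦ 2 x_j`. -/
def scaleU (k : Type u) [Field k] (n q : ℕ) : Sq k n q →ₐ[k] Sq k n q :=
  UniversalEnvelopingAlgebra.lift k ((UniversalEnvelopingAlgebra.ι k).comp (nilScale k n q))

attribute [local instance 100] LieRing.ofAssociativeRing in
theorem scaleU_ι {d : ℕ} {w : NilLie k n q} (hw : w ∈ lieComp k n q d) :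
    scaleU k n q (UniversalEnvelopingAlgebra.ι k w) =
      (2 : k) ^ d • UniversalEnvelopingAlgebra.ι k w := by
  rw [scaleU, UniversalEnvelopingAlgebra.lift_ι_apply, LieHom.comp_apply,
    nilScale_apply_of_mem hw, map_smul]

theorem algHom_orderedMonomial_smul {A : Type u} [Ring A] [Algebra k A] (f : A →ₐ[k] A) {p : ℕ}
    (x : Fin p → A) (c : k) (d : Fin p → ℕ) (hf : ∀ i, f (x i) = c ^ d i • x i) (β : Fin p → ℕ) :
    f (orderedMonomial x β) = c ^ (∑ i, β i * d i) • orderedMonomial x β := by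
  rw [map_orderedMonomial]
  induction p with
  | zero => simp [orderedMonomial_zero_vars]
  | succ p ih =>
    rw [orderedMonomial_succ, orderedMonomial_succ x, ih _ _ fun i => hf i.succ, Fin.sum_univ_succ,
      hf, smul_pow, ← pow_mul, smul_mul_smul_comm, ← pow_add, mul_comm (d 0)]

theorem RadicalBasis.scaleU_apply {e m : ℕ} {a : Sq k n q} (ha : a ∈ y.bipiece e m) :
    scaleU k n q a = (2 : k) ^ (e + m) • a := by
  induction ha using Submodule.span_induction with
  | mem a ha =>
    obtain ⟨β, α, hβ, hα, rfl⟩ := ha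
    rw [mon, map_mul, algHom_orderedMonomial_smul (scaleU k n q) (X k n q) 2 (fun _ => 1) (fun j =>
        scaleU_ι (Submodule.subset_span (IsLieMonomial.gen j))),
      algHom_orderedMonomial_smul (scaleU k n q) y.Y 2 y.deg (fun u => scaleU_ι (y.vec_mem u)),
      smul_mul_smul_comm, ← pow_add]
    simp only [mul_one]
    rw [hβ, ← hα, weight]
  | zero => simp
  | add a b _ _ ha hb => rw [map_add, ha, hb, smul_add]
  | smul c a _ ha => rw [map_smul, ha, smul_comm]

theorem eigenvalues_ne [CharZero k] (i j : ℕ × ℕ) (h : i ≠ j) :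
    ∃ a : Bool, (bif a then (2 : k) ^ (i.1 + i.2) else (i.1 : k)) ≠
      (bif a then (2 : k) ^ (j.1 + j.2) else (j.1 : k)) := by
  by_contra! hc
  have h1 := two_pow_injective (hc true)
  have h2 : i.1 = j.1 := by simpa using hc false
  exact h (Prod.ext h2 (by omega))

/-- The Euler eigenvalue gives $e$, and the scaling eigenvalue $2^{e+m}$ then gives $m$. -/
theorem RadicalBasis.iSupIndep_bipiece [CharZero k] :
    iSupIndep fun i : ℕ × ℕ => y.bipiece i.1 i.2 :=
  iSupIndep_of_eigenvectors
    (fun a : Bool => bif a then (scaleU k n q).toLinearMap else eulerU k n q)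
    (fun a i => bif a then (2 : k) ^ (i.1 + i.2) else (i.1 : k)) eigenvalues_ne _ (by
      intro a i v hv
      cases a
      · exact y.eulerU_apply hv
      · exact y.scaleU_apply hv)

/-! ### Filtration degrees of the operators -/

theorem RadicalBasis.ι_mem_J [CharZero k] {w : NilLie k n q}
    (hw : w ∈ LieModule.lowerCentralSeries k (NilLie k n q) (NilLie k n q) 1) :
    UniversalEnvelopingAlgebra.ι k w ∈ y.J 1 := by
  have hw' : w ∈ Submodule.span k (Set.range y.vec) := by rw [y.span_eq]; exact hw
  clear hw
  induction hw' using Submodule.span_induction with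
  | mem w h =>
    obtain ⟨u, rfl⟩ := h
    refine y.J_anti ?_ (y.var_mem_J (Sum.inr u))
    exact (by norm_num : 1 ≤ 2).trans (y.two_le_deg u)
  | zero => rw [map_zero]; exact zero_mem _
  | add v w _ _ h1 h2 => rw [map_add]; exact add_mem h1 h2
  | smul c v _ h1 => rw [map_smul]; exact Submodule.smul_mem _ c h1

theorem RadicalBasis.lmul_mem_filtEnd [CharZero k] {s : ℕ} {a : Sq k n q} (ha : a ∈ y.J s) :
    Algebra.lmul k (Sq k n q) a ∈ filtEnd y.J s := fun t b hb => by
  have := y.J_mul_mem ha hb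
  rwa [add_comm s t] at this

theorem RadicalBasis.pd_mem_filtEnd (j : Fin (n + 1)) : pd k n q j ∈ filtEndAlg y.J := by
  intro s a ha
  induction ha using Submodule.span_induction with
  | mem a ha =>
    obtain ⟨β, α, hα, rfl⟩ := ha
    rw [add_zero, mon, pd_mul, y.pd_monomial_Y, mul_zero, add_zero,
      derivation_orderedMonomial (pd_mul j) j (fun i => pd_X i j), smul_mul_assoc]
    exact (y.J s).smul_mem _ (Submodule.subset_span ⟨_, α, hα, rfl⟩)
  | zero => rw [map_zero]; exact zero_mem _
  | add a b _ _ ha hb => rw [map_add]; exact add_mem ha hb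
  | smul c a _ ha => rw [map_smul]; exact Submodule.smul_mem _ c ha

theorem RadicalBasis.lmul_mem_filtEndAlg [CharZero k] (a : Sq k n q) :
    Algebra.lmul k (Sq k n q) a ∈ filtEndAlg y.J := fun _ _ hb => y.mul_mem_J_left a hb

theorem RadicalBasis.diagXU_mem_filtEnd [CharZero k] (j : Fin (n + 1)) :
    diagXU k n q j ∈ filtEndAlg y.J :=
  diagElt_mem _ y.lmul_mem_filtEndAlg y.pd_mem_filtEnd j

theorem RadicalBasis.diagXU_sub_mem_filtEnd [CharZero k] (j : Fin (n + 1)) :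
    diagXU k n q j - Algebra.lmul k (Sq k n q) (X k n q j) ∈ filtEnd y.J 1 :=
  diagElt_sub_mem _ j fun _ hw _ _ _ =>
    filtEnd_mul_mem (j := 0) (y.lmul_mem_filtEnd (y.ι_mem_J hw))
      (orderedMonomial_mem (filtEndAlg y.J) (fun _ => y.pd_mem_filtEnd _) _)

theorem RadicalBasis.diagHU_mem_filtEnd [CharZero k] (h : MvPolynomial (Fin (n + 1)) k) :
    diagHU n q h ∈ filtEndAlg y.J :=
  orderedCalc_mem _ y.diagXU_mem_filtEnd h

theorem RadicalBasis.diagHU_sub_mem_filtEnd [CharZero k] (h : MvPolynomial (Fin (n + 1)) k) :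
    diagHU n q h - Algebra.lmul k (Sq k n q) (hx h) ∈ filtEnd y.J 1 := by
  rw [hx, map_orderedCalc]
  exact orderedCalc_sub_mem_filtEnd y.diagXU_mem_filtEnd (fun _ => y.lmul_mem_filtEndAlg _)
    y.diagXU_sub_mem_filtEnd h

end Pieces

/-! ## Rings of differential operators -/

/-- An algebra with left multiplications `L a` and partial derivatives `d j` that acts on `S_q`. -/
structure DiffRep (k : Type u) [Field k] (n q : ℕ) [NeZero q] (A : Type u) [Ring A]
    [Algebra k A] where
  L : Sq k n q →ₐ[k] A
  d : Fin (n + 1) → A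
  act : A →ₐ[k] Module.End k (Sq k n q)
  act_L : ∀ a, act (L a) = Algebra.lmul k (Sq k n q) a
  act_d : ∀ j, act (d j) = pd k n q j
  d_comm : ∀ i j, Commute (d i) (d j)
  d_L : ∀ j a, d j * L a = L a * d j + L (pd k n q j a)

namespace DiffRep

variable {k : Type u} [Field k] {n q : ℕ} [NeZero q] {A : Type u} [Ring A] [Algebra k A]
  (ρ : DiffRep k n q A)

theorem _root_.NCProj.commute_mulLeft {B : Type u} [CommRing B] [Algebra k B] (a b : B) :
    Commute (LinearMap.mulLeft k a) (LinearMap.mulLeft k b) :=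
  LinearMap.ext fun c => by
    simp only [Module.End.mul_apply, LinearMap.mulLeft_apply]
    ring

/-- The algebra of differential operators. -/
def diffOps : Subalgebra k A := Algebra.adjoin k (Set.range ρ.L ∪ Set.range ρ.d)

theorem L_mem (a : Sq k n q) : ρ.L a ∈ ρ.diffOps :=
  Algebra.subset_adjoin (Or.inl ⟨a, rfl⟩)

theorem d_mem (j : Fin (n + 1)) : ρ.d j ∈ ρ.diffOps :=
  Algebra.subset_adjoin (Or.inr ⟨j, rfl⟩)

theorem _root_.NCProj.orderedMonomial_add_finsupp_single {B : Type u} [Ring B] {p : ℕ} {x : Fin p → B}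
    (hx : ∀ i j, Commute (x i) (x j)) (β : Fin p →₀ ℕ) (j : Fin p) :
    orderedMonomial x (⇑(β + Finsupp.single j 1 : Fin p →₀ ℕ)) = x j * orderedMonomial x β := by
  rw [← orderedMonomial_add_single hx]
  congr 1
  funext t
  simp [Finsupp.single_apply, Pi.single_apply, eq_comm]

/-- The differential operator `∑ c β ∂ ^ β`. -/
def normalForm (c : (Fin (n + 1) →₀ ℕ) →₀ Sq k n q) : A :=
  c.sum fun β a => ρ.L a * orderedMonomial ρ.d β

theorem normalForm_single (β : Fin (n + 1) →₀ ℕ) (a : Sq k n q) :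
    ρ.normalForm (Finsupp.single β a) = ρ.L a * orderedMonomial ρ.d β :=
  Finsupp.sum_single_index (by rw [map_zero, zero_mul])

theorem normalForm_add (c c' : (Fin (n + 1) →₀ ℕ) →₀ Sq k n q) :
    ρ.normalForm (c + c') = ρ.normalForm c + ρ.normalForm c' :=
  Finsupp.sum_add_index' (fun _ => by rw [map_zero, zero_mul])
    fun _ _ _ => by rw [map_add, add_mul]

/-- The relation `d_L` moves derivatives to the right of the coefficients. So the normal forms are
stable under left multiplication by the generators, hence by all of `diffOps`. -/
theorem exists_normalForm {w : A} (hw : w ∈ ρ.diffOps) : ∃ c, w = ρ.normalForm c := by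
  have hL : ∀ a c, ∃ c', ρ.L a * ρ.normalForm c = ρ.normalForm c' := fun a c => by
    induction c using Finsupp.induction_linear with
    | zero => exact ⟨0, by simp [normalForm]⟩
    | add c₁ c₂ h₁ h₂ =>
      obtain ⟨c₁', h₁⟩ := h₁
      obtain ⟨c₂', h₂⟩ := h₂
      exact ⟨c₁' + c₂', by rw [normalForm_add, normalForm_add, mul_add, h₁, h₂]⟩
    | single β b =>
      exact ⟨Finsupp.single β (a * b), by
        rw [normalForm_single, normalForm_single, map_mul, mul_assoc]⟩
  have hd : ∀ j c, ∃ c', ρ.d j * ρ.normalForm c = ρ.normalForm c' := fun j c => by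
    induction c using Finsupp.induction_linear with
    | zero => exact ⟨0, by simp [normalForm]⟩
    | add c₁ c₂ h₁ h₂ =>
      obtain ⟨c₁', h₁⟩ := h₁
      obtain ⟨c₂', h₂⟩ := h₂
      exact ⟨c₁' + c₂', by rw [normalForm_add, normalForm_add, mul_add, h₁, h₂]⟩
    | single β b =>
      refine ⟨Finsupp.single (β + Finsupp.single j 1) b + Finsupp.single β (pd k n q j b), ?_⟩
      rw [normalForm_add, normalForm_single, normalForm_single, normalForm_single, ← mul_assoc,
        ρ.d_L, add_mul, mul_assoc, orderedMonomial_add_finsupp_single ρ.d_comm]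
  let Z : Subalgebra k A :=
    { carrier := {w | ∀ c, ∃ c', w * ρ.normalForm c = ρ.normalForm c'}
      mul_mem' := fun {a b} ha hb c => by
        obtain ⟨c', h'⟩ := hb c
        rw [mul_assoc, h']
        exact ha c'
      add_mem' := fun {a b} ha hb c => by
        obtain ⟨c', h'⟩ := ha c
        obtain ⟨c'', h''⟩ := hb c
        exact ⟨c' + c'', by rw [add_mul, h', h'', normalForm_add]⟩
      algebraMap_mem' := fun s c => by
        rw [← AlgHom.commutes ρ.L]
        exact hL _ c }
  have hZ : ρ.diffOps ≤ Z := Algebra.adjoin_le (by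
    rintro _ (⟨a, rfl⟩ | ⟨j, rfl⟩)
    · exact hL a
    · exact hd j)
  -- The unit is itself a normal form, and `w` is `w` times the unit.
  obtain ⟨c, hc⟩ := hZ hw (Finsupp.single 0 1)
  refine ⟨c, ?_⟩
  rw [← hc, normalForm_single, map_one, one_mul, Finsupp.coe_zero, orderedMonomial_zero, mul_one]

theorem exists_pd_monomial [CharZero k] (β s : Fin (n + 1) →₀ ℕ) :
    ∃ c : k, orderedMonomial (pd k n q) β (ev k n q (MvPolynomial.monomial s 1)) =
      c • ev k n q (MvPolynomial.monomial (s - β) 1) ∧ (c ≠ 0 ↔ β ≤ s) := by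
  induction hN : β.degree generalizing β with
  | zero =>
    rw [(Finsupp.degree_eq_zero_iff β).1 hN]
    exact ⟨1, by simp [orderedMonomial_zero], by simp⟩
  | succ N ih =>
    obtain ⟨j, hj⟩ : ∃ j, β j ≠ 0 := by
      by_contra! h
      rw [show β = 0 from Finsupp.ext h, map_zero] at hN
      exact absurd hN (by omega)
    obtain ⟨γ, rfl⟩ : ∃ γ, β = γ + Finsupp.single j 1 :=
      ⟨β - Finsupp.single j 1, (tsub_add_cancel_of_le (by
        rw [Finsupp.single_le_iff]
        omega)).symm⟩
    rw [map_add, Finsupp.degree_single] at hN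
    obtain ⟨c, hc, hc'⟩ := ih γ (by omega)
    refine ⟨c * ((s - γ) j : ℕ), ?_, ?_⟩
    · have h1 := pd_ev_mul (q := q) j (MvPolynomial.monomial (s - γ) (1 : k))
        (derivation_one (pd_mul j))
      have h2 : MvPolynomial.monomial (s - γ - Finsupp.single j 1) (((s - γ) j : ℕ) : k) =
          (((s - γ) j : ℕ) : k) • MvPolynomial.monomial (s - γ - Finsupp.single j 1) 1 := by
        rw [MvPolynomial.smul_monomial, smul_eq_mul, mul_one]
      rw [mul_one, mul_one, MvPolynomial.pderiv_monomial, one_mul, h2, map_smul] at h1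
      rw [orderedMonomial_add_finsupp_single pd_commute, Module.End.mul_apply, hc, map_smul, h1,
        smul_smul, tsub_add_eq_tsub_tsub]
    · rw [mul_ne_zero_iff, hc', Nat.cast_ne_zero, Finsupp.tsub_apply]
      constructor
      · rintro ⟨h1, h2⟩ t
        have := h1 t
        by_cases ht : j = t
        · subst ht
          simp only [Finsupp.add_apply, Finsupp.single_eq_same]
          omega
        · simpa [ht] using this
      · intro h1
        refine ⟨le_trans (by simp) h1, ?_⟩
        have := h1 j
        simp only [Finsupp.add_apply, Finsupp.single_eq_same] at this
        omega

/-- The transfer principle: a relation between differential operators that holds on $S_q$ holds in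
the algebra `A`. It suffices that a nonzero normal form acts nontrivially on some $\mathbf x^s$. -/
theorem eq_zero_of_act_eq_zero [CharZero k] {w : A} (hw : w ∈ ρ.diffOps) (h0 : ρ.act w = 0) :
    w = 0 := by
  obtain ⟨c, rfl⟩ := ρ.exists_normalForm hw
  by_contra hne
  have hc : c.support.Nonempty := by
    rw [Finset.nonempty_iff_ne_empty, Ne, Finsupp.support_eq_empty]
    rintro rfl
    exact hne (by simp [normalForm])
  -- On $\mathbf x^s$ the derivative $\partial^\beta$ is nonzero only for $\beta\le s$. For a
  -- minimal exponent `s` this isolates the coefficient `c s`, up to a nonzero scalar.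
  obtain ⟨s, hs⟩ := Finset.exists_minimal hc
  have h1 := LinearMap.congr_fun h0 (ev k n q (MvPolynomial.monomial s 1))
  rw [normalForm, Finsupp.sum, map_sum, LinearMap.sum_apply, Finset.sum_eq_single s] at h1
  · obtain ⟨e, he, he'⟩ := exists_pd_monomial (k := k) (n := n) (q := q) s s
    rw [map_mul, act_L, map_orderedMonomial] at h1
    simp only [act_d, Module.End.mul_apply, LinearMap.zero_apply] at h1
    change c s * orderedMonomial (pd k n q) s (ev k n q (MvPolynomial.monomial s 1)) = 0 at h1
    rw [he, tsub_self, orderedCalc_monomial, Finsupp.coe_zero, orderedMonomial_zero,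
      mul_smul_comm, mul_one] at h1
    exact (Finsupp.mem_support_iff.1 hs.1) ((smul_eq_zero_iff_right (he'.2 le_rfl)).1 h1)
  · intro β hβ hne
    obtain ⟨e, he, he'⟩ := exists_pd_monomial (k := k) (n := n) (q := q) β s
    have : e = 0 := by
      by_contra h
      exact hne (le_antisymm (he'.1 h) (hs.2 hβ (he'.1 h)))
    rw [map_mul, act_L, map_orderedMonomial]
    simp only [act_d, Module.End.mul_apply]
    rw [he, this, zero_smul, map_zero]
  · intro h
    exact absurd hs.1 h

/-- The diagonal elements. -/
def x (j : Fin (n + 1)) : A := diagElt ρ.L ρ.d j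

/-- The diagonal element of `h`. -/
def D (h : MvPolynomial (Fin (n + 1)) k) : A := orderedCalc k ρ.x h

/-- The Euler element. -/
def euler : A := ∑ j, ρ.x j * ρ.d j

theorem x_mem (j : Fin (n + 1)) : ρ.x j ∈ ρ.diffOps := diagElt_mem _ ρ.L_mem ρ.d_mem j

theorem D_mem (h : MvPolynomial (Fin (n + 1)) k) : ρ.D h ∈ ρ.diffOps := orderedCalc_mem _ ρ.x_mem h

theorem euler_mem : ρ.euler ∈ ρ.diffOps := sum_mem fun j _ => mul_mem (ρ.x_mem j) (ρ.d_mem j)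

theorem act_x (j : Fin (n + 1)) : ρ.act (ρ.x j) = diagXU k n q j := by
  rw [x, map_diagElt, diagXU]
  congr 1
  · exact AlgHom.ext ρ.act_L
  · exact funext ρ.act_d

theorem act_D (h : MvPolynomial (Fin (n + 1)) k) : ρ.act (ρ.D h) = diagHU n q h := by
  rw [D, map_orderedCalc, diagHU]
  congr 2
  exact funext ρ.act_x

theorem act_euler : ρ.act ρ.euler = eulerU k n q := by
  simp only [euler, eulerU, map_sum, map_mul, act_x, act_d]

theorem eq_of_act_eq [CharZero k] {v w : A} (hv : v ∈ ρ.diffOps) (hw : w ∈ ρ.diffOps)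
    (h : ρ.act v = ρ.act w) : v = w :=
  sub_eq_zero.1 (ρ.eq_zero_of_act_eq_zero (sub_mem hv hw) (by rw [map_sub, h, sub_self]))

variable [CharZero k]

/-- On $S_q$ both operators multiply coefficients in a commutative polynomial ring. The transfer
principle carries the relation to `A`, and the next two identities arise in the same way. -/
theorem commute_D_x {r : ℕ} (y : RadicalBasis k n q r)
    (h : MvPolynomial (Fin (n + 1)) k) (j : Fin (n + 1)) : Commute (ρ.D h) (ρ.x j) :=
  ρ.eq_of_act_eq (mul_mem (ρ.D_mem h) (ρ.x_mem j)) (mul_mem (ρ.x_mem j) (ρ.D_mem h)) (by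
    rw [map_mul, map_mul, act_D, act_x]
    refine ((y.actsAs_diagHU h).mul (y.actsAs_diagXU j)).unique (y := y) ?_
    have := (y.actsAs_diagXU (q := q) j).mul (y.actsAs_diagHU h)
    rwa [(commute_mulLeft _ _).eq] at this)

theorem d_mul_D {r : ℕ} (y : RadicalBasis k n q r)
    (h : MvPolynomial (Fin (n + 1)) k) (j : Fin (n + 1)) :
    ρ.d j * ρ.D h = ρ.D h * ρ.d j + ρ.D (MvPolynomial.pderiv j h) :=
  ρ.eq_of_act_eq (mul_mem (ρ.d_mem j) (ρ.D_mem h))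
    (add_mem (mul_mem (ρ.D_mem h) (ρ.d_mem j)) (ρ.D_mem _)) (by
    rw [map_add, map_mul, map_mul, act_D, act_d, act_D]
    refine ((y.actsAs_pd j).mul (y.actsAs_diagHU h)).unique (y := y) fun p α => ?_
    rw [(((y.actsAs_diagHU h).mul (y.actsAs_pd j)).add (y.actsAs_diagHU _)) p α]
    simp [mul_comm])

theorem euler_mul_D {r : ℕ} (y : RadicalBasis k n q r)
    (h : MvPolynomial (Fin (n + 1)) k) {e : ℕ} (hh : h.IsHomogeneous e) :
    ρ.euler * ρ.D h = ρ.D h * ρ.euler + (e : k) • ρ.D h :=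
  ρ.eq_of_act_eq (mul_mem ρ.euler_mem (ρ.D_mem h))
    (add_mem (mul_mem (ρ.D_mem h) ρ.euler_mem) (ρ.diffOps.smul_mem (ρ.D_mem _) _)) (by
    rw [map_add, map_mul, map_mul, map_smul, act_D, act_euler]
    refine ((y.actsAs_eulerU).mul (y.actsAs_diagHU h)).unique (y := y) fun p α => ?_
    rw [(((y.actsAs_diagHU h).mul y.actsAs_eulerU).add ((y.actsAs_diagHU h).smul (e : k))) p α]
    congr 2
    have := hh.sum_X_mul_pderiv
    have h2 : ((e : k) • h : MvPolynomial (Fin (n + 1)) k) = e • h := Nat.cast_smul_eq_nsmul k e h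
    simp only [Module.End.mul_apply, LinearMap.sum_apply, LinearMap.add_apply,
      LinearMap.smul_apply, LinearMap.mulLeft_apply]
    rw [← smul_mul_assoc, h2, ← this, Finset.mul_sum, Finset.sum_mul, ← Finset.sum_add_distrib]
    refine Finset.sum_congr rfl fun j _ => ?_
    simp
    ring)

/-- The commutator of $D_h$ with $\partial_j$ is $-D_{\partial_jh}$, which commutes with $D_h$. -/
theorem d_mem_adNil {r : ℕ} (y : RadicalBasis k n q r)
    (h : MvPolynomial (Fin (n + 1)) k) (j : Fin (n + 1)) : ρ.d j ∈ adNil k (ρ.D h) := by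
  refine mem_adNil_of_innerDer_mem (mem_adNil_of_commute ?_)
  have e : innerDer k (ρ.D h) (ρ.d j) = -ρ.D (MvPolynomial.pderiv j h) := by
    rw [innerDer_apply, ρ.d_mul_D y]
    abel
  rw [e]
  refine Commute.neg_right (ρ.eq_of_act_eq (mul_mem (ρ.D_mem h) (ρ.D_mem _))
    (mul_mem (ρ.D_mem _) (ρ.D_mem h)) ?_)
  rw [map_mul, map_mul, act_D, act_D]
  refine ((y.actsAs_diagHU h).mul (y.actsAs_diagHU _)).unique (y := y) ?_
  have := (y.actsAs_diagHU (q := q) (MvPolynomial.pderiv j h)).mul (y.actsAs_diagHU h)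
  rwa [(commute_mulLeft _ _).eq] at this

/-- Left multiplications by elements of the Lie algebra are ad-nilpotent. -/
theorem L_ι_mem_adNil {r : ℕ} (y : RadicalBasis k n q r)
    (h : MvPolynomial (Fin (n + 1)) k) (w : NilLie k n q) :
    ρ.L (UniversalEnvelopingAlgebra.ι k w) ∈ adNil k (ρ.D h) := by
  -- Induction up the lower central series from its vanishing term. The `+ 1` keeps the index at
  -- least one, so that every $\partial_t$ kills `w`.
  have h1 : ∀ i : ℕ, ∀ w ∈ LieModule.lowerCentralSeries k (NilLie k n q) (NilLie k n q) (q - i + 1),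
      ρ.L (UniversalEnvelopingAlgebra.ι k w) ∈ adNil k (ρ.D h) := by
    intro i
    induction i with
    | zero =>
      intro w hw
      have hw' := LieModule.antitone_lowerCentralSeries k (NilLie k n q) (NilLie k n q)
        (show q ≤ q - 0 + 1 by omega) hw
      rw [lowerCentralSeries_nilLie_eq_bot, LieSubmodule.mem_bot] at hw'
      rw [hw', map_zero, map_zero]
      exact zero_mem _
    | succ i ih =>
      intro w hw
      have hw1 := lowerCentralSeries_le_one (Nat.le_add_left 1 _) hw
      refine mem_adNil_of_forall ρ.x h (ρ.commute_D_x y h) fun j => ?_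
      have hc : ∀ t, Commute (ρ.L (UniversalEnvelopingAlgebra.ι k w)) (ρ.d t) := fun t => by
        have := ρ.d_L t (UniversalEnvelopingAlgebra.ι k w)
        rw [pd_ι, coord_eq_zero t hw1, zero_smul, map_zero, add_zero] at this
        exact this.symm
      rw [x, diagElt, Finset.sum_mul, Finset.mul_sum, ← Finset.sum_sub_distrib]
      refine sum_mem fun a _ => ?_
      rw [smul_mul_assoc, mul_smul_comm, ← smul_sub]
      refine Subalgebra.smul_mem _ ?_ _
      -- Left multiplication by `w` commutes with the derivatives. So the commutator with $x_j$ has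
      -- terms $L([v,w])\partial^i$, and $[v,w]$ lies one step further down the series.
      rw [mul_assoc, ← (commute_orderedMonomial (fun t => hc _) _).eq, ← mul_assoc, ← mul_assoc,
        ← sub_mul, ← map_mul ρ.L, ← map_mul ρ.L, ← map_sub ρ.L, ← ι_lie]
      refine mul_mem (ih _ ?_) (orderedMonomial_mem _ (fun t => ρ.d_mem_adNil y h _) _)
      refine LieModule.antitone_lowerCentralSeries k (NilLie k n q) (NilLie k n q)
        (show q - i + 1 ≤ q - (i + 1) + 1 + 1 by omega) ?_
      exact lie_mem_lowerCentralSeries_succ k n q _ hw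
  have h2 : ∀ w ∈ LieModule.lowerCentralSeries k (NilLie k n q) (NilLie k n q) 1,
      ρ.L (UniversalEnvelopingAlgebra.ι k w) ∈ adNil k (ρ.D h) := fun w hw =>
    h1 q w (by rwa [Nat.sub_self])
  have h3 : ∀ j, ρ.L (X k n q j) ∈ adNil k (ρ.D h) := fun j => by
    -- The generators lie outside the derived algebra, but the diagonal element $x_j$ commutes with
    -- `D` and differs from left multiplication by $x_j$ only by terms already treated.
    have h4 : ρ.x j - ρ.L (X k n q j) ∈ (adNil k (ρ.D h)).toSubmodule :=
      diagElt_sub_mem _ j fun w hw p g i =>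
        (adNil k (ρ.D h)).mul_mem (h2 w hw) (orderedMonomial_mem _ (fun t => ρ.d_mem_adNil y h _) _)
    have h5 := sub_mem (mem_adNil_of_commute (k := k) (ρ.commute_D_x y h j)) h4
    rwa [sub_sub_cancel] at h5
  have h6 := y.mem_span_gvec w
  induction h6 using Submodule.span_induction with
  | mem w hw =>
    obtain ⟨j | u, rfl⟩ := hw
    · exact h3 j
    · refine h2 _ ?_
      have : y.vec u ∈ (LieModule.lowerCentralSeries k (NilLie k n q)
          (NilLie k n q) 1).toSubmodule := by
        rw [← y.span_eq]
        exact Submodule.subset_span ⟨u, rfl⟩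
      exact this
  | zero => rw [map_zero, map_zero]; exact zero_mem _
  | add v w _ _ hv hw => rw [map_add, map_add]; exact add_mem hv hw
  | smul c w _ hw => rw [map_smul, map_smul]; exact Subalgebra.smul_mem _ hw c

theorem L_mem_adNil {r : ℕ} (y : RadicalBasis k n q r)
    (h : MvPolynomial (Fin (n + 1)) k) (a : Sq k n q) : ρ.L a ∈ adNil k (ρ.D h) :=
  mem_subalgebra_of_ι ((adNil k (ρ.D h)).comap ρ.L) (ρ.L_ι_mem_adNil y h) a

/-- Right multiplications are ad-nilpotent. -/
theorem R_mem_adNil {r : ℕ} (y : RadicalBasis k n q r)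
    (h : MvPolynomial (Fin (n + 1)) k) (R : Sq k n q →ₗ[k] A) (hR1 : R 1 = 1) (hR : ∀ a b, R (a * b) = R b * R a)
    (hRL : ∀ a b, Commute (ρ.L a) (R b))
    (hRd : ∀ j a, ρ.d j * R a = R a * ρ.d j + R (pd k n q j a)) (a : Sq k n q) :
    R a ∈ adNil k (ρ.D h) := by
  have h1 : ∀ w, R (UniversalEnvelopingAlgebra.ι k w) ∈ adNil k (ρ.D h) := fun w => by
    set z := R (UniversalEnvelopingAlgebra.ι k w) with hz
    refine mem_adNil_of_forall ρ.x h (ρ.commute_D_x y h) fun j => ?_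
    -- The commutator is a scalar. Left multiplications commute with `z`, so the commutator of `z`
    -- with $x_j$ is assembled from ad-nilpotent elements.
    have h2 : ∀ t, ρ.d t * z - z * ρ.d t ∈ adNil k (ρ.D h) := fun t => by
      rw [hz, hRd, pd_ι, map_smul, hR1, add_sub_cancel_left]
      exact Subalgebra.smul_mem _ (one_mem _) _
    let Z : Subalgebra k A :=
      { carrier := {v | v ∈ adNil k (ρ.D h) ∧ v * z - z * v ∈ adNil k (ρ.D h)}
        mul_mem' := by
          rintro a b ⟨ha, ha'⟩ ⟨hb, hb'⟩
          refine ⟨mul_mem ha hb, ?_⟩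
          have : a * b * z - z * (a * b) = a * (b * z - z * b) + (a * z - z * a) * b := by
            noncomm_ring
          rw [this]
          exact add_mem (mul_mem ha hb') (mul_mem ha' hb)
        add_mem' := by
          rintro a b ⟨ha, ha'⟩ ⟨hb, hb'⟩
          refine ⟨add_mem ha hb, ?_⟩
          have : (a + b) * z - z * (a + b) = (a * z - z * a) + (b * z - z * b) := by
            noncomm_ring
          rw [this]
          exact add_mem ha' hb'
        algebraMap_mem' := fun c => ⟨Subalgebra.algebraMap_mem _ c, by
          rw [Algebra.commutes, sub_self]
          exact zero_mem _⟩ }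
    have h3 : ρ.x j ∈ Z := diagElt_mem Z (fun a => ⟨ρ.L_mem_adNil y h a, by
      rw [(hRL a _).eq, sub_self]
      exact zero_mem _⟩) (fun t => ⟨ρ.d_mem_adNil y h t, h2 t⟩) j
    exact h3.2
  let Z : Subalgebra k (Sq k n q) :=
    { carrier := {a | R a ∈ adNil k (ρ.D h)}
      mul_mem' := fun {a b} (ha : R a ∈ adNil k (ρ.D h)) (hb : R b ∈ adNil k (ρ.D h)) => by
        change R (a * b) ∈ adNil k (ρ.D h)
        rw [hR]
        exact mul_mem hb ha
      add_mem' := fun {a b} (ha : R a ∈ adNil k (ρ.D h)) (hb : R b ∈ adNil k (ρ.D h)) => by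
        change R (a + b) ∈ adNil k (ρ.D h)
        rw [map_add]
        exact add_mem ha hb
      algebraMap_mem' := fun c => by
        change R (algebraMap _ _ c) ∈ adNil k (ρ.D h)
        rw [Algebra.algebraMap_eq_smul_one, map_smul, hR1]
        exact Subalgebra.smul_mem _ (one_mem _) c }
  exact mem_subalgebra_of_ι Z h1 a

end DiffRep

/-! ## Ideals of fractions -/

section FracIdeal

variable {k : Type u} [Field k] {A B : Type u} [Ring A] [Algebra k A] [Ring B] [Algebra k B]
  (f : B →ₐ[k] A) (J : Submodule k B)

theorem frac_add {b : B} {c : A} (h₁ : f b * c = 1) (h₂ : c * f b = 1) (a a' : B) (d d' : ℕ) :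
    f a * c ^ d + f a' * c ^ d' = f (a * b ^ d' + a' * b ^ d) * c ^ (d + d') := by
  have hc : Commute (f b) c := h₁.trans h₂.symm
  have key : ∀ d, f b ^ d * c ^ d = 1 := fun d => by rw [← hc.mul_pow, h₁, one_pow]
  rw [map_add, map_mul, map_mul, map_pow, map_pow, add_mul, mul_assoc, mul_assoc]
  nth_rewrite 2 [pow_add]
  rw [add_comm d d', pow_add, ← mul_assoc (f b ^ d'), key, one_mul, ← mul_assoc (f b ^ d), key,
    one_mul]

/-- The fractions `f a * c ^ d` with `a ∈ J`, where `c` is the inverse of `f b`. -/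
def fracSubmodule {b : B} {c : A} (h₁ : f b * c = 1) (h₂ : c * f b = 1)
    (hr : ∀ a ∈ J, ∀ b, a * b ∈ J) : Submodule k A where
  carrier := {u | ∃ a ∈ J, ∃ d : ℕ, u = f a * c ^ d}
  zero_mem' := ⟨0, zero_mem _, 0, by rw [map_zero, zero_mul]⟩
  add_mem' := by
    rintro _ _ ⟨a, ha, d, rfl⟩ ⟨a', ha', d', rfl⟩
    exact ⟨_, add_mem (hr _ ha _) (hr _ ha' _), _, frac_add f h₁ h₂ a a' d d'⟩
  smul_mem' := by
    rintro s _ ⟨a, ha, d, rfl⟩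
    exact ⟨s • a, J.smul_mem s ha, d, by rw [map_smul, smul_mul_assoc]⟩

variable {f J} {b : B} {c : A} (h₁ : f b * c = 1) (h₂ : c * f b = 1)
    (hl : ∀ a ∈ J, ∀ b, b * a ∈ J) (hr : ∀ a ∈ J, ∀ b, a * b ∈ J)
    (hc : ∀ a ∈ J, Commute (f a) c)
    (hgen : ∀ S : Subalgebra k A, (∀ a, f a ∈ S) → c ∈ S → ∀ u, u ∈ S)

/-- By `hc` the denominators can be moved past numerators from `J`, so products with `f x` and with
`c` are again fractions. The multipliers that preserve the fractions form a subalgebra, which is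
everything by `hgen`. -/
theorem fracSubmodule_mul_mem (u : A) {v : A} (hv : v ∈ fracSubmodule f J h₁ h₂ hr)
    (hl : ∀ a ∈ J, ∀ b, b * a ∈ J) (hc : ∀ a ∈ J, Commute (f a) c)
    (hgen : ∀ S : Subalgebra k A, (∀ a, f a ∈ S) → c ∈ S → ∀ u, u ∈ S) :
    u * v ∈ fracSubmodule f J h₁ h₂ hr ∧ v * u ∈ fracSubmodule f J h₁ h₂ hr := by
  let G := fracSubmodule f J h₁ h₂ hr
  let S : Subalgebra k A :=
    { carrier := {u | ∀ v ∈ G, u * v ∈ G ∧ v * u ∈ G}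
      mul_mem' := fun {u w} hu hw v hv => by
        rw [mul_assoc, ← mul_assoc v]
        exact ⟨(hu _ (hw v hv).1).1, (hw _ (hu v hv).2).2⟩
      add_mem' := fun {u w} hu hw v hv => by
        rw [add_mul, mul_add]
        exact ⟨add_mem (hu v hv).1 (hw v hv).1, add_mem (hu v hv).2 (hw v hv).2⟩
      algebraMap_mem' := fun s v hv => by
        rw [← Algebra.commutes, ← Algebra.smul_def]
        exact ⟨G.smul_mem s hv, G.smul_mem s hv⟩ }
  refine hgen S ?_ ?_ u v hv
  · rintro x _ ⟨a, ha, d, rfl⟩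
    refine ⟨⟨x * a, hl a ha x, d, by rw [map_mul, mul_assoc]⟩, a * x, hr a ha x, d, ?_⟩
    rw [((hc a ha).pow_right d).eq, ((hc _ (hr a ha x)).pow_right d).eq, map_mul, mul_assoc]
  · rintro _ ⟨a, ha, d, rfl⟩
    exact ⟨⟨a, ha, d + 1, by rw [← mul_assoc, ← (hc a ha).eq, mul_assoc, pow_succ']⟩,
      a, ha, d + 1, by rw [mul_assoc, pow_succ]⟩

/-- The fractions `f a * c ^ d` with `a ∈ J` as an ideal. -/
def fracIdeal (h₁ : f b * c = 1) (h₂ : c * f b = 1)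
    (hl : ∀ a ∈ J, ∀ b, b * a ∈ J) (hr : ∀ a ∈ J, ∀ b, a * b ∈ J)
    (hc : ∀ a ∈ J, Commute (f a) c)
    (hgen : ∀ S : Subalgebra k A, (∀ a, f a ∈ S) → c ∈ S → ∀ u, u ∈ S) : Ideal A :=
  { (fracSubmodule f J h₁ h₂ hr).toAddSubmonoid with
    smul_mem' := fun u _ hv => (fracSubmodule_mul_mem h₁ h₂ hr u hv hl hc hgen).1 }

theorem fracIdeal_isTwoSided : (fracIdeal h₁ h₂ hl hr hc hgen).IsTwoSided :=
  ⟨fun {_} u hv => (fracSubmodule_mul_mem h₁ h₂ hr u hv hl hc hgen).2⟩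

end FracIdeal

/-! ## The filtration of the topological localization -/

section Filtration

variable {k : Type u} [Field k] {n q : ℕ} {r : ℕ} (y : RadicalBasis k n q r)
  (h : MvPolynomial (Fin (n + 1)) k)

theorem Q.mem_of_forall {s : ℕ} (S : Subalgebra k (Q y h s)) (h1 : ∀ a, Q.of y h s a ∈ S)
    (h2 : Q.inv y h s ∈ S) (u : Q y h s) : u ∈ S := by
  let f : Q y h s →ₐ[k] S := Q.lift y h s ((Q.of y h s).codRestrict S h1)
    (fun a ha => Subtype.ext (Q.of_eq_zero y h ha)) ⟨_, h2⟩
    (Subtype.ext (Q.of_mul_inv y h s)) (Subtype.ext (Q.inv_mul_of y h s))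
  have hf : S.val.comp f = AlgHom.id k (Q y h s) := Q.algHom_ext y h fun a => by
    change ((f (Q.of y h s a) : S) : Q y h s) = Q.of y h s a
    rw [Q.lift_of]
    rfl
  have : (f u : Q y h s) = u := DFunLike.congr_fun hf u
  rw [← this]
  exact (f u).2

variable [CharZero k]

/-- The commutator of an element of $\mathcal J_t$ with $h(\mathbf x)$ lies in $\mathcal J_{t+1}$,
hence vanishes in this localization. Commuting with an element implies commuting with its inverse.
-/
theorem Q.commute_of_inv {t : ℕ} {a : Sq k n q} (ha : a ∈ y.J t) :
    Commute (Q.of y h (t + 1) a) (Q.inv y h (t + 1)) := by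
  have h1 : Commute (Q.of y h (t + 1) a) (Q.of y h (t + 1) (hx h)) := by
    have := Q.of_eq_zero y h (y.hx_commutator_mem_J h ha)
    rw [map_sub, map_mul, map_mul, sub_eq_zero] at this
    exact this.symm
  have h2 := congrArg (fun z => Q.inv y h (t + 1) * z * Q.inv y h (t + 1)) h1.eq
  simp only [mul_assoc, Q.of_mul_inv, mul_one] at h2
  rw [← mul_assoc (Q.inv y h (t + 1)) (Q.of y h (t + 1) (hx h)), Q.inv_mul_of, one_mul] at h2
  exact h2.symm

/-- The kernel of a transition homomorphism consists of fractions. -/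
theorem Q.exists_frac_of_trans_eq_zero {t : ℕ} {u : Q y h (t + 1)} (hu : Q.trans y h t u = 0) :
    ∃ a ∈ y.J t, ∃ d : ℕ, u = Q.of y h (t + 1) a * Q.inv y h (t + 1) ^ d := by
  let G := fracIdeal (f := Q.of y h (t + 1)) (J := y.J t) (Q.of_mul_inv y h _) (Q.inv_mul_of y h _)
    (fun a ha b => y.mul_mem_J_left b ha) (fun a ha b => y.mul_mem_J_right b ha)
    (fun a ha => Q.commute_of_inv y h ha) (Q.mem_of_forall y h)
  have : G.IsTwoSided := fracIdeal_isTwoSided _ _ _ _ _ _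
  let p : Q y h (t + 1) →ₐ[k] Q y h (t + 1) ⧸ G := Ideal.Quotient.mkₐ k G
  have hp : ∀ z, p z = 0 ↔ z ∈ G := fun z => Ideal.Quotient.eq_zero_iff_mem
  -- The ideal `G` contains the image of $\mathcal J_t$, so the quotient by `G` receives a map from
  -- the localization at level `t`. The projection factors through the transition map, whose kernel
  -- therefore lies in `G`.
  let g : Q y h t →ₐ[k] Q y h (t + 1) ⧸ G := Q.lift y h t (p.comp (Q.of y h (t + 1)))
    (fun a ha => (hp _).2 ⟨a, ha, 0, by rw [pow_zero, mul_one]; rfl⟩) (p (Q.inv y h (t + 1)))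
    (by rw [AlgHom.comp_apply, ← map_mul, Q.of_mul_inv, map_one])
    (by rw [AlgHom.comp_apply, ← map_mul, Q.inv_mul_of, map_one])
  have hg : g.comp (Q.trans y h t) = p := Q.algHom_ext y h fun a => by
    rw [AlgHom.comp_apply, Q.trans_of]
    exact Q.lift_of y h t _ _ _ _ _ a
  have h3 : p u = 0 := by rw [← hg, AlgHom.comp_apply, hu, map_zero]
  exact (hp u).1 h3

end Filtration

/-! ## The topology of the topological localization -/

section Topology

variable {k : Type u} [Field k] {n q : ℕ} {r : ℕ} (y : RadicalBasis k n q r)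
  (h : MvPolynomial (Fin (n + 1)) k)

/-- The projection of the inverse limit. -/
def topLoc.proj (s : ℕ) : topLoc y h →ₐ[k] Q y h s :=
  (Pi.evalAlgHom k (fun s => Q y h s) s).comp (topLoc y h).val

theorem topLoc.trans_proj (s : ℕ) (u : topLoc y h) :
    Q.trans y h s (topLoc.proj y h (s + 1) u) = topLoc.proj y h s u := u.2 s

theorem topLoc.ext_proj {u v : topLoc y h} (H : ∀ s, topLoc.proj y h s u = topLoc.proj y h s v) :
    u = v := Subtype.ext (funext H)

/-- The neighbourhood `F_s` of zero: the kernel of the projection to the localization of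
`S_q / J_s`. -/
def topLoc.filt (s : ℕ) : Submodule k (topLoc y h) :=
  LinearMap.ker (topLoc.proj y h s).toLinearMap

variable {y h}

theorem topLoc.mem_filt {s : ℕ} {u : topLoc y h} :
    u ∈ topLoc.filt y h s ↔ topLoc.proj y h s u = 0 := Iff.rfl

theorem topLoc.sub_mem_filt {s : ℕ} {u v : topLoc y h} :
    u - v ∈ topLoc.filt y h s ↔ topLoc.proj y h s u = topLoc.proj y h s v := by
  rw [topLoc.mem_filt, map_sub, sub_eq_zero]

theorem topLoc.filt_anti : Antitone (topLoc.filt y h) :=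
  antitone_nat_of_succ_le fun s u hu => by
    rw [topLoc.mem_filt] at hu ⊢
    rw [← topLoc.trans_proj, hu, map_zero]

theorem topLoc.mul_mem_filt_left {s : ℕ} (u : topLoc y h) {v : topLoc y h}
    (hv : v ∈ topLoc.filt y h s) : u * v ∈ topLoc.filt y h s := by
  rw [topLoc.mem_filt] at hv ⊢
  rw [map_mul, hv, mul_zero]

theorem topLoc.mul_mem_filt_right {s : ℕ} {u : topLoc y h} (v : topLoc y h)
    (hu : u ∈ topLoc.filt y h s) : u * v ∈ topLoc.filt y h s := by
  rw [topLoc.mem_filt] at hu ⊢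
  rw [map_mul, hu, zero_mul]

theorem topLoc.eq_zero_of_forall {u : topLoc y h} (hu : ∀ s, u ∈ topLoc.filt y h s) : u = 0 :=
  topLoc.ext_proj y h fun s => by rw [topLoc.mem_filt.1 (hu s), map_zero]

theorem topLoc.of_mem_filt {s : ℕ} {a : Sq k n q} (ha : a ∈ y.J s) :
    topLoc.of y h a ∈ topLoc.filt y h s := Q.of_eq_zero y h ha

theorem topLoc.of_mul_inv : topLoc.of y h (hx h) * topLoc.inv y h = 1 :=
  topLoc.ext_proj y h fun s => Q.of_mul_inv y h s

theorem topLoc.inv_mul_of : topLoc.inv y h * topLoc.of y h (hx h) = 1 :=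
  topLoc.ext_proj y h fun s => Q.inv_mul_of y h s

theorem topLoc.filt_zero [CharZero k] : topLoc.filt y h 0 = ⊤ := by
  refine eq_top_iff.2 fun u _ => ?_
  have h1 : (1 : Q y h 0) = 0 := by
    rw [← map_one (Q.of y h 0)]
    exact Q.of_eq_zero y h (by rw [y.J_zero]; trivial)
  rw [topLoc.mem_filt, ← one_mul (topLoc.proj y h 0 u), h1, zero_mul]

theorem topLoc.continuous_proj (s : ℕ) : Continuous (topLoc.proj y h s) :=
  (continuous_apply s).comp continuous_subtype_val

theorem topLoc.tendsto_iff {ι : Type*} {l : Filter ι} {f : ι → topLoc y h} {u : topLoc y h} :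
    Filter.Tendsto f l (nhds u) ↔ ∀ s, ∀ᶠ i in l, u - f i ∈ topLoc.filt y h s := by
  rw [tendsto_subtype_rng, tendsto_pi_nhds]
  refine forall_congr' fun s => ?_
  rw [nhds_discrete, Filter.tendsto_pure]
  refine Filter.eventually_congr (Filter.Eventually.of_forall fun i => ?_)
  rw [topLoc.sub_mem_filt]
  exact eq_comm

theorem topLoc.mem_closure_iff {S : Set (topLoc y h)} {u : topLoc y h} :
    u ∈ closure S ↔ ∀ s, ∃ v ∈ S, u - v ∈ topLoc.filt y h s := by
  constructor
  · intro hu s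
    have ho : IsOpen {v : topLoc y h | topLoc.proj y h s v = topLoc.proj y h s u} :=
      (isOpen_discrete {topLoc.proj y h s u}).preimage (topLoc.continuous_proj s)
    obtain ⟨v, hv, hv'⟩ := _root_.mem_closure_iff.1 hu _ ho rfl
    exact ⟨v, hv', topLoc.sub_mem_filt.2 hv.symm⟩
  · intro H
    choose v hv hv' using H
    refine mem_closure_of_tendsto (f := v) (b := Filter.atTop) (topLoc.tendsto_iff.2 fun s => ?_)
      (Filter.Eventually.of_forall hv)
    filter_upwards [Filter.eventually_ge_atTop s] with i hi
    exact topLoc.filt_anti hi (hv' i)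

theorem topLoc.isClosed_iff {S : Set (topLoc y h)} :
    IsClosed S ↔ ∀ u, (∀ s, ∃ v ∈ S, u - v ∈ topLoc.filt y h s) → u ∈ S := by
  rw [← closure_subset_iff_isClosed]
  exact forall_congr' fun u => by rw [topLoc.mem_closure_iff]

theorem topLoc.mem_topologicalClosure_iff {S : Submodule k (topLoc y h)} {u : topLoc y h} :
    u ∈ S.topologicalClosure ↔ ∀ s, ∃ v ∈ S, u - v ∈ topLoc.filt y h s :=
  topLoc.mem_closure_iff

/-- Terms of index at least `s` vanish at level `s`, so the projection of a finite sum is constant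
once the sum includes all indices below `s`. -/
theorem topLoc.hasSum_iff {f : ℕ → topLoc y h} (hf : ∀ m, f m ∈ topLoc.filt y h m)
    {u : topLoc y h} :
    HasSum f u ↔ ∀ s, u - ∑ m ∈ Finset.range s, f m ∈ topLoc.filt y h s := by
  have key : ∀ s, ∀ A : Finset ℕ, Finset.range s ⊆ A →
      topLoc.proj y h s (∑ m ∈ A, f m) = topLoc.proj y h s (∑ m ∈ Finset.range s, f m) := by
    intro s A hA
    rw [map_sum, map_sum]
    refine (Finset.sum_subset hA fun m _ hm => ?_).symm
    exact topLoc.filt_anti (not_lt.1 fun hlt => hm (Finset.mem_range.2 hlt)) (hf m)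
  have h0 : HasSum f u ↔ Filter.Tendsto (fun A : Finset ℕ => ∑ m ∈ A, f m) Filter.atTop
    (nhds u) := Iff.rfl
  rw [h0, topLoc.tendsto_iff]
  refine forall_congr' fun s => ?_
  simp only [topLoc.sub_mem_filt]
  constructor
  · intro H
    obtain ⟨A, hA⟩ := Filter.eventually_atTop.1 H
    rw [hA (A ∪ Finset.range s) Finset.subset_union_left, key s _ Finset.subset_union_right]
  · intro H
    filter_upwards [Filter.eventually_ge_atTop (Finset.range s)] with A hA
    rw [H, key s A hA]

theorem topLoc.exists_hasSum {f : ℕ → topLoc y h} (hf : ∀ m, f m ∈ topLoc.filt y h m) :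
    ∃ u, HasSum f u := by
  have H : ∀ s, Q.trans y h s (topLoc.proj y h (s + 1) (∑ m ∈ Finset.range (s + 1), f m)) =
      topLoc.proj y h s (∑ m ∈ Finset.range s, f m) := fun s => by
    rw [topLoc.trans_proj, ← topLoc.sub_mem_filt, Finset.sum_range_succ, add_sub_cancel_left]
    exact hf s
  obtain ⟨u, hu⟩ : ∃ u : topLoc y h, ∀ s, topLoc.proj y h s u =
    topLoc.proj y h s (∑ m ∈ Finset.range s, f m) := 
      ⟨⟨fun s => topLoc.proj y h s (∑ m ∈ Finset.range s, f m), H⟩, fun _ => rfl⟩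
  exact ⟨u, (topLoc.hasSum_iff hf).2 fun s => topLoc.sub_mem_filt.2 (hu s)⟩

variable [CharZero k]

theorem topLoc.exists_frac {t : ℕ} {u : topLoc y h} (hu : u ∈ topLoc.filt y h t) :
    ∃ a ∈ y.J t, ∃ d : ℕ,
      u - topLoc.of y h a * topLoc.inv y h ^ d ∈ topLoc.filt y h (t + 1) := by
  have hu' : Q.trans y h t (topLoc.proj y h (t + 1) u) = 0 := by
    rw [topLoc.trans_proj, topLoc.mem_filt.1 hu]
  obtain ⟨a, ha, d, hd⟩ := Q.exists_frac_of_trans_eq_zero y h hu'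
  have e : topLoc.proj y h (t + 1) (topLoc.of y h a * topLoc.inv y h ^ d) =
      Q.of y h (t + 1) a * Q.inv y h (t + 1) ^ d :=
    (map_mul _ _ _).trans (congrArg _ (map_pow _ _ _))
  exact ⟨a, ha, d, topLoc.sub_mem_filt.2 (hd.trans e.symm)⟩

end Topology

/-! ## Twisted derivations -/

section TwistedDerivation

variable {k : Type u} [Field k] {A B : Type u} [Ring A] [Algebra k A] [Ring B] [Algebra k B]

/-- The elements annihilated by a derivation relative to an endomorphism `σ`. -/
def twistedConstants (σ : A →ₐ[k] B) (δ : A →ₗ[k] B)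
    (hδ : ∀ a b, δ (a * b) = δ a * σ b + σ a * δ b) : Subalgebra k A where
  carrier := {a | δ a = 0}
  mul_mem' := fun {a b} (ha : δ a = 0) (hb : δ b = 0) => by
    change δ (a * b) = 0
    rw [hδ, ha, hb, zero_mul, mul_zero, add_zero]
  add_mem' := fun {a b} (ha : δ a = 0) (hb : δ b = 0) => by
    change δ (a + b) = 0
    rw [map_add, ha, hb, add_zero]
  algebraMap_mem' := fun c => by
    have h1 := hδ 1 1
    rw [map_one σ, mul_one, one_mul, mul_one, left_eq_add] at h1
    change δ (algebraMap k A c) = 0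
    rw [Algebra.algebraMap_eq_smul_one, map_smul, h1, smul_zero]

theorem mem_twistedConstants {σ : A →ₐ[k] B} {δ : A →ₗ[k] B}
    {hδ : ∀ a b, δ (a * b) = δ a * σ b + σ a * δ b} {a : A} :
    a ∈ twistedConstants σ δ hδ ↔ δ a = 0 := Iff.rfl

theorem mem_twistedConstants_of_inverse {σ : A →ₐ[k] B} {δ : A →ₗ[k] B}
    {hδ : ∀ a b, δ (a * b) = δ a * σ b + σ a * δ b} {b c : A} (h₁ : b * c = 1) (h₂ : c * b = 1)
    (hb : b ∈ twistedConstants σ δ hδ) : c ∈ twistedConstants σ δ hδ := by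
  rw [mem_twistedConstants] at hb ⊢
  have h3 : σ b * δ c = 0 := by
    have h4 : δ 1 = 0 := one_mem (twistedConstants σ δ hδ)
    rw [← h₁, hδ, hb, zero_mul, zero_add] at h4
    exact h4
  calc δ c = σ (c * b) * δ c := by rw [h₂, map_one, one_mul]
    _ = 0 := by rw [map_mul, mul_assoc, h3, mul_zero]

theorem derivation_commutator {δ δ' : Module.End k A}
    (hδ : ∀ a b, δ (a * b) = δ a * b + a * δ b)
    (hδ' : ∀ a b, δ' (a * b) = δ' a * b + a * δ' b) (a b : A) :
    (δ * δ' - δ' * δ) (a * b) = (δ * δ' - δ' * δ) a * b + a * (δ * δ' - δ' * δ) b := by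
  simp only [LinearMap.sub_apply, Module.End.mul_apply, hδ, hδ', map_add]
  noncomm_ring

/-- The defect of commutation of $\delta$ and $\sigma$ is a $\sigma$-derivation. It vanishes on
inverses of elements it kills, so identities on the localizations need only be checked on the image
of $S_q$. -/
theorem derivation_scale {σ : A →ₐ[k] A} {δ : Module.End k A} (c : k)
    (hδ : ∀ a b, δ (a * b) = δ a * b + a * δ b) (a b : A) :
    (δ * σ.toLinearMap - c • (σ.toLinearMap * δ)) (a * b) =
      (δ * σ.toLinearMap - c • (σ.toLinearMap * δ)) a * σ b +
        σ a * (δ * σ.toLinearMap - c • (σ.toLinearMap * δ)) b := by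
  simp only [LinearMap.sub_apply, LinearMap.smul_apply, Module.End.mul_apply,
    AlgHom.toLinearMap_apply, map_mul, hδ, map_add, smul_add, sub_mul, mul_sub, smul_mul_assoc,
    mul_smul_comm]
  abel

end TwistedDerivation

/-! ## Scaling and the filtration of `S_q` -/

section ScaleU

variable {k : Type u} [Field k] {n q : ℕ} [NeZero q] {r : ℕ}

theorem RadicalBasis.scaleU_mem_J (y : RadicalBasis k n q r) {s : ℕ} {a : Sq k n q}
    (ha : a ∈ y.J s) : scaleU k n q a ∈ y.J s := by
  rw [y.J_eq_iSup] at ha ⊢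
  refine Submodule.iSup_induction _ (motive := fun a => scaleU k n q a ∈ _) ha ?_ ?_ ?_
  · intro i a ha
    rw [y.scaleU_apply ha]
    exact Submodule.smul_mem _ _ (Submodule.mem_iSup_of_mem i ha)
  · rw [map_zero]
    exact zero_mem _
  · intro a b ha hb
    rw [map_add]
    exact add_mem ha hb

theorem RadicalBasis.pd_scaleU [CharZero k] (y : RadicalBasis k n q r) (j : Fin (n + 1)) (a : Sq k n q) :
    pd k n q j (scaleU k n q a) = (2 : k) • scaleU k n q (pd k n q j a) := by
  have hm := derivation_scale (σ := scaleU k n q) 2 (pd_mul (k := k) (n := n) (q := q) j)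
  have := y.mem_subalgebra_of_var (twistedConstants _ _ hm) (fun i => ?_) a
  · rw [mem_twistedConstants, LinearMap.sub_apply, sub_eq_zero] at this
    exact this
  rw [mem_twistedConstants, LinearMap.sub_apply, sub_eq_zero]
  change pd k n q j (scaleU k n q (y.var i)) = (2 : k) • scaleU k n q (pd k n q j (y.var i))
  rw [RadicalBasis.var, scaleU_ι (y.gvec_mem i), map_smul, pd_ι, map_smul, map_one]
  obtain j' | u := i
  · exact congrArg (· • _) (pow_one _)
  · change _ • coord k n q j (y.vec u) • _ = _ • coord k n q j (y.vec u) • _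
    rw [coord_vec, zero_smul, smul_zero, smul_zero]

theorem RadicalBasis.scaleU_hx (y : RadicalBasis k n q r) {h : MvPolynomial (Fin (n + 1)) k}
    {e : ℕ} (hh : h.IsHomogeneous e) : scaleU k n q (hx h) = (2 : k) ^ e • hx h := by
  have : hx h ∈ y.bipiece e 0 := by
    rw [y.bipiece_eq]
    refine Submodule.subset_span ⟨h, hh, 0, ?_, ?_⟩
    · simp [RadicalBasis.weight]
    · rw [orderedMonomial_zero, mul_one]
      rfl
  rw [y.scaleU_apply this, add_zero]

end ScaleU

/-! ## Derivations and scaling on the topological localization -/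

section TopLocOps

variable {k : Type u} [Field k] {n q : ℕ} [NeZero q] {r : ℕ} (y : RadicalBasis k n q r)
  (h : MvPolynomial (Fin (n + 1)) k)

theorem Q.fst_partialHom (s : ℕ) (j : Fin (n + 1)) (u : Q y h s) :
    (Q.partialHom y h s j u).fst = u := by
  have H : (TrivSqZeroExt.fstHom k (Q y h s) (Q y h s)).comp (Q.partialHom y h s j) =
      AlgHom.id k (Q y h s) := Q.algHom_ext y h fun a =>
    (congrArg TrivSqZeroExt.fst (Q.partialHom_of y h s j a)).trans (Q.fst_preDual y h s j a)
  exact DFunLike.congr_fun H u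

/-- The derivation `∂_j` on the localization of `S_q / J_s`. -/
def Q.pd (s : ℕ) (j : Fin (n + 1)) : Module.End k (Q y h s) :=
  (TrivSqZeroExt.sndHom (Q y h s) (Q y h s)).restrictScalars k ∘ₗ (Q.partialHom y h s j).toLinearMap

theorem Q.pd_mul (s : ℕ) (j : Fin (n + 1)) (u v : Q y h s) :
    Q.pd y h s j (u * v) = Q.pd y h s j u * v + u * Q.pd y h s j v := by
  have h1 := TrivSqZeroExt.snd_mul (Q.partialHom y h s j u) (Q.partialHom y h s j v)
  rw [Q.fst_partialHom, Q.fst_partialHom] at h1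
  exact ((congrArg TrivSqZeroExt.snd (map_mul (Q.partialHom y h s j) u v)).trans h1).trans
    (_root_.add_comm _ _)

theorem Q.pd_of (s : ℕ) (j : Fin (n + 1)) (a : Sq k n q) :
    Q.pd y h s j (Q.of y h s a) = Q.of y h s (NCProj.pd k n q j a) :=
  (congrArg TrivSqZeroExt.snd (Q.partialHom_of y h s j a)).trans (Q.snd_preDual y h s j a)

theorem Q.eq_zero_of_twisted {s : ℕ} {σ : Q y h s →ₐ[k] Q y h s} {δ : Module.End k (Q y h s)}
    (hδ : ∀ a b, δ (a * b) = δ a * σ b + σ a * δ b) (h0 : ∀ a, δ (Q.of y h s a) = 0)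
    (u : Q y h s) : δ u = 0 :=
  Q.mem_of_forall y h (twistedConstants σ δ hδ) h0
    (mem_twistedConstants_of_inverse (Q.of_mul_inv y h s) (Q.inv_mul_of y h s) (h0 _)) u

theorem Q.pd_comm (s : ℕ) (i j : Fin (n + 1)) (u : Q y h s) :
    Q.pd y h s i (Q.pd y h s j u) = Q.pd y h s j (Q.pd y h s i u) := by
  have := Q.eq_zero_of_twisted y h (σ := AlgHom.id k _)
    (derivation_commutator (Q.pd_mul y h s i) (Q.pd_mul y h s j)) (fun a => by
      rw [LinearMap.sub_apply, sub_eq_zero, Module.End.mul_apply, Module.End.mul_apply, Q.pd_of,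
        Q.pd_of, Q.pd_of, Q.pd_of]
      exact congrArg _ (LinearMap.congr_fun (pd_commute i j).eq a)) u
  rwa [LinearMap.sub_apply, sub_eq_zero] at this

theorem topLoc.proj_partialD (s : ℕ) (j : Fin (n + 1)) (u : topLoc y h) :
    topLoc.proj y h s (partialD y h j u) = Q.pd y h s j (topLoc.proj y h s u) := rfl

theorem partialD_mul (j : Fin (n + 1)) (u v : topLoc y h) :
    partialD y h j (u * v) = partialD y h j u * v + u * partialD y h j v :=
  topLoc.ext_proj y h fun s => Q.pd_mul y h s j _ _

theorem partialD_of (j : Fin (n + 1)) (a : Sq k n q) :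
    partialD y h j (topLoc.of y h a) = topLoc.of y h (pd k n q j a) :=
  topLoc.ext_proj y h fun s => Q.pd_of y h s j a

theorem partialD_comm (i j : Fin (n + 1)) (u : topLoc y h) :
    partialD y h i (partialD y h j u) = partialD y h j (partialD y h i u) :=
  topLoc.ext_proj y h fun s => Q.pd_comm y h s i j _

theorem partialD_mem_filt (j : Fin (n + 1)) {s : ℕ} {u : topLoc y h}
    (hu : u ∈ topLoc.filt y h s) : partialD y h j u ∈ topLoc.filt y h s := by
  rw [topLoc.mem_filt, topLoc.proj_partialD, topLoc.mem_filt.1 hu, map_zero]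

variable [CharZero k] {h} {e : ℕ} (hh : h.IsHomogeneous e)

/-- The scaling homomorphism on the localization of `S_q / J_s`. -/
def Q.scale (s : ℕ) : Q y h s →ₐ[k] Q y h s :=
  Q.lift y h s ((Q.of y h s).comp (scaleU k n q))
    (fun _ ha => Q.of_eq_zero y h (y.scaleU_mem_J ha)) (((2 : k) ^ e)⁻¹ • Q.inv y h s)
    (by rw [AlgHom.comp_apply, y.scaleU_hx hh, map_smul, smul_mul_smul_comm, Q.of_mul_inv,
      mul_inv_cancel₀ (pow_ne_zero _ two_ne_zero), one_smul])
    (by rw [AlgHom.comp_apply, y.scaleU_hx hh, map_smul, smul_mul_smul_comm, Q.inv_mul_of,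
      inv_mul_cancel₀ (pow_ne_zero _ two_ne_zero), one_smul])

theorem Q.scale_of (s : ℕ) (a : Sq k n q) :
    Q.scale y hh s (Q.of y h s a) = Q.of y h s (scaleU k n q a) := Q.lift_of y h _ _ _ _ _ _ a

theorem Q.trans_scale (s : ℕ) (u : Q y h (s + 1)) :
    Q.trans y h s (Q.scale y hh (s + 1) u) = Q.scale y hh s (Q.trans y h s u) := by
  have H : (Q.trans y h s).comp (Q.scale y hh (s + 1)) =
      (Q.scale y hh s).comp (Q.trans y h s) := Q.algHom_ext y h fun a => by
    rw [AlgHom.comp_apply, AlgHom.comp_apply, Q.scale_of, Q.trans_of, Q.trans_of, Q.scale_of]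
  exact DFunLike.congr_fun H u

theorem Q.pd_scale (s : ℕ) (j : Fin (n + 1)) (u : Q y h s) :
    Q.pd y h s j (Q.scale y hh s u) = (2 : k) • Q.scale y hh s (Q.pd y h s j u) := by
  have := Q.eq_zero_of_twisted y h (derivation_scale (σ := Q.scale y hh s) 2 (Q.pd_mul y h s j))
    (fun a => by
      rw [LinearMap.sub_apply, sub_eq_zero]
      change Q.pd y h s j (Q.scale y hh s (Q.of y h s a)) =
        (2 : k) • Q.scale y hh s (Q.pd y h s j (Q.of y h s a))
      rw [Q.scale_of, Q.pd_of, Q.pd_of, Q.scale_of, y.pd_scaleU, map_smul]) u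
  rw [LinearMap.sub_apply, sub_eq_zero] at this
  exact this

/-- The scaling homomorphism on the topological localization. -/
def topLoc.scale : topLoc y h →ₐ[k] topLoc y h :=
  (AlgHom.pi fun s => (Q.scale y hh s).comp (topLoc.proj y h s)).codRestrict (topLoc y h)
    fun u s => (Q.trans_scale y hh s (topLoc.proj y h (s + 1) u)).trans
      (congrArg _ (topLoc.trans_proj y h s u))

theorem topLoc.proj_scale (s : ℕ) (u : topLoc y h) :
    topLoc.proj y h s (topLoc.scale y hh u) = Q.scale y hh s (topLoc.proj y h s u) := rfl

theorem topLoc.scale_of (a : Sq k n q) :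
    topLoc.scale y hh (topLoc.of y h a) = topLoc.of y h (scaleU k n q a) :=
  topLoc.ext_proj y h fun s => Q.scale_of y hh s a

theorem topLoc.scale_mem_filt {s : ℕ} {u : topLoc y h} (hu : u ∈ topLoc.filt y h s) :
    topLoc.scale y hh u ∈ topLoc.filt y h s := by
  rw [topLoc.mem_filt, topLoc.proj_scale, topLoc.mem_filt.1 hu, map_zero]

theorem partialD_scale (j : Fin (n + 1)) (u : topLoc y h) :
    partialD y h j (topLoc.scale y hh u) = (2 : k) • topLoc.scale y hh (partialD y h j u) :=
  topLoc.ext_proj y h fun s => Q.pd_scale y hh s j _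

end TopLocOps

/-! ## Complete filtered vector spaces -/

section CompleteFiltration

variable {k : Type u} [Field k] {V : Type u} [AddCommGroup V] [Module k V]

/-- A decreasing filtration by subspaces that is exhaustive, separated and complete. -/
structure CompleteFiltration (G : ℕ → Submodule k V) : Prop where
  anti : Antitone G
  zero : G 0 = ⊤
  eq_zero : ∀ u, (∀ s, u ∈ G s) → u = 0
  exists_lim : ∀ f : ℕ → V, (∀ m, f m ∈ G m) →
    ∃ u, ∀ s, u - ∑ m ∈ Finset.range s, f m ∈ G s

namespace CompleteFiltration

variable {G : ℕ → Submodule k V}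

/-- Successive approximation: a decreasing sequence of subspaces is expanded in series. -/
theorem exists_series (C E : ℕ → Submodule k V)
    (step : ∀ t, ∀ u ∈ E t, ∃ w ∈ C t, u - w ∈ E (t + 1)) {t : ℕ} {u : V} (hu : u ∈ E t) :
    ∃ f : ℕ → V, (∀ m, f m ∈ C m) ∧ (∀ m < t, f m = 0) ∧
      ∀ s, t ≤ s → u - ∑ m ∈ Finset.range s, f m ∈ E s := by
  choose! w hw hw' using step
  -- `v i` is the remainder after `i` corrections, starting at level `t`. The terms of the series
  -- below `t` are set to zero.
  let v : ℕ → V := fun i => Nat.rec u (fun i x => x - w (t + i) x) i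
  have hv0 : v 0 = u := rfl
  have hv1 : ∀ i, v (i + 1) = v i - w (t + i) (v i) := fun i => rfl
  have hv : ∀ i, v i ∈ E (t + i) := fun i => by
    induction i with
    | zero => exact hu
    | succ i ih => rw [hv1]; exact hw' _ _ ih
  refine ⟨fun m => if m < t then 0 else w m (v (m - t)), fun m => ?_, fun m hm => if_pos hm, ?_⟩
  · dsimp only
    split_ifs with hm
    · exact zero_mem _
    · have := hw _ _ (hv (m - t))
      rwa [Nat.add_sub_cancel' (not_lt.1 hm)] at this
  · intro s hs
    obtain ⟨i, rfl⟩ := Nat.exists_eq_add_of_le hs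
    have key : ∀ i, u - ∑ m ∈ Finset.range (t + i), (if m < t then 0 else w m (v (m - t))) =
        v i := fun i => by
      induction i with
      | zero =>
        rw [add_zero, Finset.sum_eq_zero, sub_zero, hv0]
        exact fun m hm => if_pos (Finset.mem_range.1 hm)
      | succ i ih =>
        rw [← add_assoc, Finset.sum_range_succ, ← sub_sub, ih, hv1,
          if_neg (not_lt.2 (Nat.le_add_right t i)), Nat.add_sub_cancel_left]
    rw [key]
    exact hv i

/-- If `u` lies in `G s` and `P u` in `G (s + 1)`, then `P₀ u` lies in `G (s + 1)`, and applying the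
left inverse `P₀'` puts `u` there as well. -/
theorem mem_of_sub_mem (hG : CompleteFiltration G) {P P₀ P₀' : Module.End k V} (h₂ : P₀' * P₀ = 1)
    (h0' : P₀' ∈ filtEnd G 0) (h1 : P - P₀ ∈ filtEnd G 1) {t : ℕ} {u : V} (hu : P u ∈ G t) :
    u ∈ G t := by
  have key : ∀ s ≤ t, u ∈ G s := fun s => by
    induction s with
    | zero => intro _; rw [hG.zero]; trivial
    | succ s ih =>
      intro hs
      have h3 := sub_mem (hG.anti hs hu) (h1 s u (ih (by omega)))
      rw [LinearMap.sub_apply, sub_sub_cancel] at h3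
      have h4 := h0' _ _ h3
      rwa [← Module.End.mul_apply, h₂, Module.End.one_apply] at h4
  exact key t le_rfl

theorem injective_of_sub_mem (hG : CompleteFiltration G) {P P₀ P₀' : Module.End k V} (h₂ : P₀' * P₀ = 1)
    (h0' : P₀' ∈ filtEnd G 0) (h1 : P - P₀ ∈ filtEnd G 1) : Function.Injective P :=
  (injective_iff_map_eq_zero P).2 fun u hu => hG.eq_zero u fun s =>
    hG.mem_of_sub_mem h₂ h0' h1 (by rw [hu]; exact zero_mem _)

/-- The element `P₀' v` solves `P u = v` up to one more step of the filtration. Successive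
corrections converge by completeness. -/
theorem surjective_of_sub_mem (hG : CompleteFiltration G) {P P₀ P₀' : Module.End k V} (h₁ : P₀ * P₀' = 1)
    (h0 : P ∈ filtEnd G 0) (h0' : P₀' ∈ filtEnd G 0) (h1 : P - P₀ ∈ filtEnd G 1) :
    Function.Surjective P := fun v => by
  obtain ⟨f, hf, -, hf'⟩ := exists_series (fun m => (G m).map P) G (fun t v hv => by
    refine ⟨P (P₀' v), ⟨P₀' v, h0' t v hv, rfl⟩, ?_⟩
    have := (G (t + 1)).neg_mem (h1 _ _ (h0' t v hv))
    rwa [LinearMap.sub_apply, ← Module.End.mul_apply P₀, h₁, Module.End.one_apply, neg_sub] at this)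
    (t := 0) (u := v) (by rw [hG.zero]; trivial)
  choose g hg hgf using hf
  obtain ⟨u, hu⟩ := hG.exists_lim g hg
  refine ⟨u, sub_eq_zero.1 (hG.eq_zero _ fun s => ?_)⟩
  have h3 := h0 _ _ (hu s)
  rw [map_sub, map_sum] at h3
  have h4 := sub_mem h3 (hf' s (Nat.zero_le s))
  simp only [hgf] at h4
  rwa [sub_sub_sub_cancel_right] at h4

end CompleteFiltration

end CompleteFiltration

/-! ## An axiomatic description of the topological localization -/

section FracSystem

/-- The structure of the topological localization of `S_q` at `h(x)`. -/
structure FracSystem {k : Type u} [Field k] {n q : ℕ} [NeZero q] {r : ℕ} (y : RadicalBasis k n q r)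
    (h : MvPolynomial (Fin (n + 1)) k) (T : Type u) [Ring T] [Algebra k T] where
  filt : ℕ → Submodule k T
  of : Sq k n q →ₐ[k] T
  inv : T
  d : Fin (n + 1) → Module.End k T
  scale : T →ₐ[k] T
  complete : CompleteFiltration filt
  mul_mem_left : ∀ s a, ∀ u ∈ filt s, a * u ∈ filt s
  mul_mem_right : ∀ s a, ∀ u ∈ filt s, u * a ∈ filt s
  of_mem : ∀ s, ∀ a ∈ y.J s, of a ∈ filt s
  of_mul_inv : of (hx h) * inv = 1
  inv_mul_of : inv * of (hx h) = 1
  exists_frac : ∀ t, ∀ u ∈ filt t, ∃ a ∈ y.J t, ∃ d : ℕ, u - of a * inv ^ d ∈ filt (t + 1)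
  d_mul : ∀ j u v, d j (u * v) = d j u * v + u * d j v
  d_of : ∀ j a, d j (of a) = of (pd k n q j a)
  d_comm : ∀ i j u, d i (d j u) = d j (d i u)
  d_mem : ∀ j s, ∀ u ∈ filt s, d j u ∈ filt s
  scale_of : ∀ a, scale (of a) = of (scaleU k n q a)
  scale_mem : ∀ s, ∀ u ∈ filt s, scale u ∈ filt s
  d_scale : ∀ j u, d j (scale u) = (2 : k) • scale (d j u)

namespace FracSystem

variable {k : Type u} [Field k] {n q : ℕ} [NeZero q] {r : ℕ} {y : RadicalBasis k n q r}
  {h : MvPolynomial (Fin (n + 1)) k} {T : Type u} [Ring T] [Algebra k T] (F : FracSystem y h T)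

theorem anti {s t : ℕ} (hst : s ≤ t) {u : T} (hu : u ∈ F.filt t) : u ∈ F.filt s :=
  F.complete.anti hst hu

theorem mem_filt_zero (u : T) : u ∈ F.filt 0 := by
  rw [F.complete.zero]
  trivial

/-- Each element of `filt i` is a fraction modulo `filt (i + 1)`, which gives a descending induction
from `N`. Linear statements modulo `filt N` thus need only be checked on right fractions. -/
theorem filt_le_of_frac {t N : ℕ} (G : Submodule k T) (hN : F.filt N ≤ G)
    (hG : ∀ a ∈ y.J t, ∀ d : ℕ, F.of a * F.inv ^ d ∈ G) : F.filt t ≤ G := by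
  have key : ∀ p i, t ≤ i → N ≤ i + p → F.filt i ≤ G := by
    intro p
    induction p with
    | zero => exact fun i _ hi => (F.complete.anti hi).trans hN
    | succ p ih =>
      intro i hi hi' u hu
      obtain ⟨a, ha, d, hd⟩ := F.exists_frac i u hu
      have := G.add_mem (ih (i + 1) (by omega) (by omega) hd) (hG a (y.J_anti hi ha) d)
      rwa [sub_add_cancel] at this
  exact key N t le_rfl (Nat.le_add_left N t)

/-- The operators of left multiplication. -/
def L : Sq k n q →ₐ[k] Module.End k T := (Algebra.lmul k T).comp F.of

/-- The diagonal operators. -/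
def X (j : Fin (n + 1)) : Module.End k T := diagElt F.L F.d j

/-- The diagonal operator of `h`. -/
def D : Module.End k T := orderedCalc k F.X h

theorem mulLeft_mem_filtEnd (a : T) : Algebra.lmul k T a ∈ filtEnd F.filt 0 :=
  fun s u hu => F.mul_mem_left s a u hu

theorem mulRight_mem_filtEnd (a : T) : LinearMap.mulRight k a ∈ filtEnd F.filt 0 :=
  fun s u hu => F.mul_mem_right s a u hu

theorem d_mem_filtEnd (j : Fin (n + 1)) : F.d j ∈ filtEndAlg F.filt := F.d_mem j

theorem X_mem_filtEnd (j : Fin (n + 1)) : F.X j ∈ filtEndAlg F.filt :=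
  diagElt_mem _ (fun _ => F.mulLeft_mem_filtEnd _) F.d_mem_filtEnd j

theorem D_mem_filtEnd : F.D ∈ filtEnd F.filt 0 :=
  orderedCalc_mem (filtEndAlg F.filt) F.X_mem_filtEnd h

variable [CharZero k]

theorem L_mem_filtEnd {s : ℕ} {a : Sq k n q} (ha : a ∈ y.J s) : F.L a ∈ filtEnd F.filt s :=
    fun t u hu => by
  refine F.filt_le_of_frac (N := t + s) ((F.filt (t + s)).comap (F.L a))
    (fun v (hv : v ∈ F.filt (t + s)) => F.mul_mem_left _ _ _ hv) (fun b hb d => ?_) hu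
  change F.of a * (F.of b * F.inv ^ d) ∈ F.filt (t + s)
  rw [← mul_assoc, ← map_mul]
  have := y.J_mul_mem ha hb
  rw [add_comm s t] at this
  exact F.mul_mem_right _ _ _ (F.of_mem _ _ this)

theorem X_sub_mem_filtEnd (j : Fin (n + 1)) :
    F.X j - F.L (NCProj.X k n q j) ∈ filtEnd F.filt 1 :=
  diagElt_sub_mem _ j fun _ hw _ _ _ =>
    filtEnd_mul_mem (j := 0) (F.L_mem_filtEnd (y.ι_mem_J hw))
      (orderedMonomial_mem (filtEndAlg F.filt) (fun _ => F.d_mem_filtEnd _) _)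

theorem D_sub_mem_filtEnd : F.D - F.L (hx h) ∈ filtEnd F.filt 1 := by
  rw [hx, map_orderedCalc]
  exact orderedCalc_sub_mem_filtEnd F.X_mem_filtEnd (fun _ => F.mulLeft_mem_filtEnd _)
    F.X_sub_mem_filtEnd h

theorem commute_inv : Commute F.inv (F.of (hx h)) := F.inv_mul_of.trans F.of_mul_inv.symm

/-- On a fraction $a\,h(\mathbf x)^{-d}$ the difference is $[h(\mathbf x),a]\,h(\mathbf x)^{-d}$,
and the commutator gains one step. -/
theorem L_sub_R_mem_filtEnd :
    F.L (hx h) - LinearMap.mulRight k (F.of (hx h)) ∈ filtEnd F.filt 1 := fun t u hu => by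
  refine F.filt_le_of_frac (N := t + 1) ((F.filt (t + 1)).comap
    (F.L (hx h) - LinearMap.mulRight k (F.of (hx h))))
    (fun v (hv : v ∈ F.filt (t + 1)) => sub_mem (F.mul_mem_left _ _ _ hv) (F.mul_mem_right _ _ _ hv))
    (fun b hb d => ?_) hu
  change F.of (hx h) * (F.of b * F.inv ^ d) - F.of b * F.inv ^ d * F.of (hx h) ∈ F.filt (t + 1)
  rw [mul_assoc _ _ (F.of (hx h)), (F.commute_inv.pow_left d).eq, ← mul_assoc, ← mul_assoc,
    ← sub_mul, ← map_mul, ← map_mul, ← map_sub]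
  exact F.mul_mem_right _ _ _ (F.of_mem _ _ (y.hx_commutator_mem_J h hb))

theorem D_sub_R_mem_filtEnd :
    F.D - LinearMap.mulRight k (F.of (hx h)) ∈ filtEnd F.filt 1 := by
  have := add_mem F.D_sub_mem_filtEnd F.L_sub_R_mem_filtEnd
  rwa [sub_add_sub_cancel] at this

theorem lmul_inv_mul : Algebra.lmul k T F.inv * F.L (hx h) = 1 := by
  rw [L, AlgHom.comp_apply, ← map_mul, F.inv_mul_of, map_one]

theorem mul_lmul_inv : F.L (hx h) * Algebra.lmul k T F.inv = 1 := by
  rw [L, AlgHom.comp_apply, ← map_mul, F.of_mul_inv, map_one]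

/-- `D` is a perturbation, of filtration degree one, of left multiplication by the invertible
element $h(\mathbf x)$. This is what makes sense of the commutative fractions $a/h^l$. -/
theorem D_bijective : Function.Bijective F.D :=
  ⟨F.complete.injective_of_sub_mem F.lmul_inv_mul (F.mulLeft_mem_filtEnd _) F.D_sub_mem_filtEnd,
    F.complete.surjective_of_sub_mem F.mul_lmul_inv F.D_mem_filtEnd (F.mulLeft_mem_filtEnd _)
      F.D_sub_mem_filtEnd⟩

theorem mem_filt_of_D {t : ℕ} {u : T} (hu : F.D u ∈ F.filt t) : u ∈ F.filt t :=
  F.complete.mem_of_sub_mem F.lmul_inv_mul (F.mulLeft_mem_filtEnd _) F.D_sub_mem_filtEnd hu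

theorem D_pow_injective (l : ℕ) : Function.Injective (F.D ^ l : Module.End k T) := by
  rw [Module.End.coe_pow]
  exact F.D_bijective.injective.iterate l

theorem D_pow_surjective (l : ℕ) : Function.Surjective (F.D ^ l : Module.End k T) := by
  rw [Module.End.coe_pow]
  exact F.D_bijective.surjective.iterate l

theorem mem_filt_of_D_pow {t : ℕ} (l : ℕ) {u : T} (hu : (F.D ^ l) u ∈ F.filt t) :
    u ∈ F.filt t := by
  induction l with
  | zero => exact hu
  | succ l ih =>
    rw [pow_succ', Module.End.mul_apply] at hu
    exact ih (F.mem_filt_of_D hu)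

end FracSystem

end FracSystem

theorem two_zpow_injective {k : Type*} [Field k] [CharZero k] :
    Function.Injective fun d : ℤ => (2 : k) ^ d := by
  intro a b hab
  have h1 : ((2 : ℚ) ^ a : ℚ) = (2 : ℚ) ^ b := by
    apply Rat.cast_injective (α := k)
    push_cast
    exact hab
  exact zpow_right_injective₀ (by norm_num) (by norm_num) h1

/-! ## Operators of a given degree with respect to an endomorphism -/

section DegreeEnd

variable {k : Type u} [Field k] [CharZero k] {V : Type u} [AddCommGroup V] [Module k V]

/-- The operators `P` with `σ P = 2 ^ m P σ`. -/
def degEnd (σ : Module.End k V) (m : ℤ) : Submodule k (Module.End k V) where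
  carrier := {P | σ * P = (2 : k) ^ m • (P * σ)}
  add_mem' := fun {P Q} (hP : σ * P = _) (hQ : σ * Q = _) => by
    change σ * (P + Q) = _
    rw [mul_add, hP, hQ, add_mul, smul_add]
  zero_mem' := by
    change σ * 0 = _
    rw [mul_zero, zero_mul, smul_zero]
  smul_mem' := fun c P (hP : σ * P = _) => by
    change σ * (c • P) = _
    rw [mul_smul_comm, hP, smul_mul_assoc, smul_comm]

variable {σ : Module.End k V}

theorem mem_degEnd {m : ℤ} {P : Module.End k V} :
    P ∈ degEnd σ m ↔ σ * P = (2 : k) ^ m • (P * σ) := Iff.rfl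

theorem degEnd_mul_mem {a b : ℤ} {P Q : Module.End k V} (hP : P ∈ degEnd σ a)
    (hQ : Q ∈ degEnd σ b) : P * Q ∈ degEnd σ (a + b) := by
  rw [mem_degEnd] at *
  rw [← mul_assoc, hP, smul_mul_assoc, mul_assoc, hQ, mul_smul_comm, smul_smul, mul_assoc,
    zpow_add₀ two_ne_zero]

theorem one_mem_degEnd : (1 : Module.End k V) ∈ degEnd σ 0 := by
  rw [mem_degEnd, zpow_zero, one_smul, mul_one, one_mul]

theorem degEnd_pow_mem {a : ℤ} {P : Module.End k V} (hP : P ∈ degEnd σ a) (l : ℕ) :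
    P ^ l ∈ degEnd σ (l * a) := by
  induction l with
  | zero => rw [pow_zero, Nat.cast_zero, zero_mul]; exact one_mem_degEnd
  | succ l ih =>
    rw [pow_succ, Nat.cast_succ, add_mul, one_mul]
    exact degEnd_mul_mem ih hP

theorem orderedMonomial_mem_degEnd {p : ℕ} {x : Fin p → Module.End k V} {a : ℤ}
    (hx : ∀ i, x i ∈ degEnd σ a) (β : Fin p → ℕ) :
    orderedMonomial x β ∈ degEnd σ ((∑ i, β i : ℕ) * a) := by
  induction p with
  | zero =>
    rw [orderedMonomial_zero_vars, Finset.univ_eq_empty, Finset.sum_empty, Nat.cast_zero, zero_mul]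
    exact one_mem_degEnd
  | succ p ih =>
    rw [orderedMonomial_succ, Fin.sum_univ_succ, Nat.cast_add, add_mul]
    exact degEnd_mul_mem (degEnd_pow_mem (hx 0) _) (ih (fun i => hx i.succ) _)

theorem orderedCalc_mem_degEnd {p : ℕ} {x : Fin p → Module.End k V}
    (hx : ∀ i, x i ∈ degEnd σ 1) {g : MvPolynomial (Fin p) k} {e : ℕ} (hg : g.IsHomogeneous e) :
    orderedCalc k x g ∈ degEnd σ e := by
  rw [g.as_sum, map_sum]
  refine Submodule.sum_mem _ fun β hβ => ?_
  have h1 : MvPolynomial.monomial β (g.coeff β) = g.coeff β • MvPolynomial.monomial β 1 := by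
    rw [MvPolynomial.smul_monomial, smul_eq_mul, mul_one]
  rw [h1, map_smul, orderedCalc_monomial]
  refine Submodule.smul_mem _ _ ?_
  have h2 := orderedMonomial_mem_degEnd hx β
  have h3 : ∑ i, β i = e := by
    rw [← Finsupp.degree_eq_sum, Finsupp.degree_eq_weight_one]
    exact hg (MvPolynomial.mem_support_iff.1 hβ)
  rwa [mul_one, h3] at h2

end DegreeEnd

namespace FracSystem

variable {k : Type u} [Field k] {n q : ℕ} [NeZero q] {r : ℕ} {y : RadicalBasis k n q r}
  {h : MvPolynomial (Fin (n + 1)) k} {T : Type u} [Ring T] [Algebra k T] (F : FracSystem y h T)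

/-! ### Transfer of operator identities -/

/-- The differential operators acting on `S_q` and on `T` simultaneously. -/
def rep : DiffRep k n q (Module.End k (Sq k n q) × Module.End k T) where
  L := (Algebra.lmul k (Sq k n q)).prod F.L
  d j := (pd k n q j, F.d j)
  act := AlgHom.fst k _ _
  act_L _ := rfl
  act_d _ := rfl
  d_comm i j := Prod.ext (pd_commute i j).eq (LinearMap.ext fun u => F.d_comm i j u)
  d_L j a := Prod.ext
    (LinearMap.ext fun b => (pd_mul j a b).trans (add_comm _ _))
    (LinearMap.ext fun u => by
      change F.d j (F.of a * u) = F.of a * F.d j u + F.of (pd k n q j a) * u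
      rw [F.d_mul, F.d_of, add_comm])

theorem rep_x (j : Fin (n + 1)) : F.rep.x j = (diagXU k n q j, F.X j) :=
  Prod.ext (F.rep.act_x j) (map_diagElt (AlgHom.snd k _ _) F.rep.L F.rep.d j)

theorem rep_D : F.rep.D h = (diagHU n q h, F.D) := by
  refine Prod.ext (F.rep.act_D h) ((map_orderedCalc (AlgHom.snd k _ _) F.rep.x h).trans ?_)
  rw [D]
  congr 1
  exact congrArg _ (funext fun j => congrArg Prod.snd (F.rep_x j))

/-- The pairs of operators on `S_q` and on `T` that are compatible with `S_q → T`. -/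
def compat : Subalgebra k (Module.End k (Sq k n q) × Module.End k T) where
  carrier := {P | ∀ a, P.2 (F.of a) = F.of (P.1 a)}
  mul_mem' := by
    intro P Q hP hQ a
    change P.2 (Q.2 (F.of a)) = F.of (P.1 (Q.1 a))
    rw [hQ, hP]
  add_mem' := by
    intro P Q hP hQ a
    change P.2 (F.of a) + Q.2 (F.of a) = F.of (P.1 a + Q.1 a)
    rw [hP, hQ, map_add]
  algebraMap_mem' := fun c a => (map_smul F.of c a).symm

theorem rep_L_mem_compat (a : Sq k n q) : F.rep.L a ∈ F.compat := fun b => (map_mul F.of a b).symm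

theorem rep_d_mem_compat (j : Fin (n + 1)) : F.rep.d j ∈ F.compat := F.d_of j

theorem rep_x_mem_compat (j : Fin (n + 1)) : F.rep.x j ∈ F.compat :=
  diagElt_mem _ F.rep_L_mem_compat F.rep_d_mem_compat j

theorem rep_D_mem_compat : F.rep.D h ∈ F.compat := orderedCalc_mem _ F.rep_x_mem_compat h

theorem D_pow_of (l : ℕ) (a : Sq k n q) : (F.D ^ l) (F.of a) = F.of ((diagHU n q h ^ l) a) := by
  have := pow_mem F.rep_D_mem_compat l
  rw [rep_D] at this
  exact this a

/-- The Euler operator. -/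
def euler : Module.End k T := ∑ j, F.X j * F.d j

theorem rep_euler : F.rep.euler = (eulerU k n q, F.euler) := by
  refine Prod.ext F.rep.act_euler ((map_sum (AlgHom.snd k _ _) _ _).trans ?_)
  refine Finset.sum_congr rfl fun j _ => ?_
  change (F.rep.x j).2 * _ = _
  rw [rep_x]
  rfl

theorem euler_of (a : Sq k n q) : F.euler (F.of a) = F.of (eulerU k n q a) := by
  have : F.rep.euler ∈ F.compat :=
    sum_mem fun j _ => mul_mem (F.rep_x_mem_compat j) (F.rep_d_mem_compat j)
  rw [rep_euler] at this
  exact this a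

theorem euler_mem_filt {s : ℕ} {u : T} (hu : u ∈ F.filt s) : F.euler u ∈ F.filt s :=
  (filtEndAlg F.filt).sum_mem (fun j _ => mul_mem (F.X_mem_filtEnd j) (F.d_mem_filtEnd j)) s u hu

variable [CharZero k] {e : ℕ} (hh : h.IsHomogeneous e)

theorem euler_mul_D_pow (hh : h.IsHomogeneous e) (l : ℕ) :
    F.euler * F.D ^ l = F.D ^ l * F.euler + ((l * e : ℕ) : k) • F.D ^ l := by
  have h1 : F.euler * F.D = F.D * F.euler + (e : k) • F.D := by
    have := congrArg Prod.snd (F.rep.euler_mul_D y h hh)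
    rw [rep_D, rep_euler] at this
    exact this
  induction l with
  | zero => simp
  | succ l ih =>
    rw [pow_succ, ← mul_assoc, ih, add_mul, mul_assoc, h1, mul_add, smul_mul_assoc, mul_smul_comm,
      ← mul_assoc, add_assoc, ← add_smul]
    congr 2
    push_cast
    ring

/-! ### Scaling -/

theorem L_ι_mem_degEnd {m : ℕ} {w : NilLie k n q} (hw : w ∈ lieComp k n q m) :
    F.L (UniversalEnvelopingAlgebra.ι k w) ∈ degEnd F.scale.toLinearMap m :=
  LinearMap.ext fun u => by
    change F.scale (F.of _ * u) = (2 : k) ^ (m : ℤ) • (F.of _ * F.scale u)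
    rw [map_mul, F.scale_of, scaleU_ι hw, map_smul, smul_mul_assoc, zpow_natCast]

theorem d_mem_degEnd (j : Fin (n + 1)) : F.d j ∈ degEnd F.scale.toLinearMap (-1) :=
  LinearMap.ext fun u => by
    change F.scale (F.d j u) = (2 : k) ^ (-1 : ℤ) • F.d j (F.scale u)
    rw [F.d_scale, smul_smul, zpow_neg_one, inv_mul_cancel₀ two_ne_zero, one_smul]

theorem X_mem_degEnd (j : Fin (n + 1)) : F.X j ∈ degEnd F.scale.toLinearMap 1 := by
  refine Submodule.sum_mem _ fun i _ => Submodule.smul_mem _ _ ?_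
  have := degEnd_mul_mem (F.L_ι_mem_degEnd (adWord_mem_lieComp j i))
    (orderedMonomial_mem_degEnd (fun t : Fin j => F.d_mem_degEnd (t.castLE j.is_lt.le))
      fun t => (i t : ℕ))
  -- In the term indexed by `i` the Lie monomial has degree $1+|i|$ and the derivatives have degree
  -- $-|i|$.
  have e : ((1 + ∑ t, (i t : ℕ) : ℕ) : ℤ) + ((∑ t, (i t : ℕ) : ℕ) : ℤ) * (-1) = 1 := by
    push_cast
    ring
  rwa [e] at this

theorem D_mem_degEnd (hh : h.IsHomogeneous e) : F.D ∈ degEnd F.scale.toLinearMap e :=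
  orderedCalc_mem_degEnd F.X_mem_degEnd hh

theorem scale_D_pow (hh : h.IsHomogeneous e) (l : ℕ) (u : T) :
    F.scale ((F.D ^ l) u) = (2 : k) ^ ((l : ℤ) * e) • (F.D ^ l) (F.scale u) :=
  LinearMap.congr_fun (degEnd_pow_mem (F.D_mem_degEnd hh) l) u

/-! ### Commutative fractions -/

/-- The commutative fractions with numerators in `N`. -/
def commLoc (N : Submodule k (Sq k n q)) : Submodule k T :=
  Submodule.span k {u | ∃ l : ℕ, ∃ a ∈ N, (F.D ^ l) u = F.of a}

/-- The commutative fractions of bidegree `(c, m)`. -/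
def bip (e : ℕ) (c : ℤ) (m : ℕ) : Submodule k T :=
  Submodule.span k {u | ∃ l d : ℕ, (d : ℤ) = c + l * e ∧
    ∃ a ∈ y.bipiece d m, (F.D ^ l) u = F.of a}

variable {F}

theorem euler_apply (hh : h.IsHomogeneous e) {c : ℤ} {m : ℕ} {u : T} (hu : u ∈ F.bip e c m) :
    F.euler u = (c : k) • u := by
  induction hu using Submodule.span_induction with
  | mem u hu =>
    obtain ⟨l, d, hd, a, ha, hu⟩ := hu
    apply F.D_pow_injective l
    have h1 := LinearMap.congr_fun (F.euler_mul_D_pow hh l) u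
    simp only [Module.End.mul_apply, LinearMap.add_apply, LinearMap.smul_apply] at h1
    rw [hu, F.euler_of, y.eulerU_apply ha, map_smul, ← sub_eq_iff_eq_add, ← sub_smul] at h1
    rw [← h1, map_smul, hu]
    congr 1
    have := congrArg (Int.cast : ℤ → k) hd
    push_cast at this ⊢
    rw [this]
    ring
  | zero => rw [map_zero, smul_zero]
  | add u v _ _ hu hv => rw [map_add, hu, hv, smul_add]
  | smul s u _ hu => rw [map_smul, hu, smul_comm]

theorem scale_apply (hh : h.IsHomogeneous e) {c : ℤ} {m : ℕ} {u : T} (hu : u ∈ F.bip e c m) :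
    F.scale u = (2 : k) ^ (c + m) • u := by
  induction hu using Submodule.span_induction with
  | mem u hu =>
    obtain ⟨l, d, hd, a, ha, hu⟩ := hu
    apply F.D_pow_injective l
    have h1 := F.scale_D_pow hh l u
    rw [hu, F.scale_of, y.scaleU_apply ha, map_smul, ← zpow_natCast] at h1
    rw [← inv_smul_eq_iff₀ (zpow_ne_zero _ two_ne_zero), smul_smul, ← zpow_neg,
      ← zpow_add₀ two_ne_zero] at h1
    rw [map_smul, hu, ← h1]
    congr 2
    push_cast
    rw [hd]
    ring
  | zero => rw [map_zero, smul_zero]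
  | add u v _ _ hu hv => rw [map_add, hu, hv, smul_add]
  | smul s u _ hu => rw [map_smul, hu, smul_comm]

theorem commLoc_le_filt {N : Submodule k (Sq k n q)} {s : ℕ} (hN : N ≤ y.J s) :
    F.commLoc N ≤ F.filt s :=
  Submodule.span_le.2 fun _ ⟨l, a, ha, hu⟩ =>
    F.mem_filt_of_D_pow l (by rw [hu]; exact F.of_mem s a (hN ha))

theorem commLoc_mono {N N' : Submodule k (Sq k n q)} (hN : N ≤ N') :
    F.commLoc N ≤ F.commLoc N' :=
  Submodule.span_mono fun _ ⟨l, a, ha, hu⟩ => ⟨l, a, hN ha, hu⟩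

/-- A decomposition of the numerator lifts to the fraction because $D^l$ is bijective. -/
theorem commLoc_iSup_le {ι : Sort*} (N : ι → Submodule k (Sq k n q)) :
    F.commLoc (⨆ i, N i) ≤ ⨆ i, F.commLoc (N i) := by
  refine Submodule.span_le.2 ?_
  rintro u ⟨l, a, ha, hu⟩
  suffices H : ∀ a ∈ ⨆ i, N i, ∀ u, (F.D ^ l) u = F.of a → u ∈ ⨆ i, F.commLoc (N i) from
    H a ha u hu
  intro a ha
  refine Submodule.iSup_induction _ (motive := fun a => ∀ u, (F.D ^ l) u = F.of a →
    u ∈ ⨆ i, F.commLoc (N i)) ha ?_ ?_ ?_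
  · intro i a ha u hu
    exact Submodule.mem_iSup_of_mem i (Submodule.subset_span ⟨l, a, ha, hu⟩)
  · intro u hu
    rw [map_zero] at hu
    rw [F.D_pow_injective l (hu.trans (map_zero _).symm)]
    exact zero_mem _
  · intro a b ha hb u hu
    obtain ⟨v, hv⟩ := F.D_pow_surjective l (F.of a)
    have h1 : (F.D ^ l) (u - v) = F.of b := by rw [map_sub, hu, hv, map_add, add_sub_cancel_left]
    have := add_mem (ha v hv) (hb _ h1)
    rwa [add_sub_cancel] at this

theorem commLoc_bipiece_le (e : ℕ) (N : Submodule k (Sq k n q)) (d m : ℕ) :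
    F.commLoc (N ⊓ y.bipiece d m) ≤ ⨆ c, F.commLoc (N ⊓ y.bipiece d m) ⊓ F.bip e c m := by
  refine Submodule.span_le.2 ?_
  rintro u ⟨l, a, ha, hu⟩
  exact Submodule.mem_iSup_of_mem ((d : ℤ) - l * e) ⟨Submodule.subset_span ⟨l, a, ha, hu⟩,
    Submodule.subset_span ⟨l, d, by ring, a, ha.2, hu⟩⟩

theorem bip_le_commLoc (e : ℕ) (c : ℤ) (m : ℕ) : F.bip e c m ≤ F.commLoc (y.piece m) :=
  Submodule.span_mono fun _ ⟨l, _, _, a, ha, hu⟩ => ⟨l, a, y.bipiece_le_piece _ _ ha, hu⟩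

theorem commLoc_piece_le (e m : ℕ) :
    F.commLoc (y.piece m) ≤ ⨆ c, F.bip e c m := by
  rw [y.piece_eq_iSup]
  refine (commLoc_iSup_le _).trans (iSup_le fun d => ?_)
  have := commLoc_bipiece_le (F := F) e ⊤ d m
  rw [top_inf_eq] at this
  exact this.trans (iSup_mono fun c => inf_le_right)

end FracSystem

namespace FracSystem

/-! ### The product decomposition -/

variable {k : Type u} [Field k] {n q : ℕ} [NeZero q] {r : ℕ} {y : RadicalBasis k n q r}
  {h : MvPolynomial (Fin (n + 1)) k} {T : Type u} [Ring T] [Algebra k T] (F : FracSystem y h T)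

/-- Convergence of a series. -/
def IsSum (f : ℕ → T) (u : T) : Prop := ∀ s, u - ∑ m ∈ Finset.range s, f m ∈ F.filt s

variable {F}

theorem IsSum.sub {f g : ℕ → T} {u v : T} (hf : F.IsSum f u) (hg : F.IsSum g v) :
    F.IsSum (fun m => f m - g m) (u - v) := fun s => by
  rw [Finset.sum_sub_distrib, sub_sub_sub_comm]
  exact sub_mem (hf s) (hg s)

theorem IsSum.add {f g : ℕ → T} {u v : T} (hf : F.IsSum f u) (hg : F.IsSum g v) :
    F.IsSum (fun m => f m + g m) (u + v) := fun s => by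
  rw [Finset.sum_add_distrib, add_sub_add_comm]
  exact add_mem (hf s) (hg s)

theorem IsSum.map {f : ℕ → T} {u : T} (hf : F.IsSum f u) {P : Module.End k T}
    (hP : P ∈ filtEnd F.filt 0) : F.IsSum (fun m => P (f m)) (P u) := fun s => by
  rw [← map_sum, ← map_sub]
  exact hP s _ (hf s)

theorem IsSum.eq {f : ℕ → T} {u v : T} (hu : F.IsSum f u) (hv : F.IsSum f v) : u = v :=
  sub_eq_zero.1 (F.complete.eq_zero _ fun s => by
    have := sub_mem (hu s) (hv s)
    rwa [sub_sub_sub_cancel_right] at this)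

variable (F)

/-- The space of convergent series with terms in prescribed subspaces. -/
def prodSub (C : ℕ → Submodule k T) : Submodule k T where
  carrier := {u | ∃ f : ℕ → T, (∀ m, f m ∈ C m) ∧ F.IsSum f u}
  zero_mem' := ⟨fun _ => 0, fun m => (C m).zero_mem, fun s => by simp⟩
  add_mem' := by
    rintro u v ⟨f, hf, hu⟩ ⟨g, hg, hv⟩
    exact ⟨fun m => f m + g m, fun m => (C m).add_mem (hf m) (hg m), hu.add hv⟩
  smul_mem' := by
    rintro c u ⟨f, hf, hu⟩
    refine ⟨fun m => c • f m, fun m => (C m).smul_mem c (hf m), fun s => ?_⟩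
    rw [← Finset.smul_sum, ← smul_sub]
    exact Submodule.smul_mem _ c (hu s)

theorem prodSub_mono {C C' : ℕ → Submodule k T} (hC : ∀ m, C m ≤ C' m) :
    F.prodSub C ≤ F.prodSub C' := fun _ ⟨f, hf, hu⟩ => ⟨f, fun m => hC m (hf m), hu⟩

theorem mem_prodSub_of_mem {C : ℕ → Submodule k T} (hC : ∀ m, C m ≤ F.filt m) {m : ℕ} {u : T}
    (hu : u ∈ C m) : u ∈ F.prodSub C := by
  refine ⟨Pi.single m u, fun i => ?_, fun s => ?_⟩
  · by_cases hi : i = m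
    · subst hi
      rwa [Pi.single_eq_same]
    · rw [Pi.single_eq_of_ne hi]
      exact zero_mem _
  · rw [Finset.sum_pi_single']
    split_ifs with hs
    · rw [sub_self]
      exact zero_mem _
    · rw [sub_zero]
      exact F.anti (not_lt.1 fun hlt => hs (Finset.mem_range.2 hlt)) (hC m hu)

variable [CharZero k] {e : ℕ}

theorem commLoc_piece_le_filt (m : ℕ) : F.commLoc (y.piece m) ≤ F.filt m :=
  commLoc_le_filt (y.piece_le_J le_rfl)

/-- The commutative fraction $v/h^l$ and the right fraction $v\,h(\mathbf x)^{-l}$ agree to leading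
order, since `D` agrees with right multiplication by $h(\mathbf x)$ to leading order. -/
theorem sub_mul_inv_pow_mem {t : ℕ} (l : ℕ) {v w : T} (hw : w ∈ F.filt t)
    (hv : (F.D ^ l) w = v) : w - v * F.inv ^ l ∈ F.filt (t + 1) := by
  induction l generalizing v with
  | zero =>
    rw [pow_zero, Module.End.one_apply] at hv
    rw [pow_zero, mul_one, hv, sub_self]
    exact zero_mem _
  | succ l ih =>
    subst hv
    have h1 : (F.D ^ l) w ∈ F.filt t := by
      refine (?_ : F.D ^ l ∈ filtEndAlg F.filt) t w hw
      exact pow_mem (show F.D ∈ filtEndAlg F.filt from F.D_mem_filtEnd) l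
    have h2 := F.mul_mem_right _ F.inv _ (F.D_sub_R_mem_filtEnd t _ h1)
    rw [LinearMap.sub_apply, LinearMap.mulRight_apply, sub_mul, mul_assoc, F.of_mul_inv,
      mul_one, ← Module.End.mul_apply, ← pow_succ'] at h2
    have h3 := sub_mem (ih rfl) (F.mul_mem_right _ (F.inv ^ l) _ h2)
    rwa [sub_mul, mul_assoc, ← pow_succ', sub_sub_eq_add_sub, sub_add_cancel] at h3

/-- Modulo the next step, an element is a right fraction with numerator in $\mathcal J_t$. The
numerator may be replaced by its part of weight `t`, and the right fraction by the commutative one.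
Iteration yields the series. -/
theorem exists_isSum {t : ℕ} {u : T} (hu : u ∈ F.filt t) :
    ∃ f : ℕ → T, (∀ m, f m ∈ F.commLoc (y.piece m)) ∧ (∀ m < t, f m = 0) ∧ F.IsSum f u := by
  obtain ⟨f, hf, hf0, hs⟩ := CompleteFiltration.exists_series
    (fun m => F.commLoc (y.piece m)) F.filt (fun t u hu => by
      obtain ⟨a, ha, d, hd⟩ := F.exists_frac t u hu
      obtain ⟨b, hb, hab⟩ := y.exists_piece_of_mem_J ha
      obtain ⟨w, hw⟩ := F.D_pow_surjective d (F.of b)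
      refine ⟨w, Submodule.subset_span ⟨d, b, hb, hw⟩, ?_⟩
      have h1 : w ∈ F.filt t := F.mem_filt_of_D_pow d (by
        rw [hw]
        exact F.of_mem _ _ (y.piece_le_J le_rfl hb))
      have h2 := F.sub_mul_inv_pow_mem d h1 hw
      have h3 := F.mul_mem_right _ (F.inv ^ d) _ (F.of_mem _ _ hab)
      have h4 := sub_mem (add_mem hd h3) h2
      rw [map_sub, sub_mul] at h4
      convert h4 using 1
      abel) hu
  refine ⟨f, hf, hf0, fun s => ?_⟩
  rcases le_total t s with hts | hst
  · exact hs s hts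
  · rw [Finset.sum_eq_zero fun m hm => hf0 m ((Finset.mem_range.1 hm).trans_le hst), sub_zero]
    exact F.anti hst hu

/-- The subspace `filt N'` is stable under scaling and the Euler operator. The terms split into
bihomogeneous fractions with distinct pairs of eigenvalues $(2^{c+m},c)$, so each of them lies in
it. -/
theorem mem_filt_of_sum_mem (hh : h.IsHomogeneous e) {f : ℕ → T}
    (hf : ∀ m, f m ∈ F.commLoc (y.piece m)) {N N' : ℕ}
    (hs : ∑ m ∈ Finset.range N, f m ∈ F.filt N') {m : ℕ} (hm : m < N) : f m ∈ F.filt N' := by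
  have h1 : ∀ m, ∃ g : ℤ →₀ T, (∀ c, g c ∈ F.bip e c m) ∧ ∑ c ∈ g.support, g c = f m := fun m =>
    (Submodule.mem_iSup_iff_exists_finsupp _ _).1 (commLoc_piece_le e m (hf m))
  choose g hg hgf using h1
  have h2 : ∑ i ∈ (Finset.range N).sigma fun m => (g m).support, g i.1 i.2 ∈ F.filt N' := by
    rw [Finset.sum_sigma]
    simpa only [hgf] using hs
  rw [← hgf]
  refine sum_mem fun c hc => ?_
  refine eigenvector_mem_of_sum_mem
    (fun a : Bool => bif a then F.scale.toLinearMap else F.euler)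
    (fun a (i : (_ : ℕ) × ℤ) => bif a then (2 : k) ^ (i.2 + i.1 : ℤ) else (i.2 : k)) ?_ (F.filt N')
    ?_ _ (fun i => g i.1 i.2) ?_ h2 ⟨m, c⟩ (Finset.mem_sigma.2 ⟨Finset.mem_range.2 hm, hc⟩)
  · rintro ⟨a, b⟩ ⟨a', b'⟩ hne
    by_contra! hcon
    have h3 : b + a = b' + a' := two_zpow_injective (hcon true)
    have h4 : b = b' := Int.cast_injective (α := k) (hcon false)
    have h5 : a = a' := by omega
    subst h4 h5
    exact hne rfl
  · intro a v hv
    cases a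
    · exact F.euler_mem_filt hv
    · exact F.scale_mem _ _ hv
  · intro a i
    cases a
    · exact euler_apply hh (hg _ _)
    · exact scale_apply hh (hg _ _)

variable {F}

theorem IsSum.eq_zero (hh : h.IsHomogeneous e) {f : ℕ → T}
    (hf : ∀ m, f m ∈ F.commLoc (y.piece m)) (h0 : F.IsSum f 0) (m : ℕ) : f m = 0 := by
  refine F.complete.eq_zero _ fun s => F.anti (le_max_left s (m + 1)) ?_
  refine F.mem_filt_of_sum_mem hh hf (N := max s (m + 1)) ?_ (by omega)
  have := h0 (max s (m + 1))
  rwa [zero_sub, neg_mem_iff] at this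

theorem IsSum.unique (hh : h.IsHomogeneous e) {f g : ℕ → T}
    (hf : ∀ m, f m ∈ F.commLoc (y.piece m)) (hg : ∀ m, g m ∈ F.commLoc (y.piece m)) {u : T}
    (hfu : F.IsSum f u) (hgu : F.IsSum g u) : f = g := funext fun m => by
  have h1 := hfu.sub hgu
  rw [sub_self] at h1
  exact sub_eq_zero.1 (IsSum.eq_zero hh (fun m => sub_mem (hf m) (hg m)) h1 m)

/-- An element of `filt s` has an expansion without terms below `s`. By uniqueness the difference of
the two expansions is of this kind, so the coefficients of index below `s` are continuous for the
filtration. -/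
theorem IsSum.eq_of_sub_mem (hh : h.IsHomogeneous e) {f g : ℕ → T}
    (hf : ∀ m, f m ∈ F.commLoc (y.piece m)) (hg : ∀ m, g m ∈ F.commLoc (y.piece m)) {u v : T}
    (hfu : F.IsSum f u) (hgv : F.IsSum g v) {s : ℕ} (huv : u - v ∈ F.filt s) {m : ℕ}
    (hm : m < s) : f m = g m := by
  obtain ⟨w, hw, hw0, hs⟩ := F.exists_isSum huv
  have h1 := congrFun (IsSum.unique hh (fun m => sub_mem (hf m) (hg m)) hw (hfu.sub hgv) hs) m
  rw [hw0 m hm] at h1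
  exact sub_eq_zero.1 h1

/-- Products of subspaces are closed. -/
theorem mem_prodSub_of_forall (hh : h.IsHomogeneous e) {C : ℕ → Submodule k T}
    (hC : ∀ m, C m ≤ F.commLoc (y.piece m)) {u : T}
    (hu : ∀ s, ∃ v ∈ F.prodSub C, u - v ∈ F.filt s) : u ∈ F.prodSub C := by
  obtain ⟨f, hf, -, hfu⟩ := F.exists_isSum (F.mem_filt_zero u)
  refine ⟨f, fun m => ?_, hfu⟩
  obtain ⟨v, ⟨g, hg, hgv⟩, huv⟩ := hu (m + 1)
  rw [IsSum.eq_of_sub_mem hh hf (fun m => hC m (hg m)) hfu hgv huv (Nat.lt_succ_self m)]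
  exact hg m

theorem prodSub_inf (hh : h.IsHomogeneous e) {C C' : ℕ → Submodule k T}
    (hC : ∀ m, C m ≤ F.commLoc (y.piece m)) (hC' : ∀ m, C' m ≤ F.commLoc (y.piece m)) :
    F.prodSub (fun m => C m ⊓ C' m) = F.prodSub C ⊓ F.prodSub C' := by
  refine le_antisymm (le_inf (F.prodSub_mono fun _ => inf_le_left)
    (F.prodSub_mono fun _ => inf_le_right)) ?_
  rintro u ⟨⟨f, hf, hfu⟩, g, hg, hgu⟩
  have := IsSum.unique hh (fun m => hC m (hf m)) (fun m => hC' m (hg m)) hfu hgu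
  subst this
  exact ⟨f, fun m => ⟨hf m, hg m⟩, hfu⟩

/-! ### Homogeneous components -/

theorem scale_mem_commLoc (hh : h.IsHomogeneous e) {m : ℕ} {u : T}
    (hu : u ∈ F.commLoc (y.piece m)) : F.scale u ∈ F.commLoc (y.piece m) := by
  refine Submodule.iSup_induction _ (motive := fun u => F.scale u ∈ F.commLoc (y.piece m))
    (commLoc_piece_le e m hu) ?_ ?_ ?_
  · intro c u hu
    rw [scale_apply hh hu]
    exact Submodule.smul_mem _ _ (bip_le_commLoc e c m hu)
  · rw [map_zero]
    exact zero_mem _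
  · intro u v hu hv
    rw [map_add]
    exact add_mem hu hv

/-- For fixed weight `m` the scaling eigenvalues $2^{c+m}$ are distinct for distinct `c`, so scaling
alone detects the degree. -/
theorem mem_bip_of_scale_eq (hh : h.IsHomogeneous e) {m : ℕ} {d : ℤ} {u : T}
    (hu : u ∈ F.commLoc (y.piece m)) (hs : F.scale u = (2 : k) ^ d • u) :
    u ∈ F.bip e (d - m) m := by
  have h1 : ∀ c, F.bip e c m ≤ Module.End.eigenspace F.scale.toLinearMap ((2 : k) ^ (c + m)) :=
    fun c v hv => Module.End.mem_eigenspace_iff.2 (scale_apply hh hv)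
  have h2 := commLoc_piece_le (F := F) e m hu
  rw [iSup_split_single _ (d - (m : ℤ)), Submodule.mem_sup] at h2
  obtain ⟨v, hv, w, hw, rfl⟩ := h2
  have h3 : w ∈ Module.End.eigenspace F.scale.toLinearMap ((2 : k) ^ d) := by
    have h4 := sub_mem (Module.End.mem_eigenspace_iff.2 hs) (by
      have := h1 _ hv
      rwa [sub_add_cancel] at this)
    rwa [add_sub_cancel_left] at h4
  have h5 : w ∈ ⨆ (μ : k) (_ : μ ≠ (2 : k) ^ d),
      Module.End.eigenspace F.scale.toLinearMap μ := by
    refine iSup₂_le (fun c hc => (h1 c).trans ?_) hw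
    refine le_iSup₂_of_le ((2 : k) ^ (c + m)) ?_ le_rfl
    intro h6
    have := two_zpow_injective h6
    exact hc (by linarith)
  have h7 := (Module.End.eigenspaces_iSupIndep F.scale.toLinearMap ((2 : k) ^ d)).le_bot ⟨h3, h5⟩
  rw [(Submodule.mem_bot k).1 h7, add_zero]
  exact hv

theorem scale_eq_of_mem_prodSub (hh : h.IsHomogeneous e) {d : ℤ} {u : T}
    (hu : u ∈ F.prodSub fun m => F.bip e (d - m) m) : F.scale u = (2 : k) ^ d • u := by
  obtain ⟨f, hf, hfu⟩ := hu
  have h1 := hfu.map (P := F.scale.toLinearMap) F.scale_mem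
  have h2 := hfu.map (P := ((2 : k) ^ d) • 1) (Submodule.smul_mem _ _ fun s v hv => hv)
  have h3 : (fun m => F.scale.toLinearMap (f m)) =
      fun m => (((2 : k) ^ d) • (1 : Module.End k T)) (f m) := funext fun m => by
    have := scale_apply hh (hf m)
    rw [sub_add_cancel] at this
    exact this
  rw [← h3] at h2
  exact IsSum.eq h1 h2

theorem mem_prodSub_of_scale_eq (hh : h.IsHomogeneous e) {C : ℕ → Submodule k T}
    (hC : ∀ m, C m ≤ F.commLoc (y.piece m)) {d : ℤ} {u : T} (hu : u ∈ F.prodSub C)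
    (hs : F.scale u = (2 : k) ^ d • u) : u ∈ F.prodSub fun m => C m ⊓ F.bip e (d - m) m := by
  obtain ⟨f, hf, hfu⟩ := hu
  have h1 := hfu.map (P := F.scale.toLinearMap) F.scale_mem
  have h2 := hfu.map (P := ((2 : k) ^ d) • 1) (Submodule.smul_mem _ _ fun s v hv => hv)
  have h3 : F.scale.toLinearMap u = (((2 : k) ^ d) • (1 : Module.End k T)) u := hs
  rw [← h3] at h2
  have h4 := IsSum.unique hh (fun m => scale_mem_commLoc hh (hC m (hf m)))
    (fun m => Submodule.smul_mem _ _ (hC m (hf m))) h1 h2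
  exact ⟨f, fun m => ⟨hf m, mem_bip_of_scale_eq hh (hC m (hf m)) (congrFun h4 m)⟩, hfu⟩

theorem iSupIndep_prodSub_bip (hh : h.IsHomogeneous e) :
    iSupIndep fun d : ℤ => F.prodSub fun m => F.bip e (d - m) m :=
  iSupIndep_of_eigenvectors (fun _ : Unit => F.scale.toLinearMap) (fun _ d => (2 : k) ^ d)
    (fun _ _ hij => ⟨(), fun hc => hij (two_zpow_injective hc)⟩) _
    fun _ _ _ hu => scale_eq_of_mem_prodSub hh hu

end FracSystem

/-! ## Bigraded ideals -/

/-- A subspace spanned by its homogeneous elements contains the homogeneous components of its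
elements. -/
theorem mem_of_add_mem_of_iSupIndep {k V ι : Type*} [Ring k] [AddCommGroup V] [Module k V]
    {W : ι → Submodule k V} (hW : iSupIndep W) {P : Submodule k V} (hP : P ≤ ⨆ i, P ⊓ W i) {i : ι}
    {v w : V} (hv : v ∈ W i) (hw : w ∈ ⨆ (j) (_ : j ≠ i), W j) (h : v + w ∈ P) : v ∈ P := by
  have h1 := hP h
  rw [iSup_split_single _ i, Submodule.mem_sup] at h1
  obtain ⟨p, hp, p', hp', h2⟩ := h1
  have h3 : v - p ∈ W i := sub_mem hv hp.2
  have h4 : v - p = p' - w := by rw [sub_eq_sub_iff_add_eq_add, h2.symm, add_comm]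
  have h5 : p' - w ∈ ⨆ (j) (_ : j ≠ i), W j :=
    sub_mem ((iSup₂_mono fun j _ => inf_le_right : (⨆ (j) (_ : j ≠ i), P ⊓ W j) ≤ _) hp') hw
  have h6 := (hW i).le_bot ⟨h3, h4 ▸ h5⟩
  rw [sub_eq_zero.1 ((Submodule.mem_bot k).1 h6)]
  exact hp.1

section BigradedIdeal

variable {k : Type u} [Field k] {n q : ℕ} [NeZero q] {r : ℕ}

/-- A two-sided ideal that is spanned by its bihomogeneous elements. -/
structure RadicalBasis.IsBigraded (y : RadicalBasis k n q r) (P : Submodule k (Sq k n q)) :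
    Prop where
  le_iSup : P ≤ ⨆ i : ℕ × ℕ, P ⊓ y.bipiece i.1 i.2
  mul_mem_left : ∀ a, ∀ b ∈ P, a * b ∈ P
  mul_mem_right : ∀ a, ∀ b ∈ P, b * a ∈ P

namespace RadicalBasis.IsBigraded

variable [CharZero k] {y : RadicalBasis k n q r} {P : Submodule k (Sq k n q)}

/-- For `a` of bidegree $(e,m)$ the product $x_ja$ lies in `P` and equals `diagXU k n q j a`, of
bidegree $(e+1,m)$, plus terms of weight greater than `m`. The first summand is thus a bihomogeneous
component of an element of `P`. This is where the NC-grading of the ideal is indispensable. -/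
theorem diagXU_mem (hP : y.IsBigraded P) (j : Fin (n + 1)) {a : Sq k n q} (ha : a ∈ P) :
    diagXU k n q j a ∈ P := by
  refine Submodule.iSup_induction _ (motive := fun a => diagXU k n q j a ∈ P) (hP.le_iSup ha)
    ?_ ?_ ?_
  · rintro ⟨e, m⟩ a ⟨ha, ha'⟩
    have h1 := y.diagXU_sub_mem_filtEnd j m a (y.piece_le_J le_rfl (y.bipiece_le_piece e m ha'))
    have h2 : NCProj.X k n q j * a - diagXU k n q j a ∈ y.J (m + 1) := by
      rw [← neg_sub]
      exact neg_mem h1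
    refine mem_of_add_mem_of_iSupIndep y.iSupIndep_bipiece hP.le_iSup (i := (e + 1, m))
      (w := NCProj.X k n q j * a - diagXU k n q j a) (y.diagXU_mem_bipiece j ha') ?_ ?_
    · rw [y.J_eq_iSup] at h2
      refine (iSup_le fun i => ?_ : _ ≤ ⨆ (j) (_ : j ≠ (e + 1, m)), y.bipiece j.1 j.2) h2
      refine le_iSup₂_of_le (i : ℕ × ℕ) ?_ le_rfl
      intro hi
      have := i.2
      rw [hi] at this
      exact absurd this (by simp)
    · rw [add_sub_cancel]
      exact hP.mul_mem_left _ _ ha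
  · rw [map_zero]
    exact zero_mem _
  · intro a b ha hb
    rw [map_add]
    exact add_mem ha hb

theorem diagHU_mem (hP : y.IsBigraded P) (h : MvPolynomial (Fin (n + 1)) k) {a : Sq k n q}
    (ha : a ∈ P) : diagHU n q h a ∈ P := by
  have h1 : ∀ Q, Q ∈ filtEndAlg (fun _ : ℕ => P) ↔ ∀ a ∈ P, Q a ∈ P :=
    fun Q => ⟨fun H => H 0, fun H _ => H⟩
  exact (h1 _).1 (orderedCalc_mem _ (fun j => (h1 _).2 fun a ha => hP.diagXU_mem j ha) h) a ha

theorem diagHU_mem_inf (hP : y.IsBigraded P) (h : MvPolynomial (Fin (n + 1)) k) (t : ℕ) :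
    ∀ a ∈ P ⊓ y.J t, diagHU n q h a ∈ P ⊓ y.J t :=
  fun a ha => ⟨hP.diagHU_mem h ha.1, y.diagHU_mem_filtEnd h t a ha.2⟩

theorem diagHU_sub_left_mem (hP : y.IsBigraded P) (h : MvPolynomial (Fin (n + 1)) k) {t : ℕ} :
    ∀ a ∈ P ⊓ y.J t, diagHU n q h a - hx h * a ∈ P ⊓ y.J (t + 1) :=
  fun a ha => ⟨sub_mem (hP.diagHU_mem h ha.1) (hP.mul_mem_left _ _ ha.1),
    y.diagHU_sub_mem_filtEnd h t a ha.2⟩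

theorem diagHU_sub_right_mem (hP : y.IsBigraded P) (h : MvPolynomial (Fin (n + 1)) k) {t : ℕ} :
    ∀ a ∈ P ⊓ y.J t, diagHU n q h a - a * hx h ∈ P ⊓ y.J (t + 1) :=
  fun a ha => ⟨sub_mem (hP.diagHU_mem h ha.1) (hP.mul_mem_right _ _ ha.1), by
    have := add_mem (y.diagHU_sub_mem_filtEnd h t a ha.2) (y.hx_commutator_mem_J h ha.2)
    rw [LinearMap.sub_apply] at this
    change diagHU n q h a - hx h * a + (hx h * a - a * hx h) ∈ _ at this
    rwa [sub_add_sub_cancel] at this⟩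

end RadicalBasis.IsBigraded

end BigradedIdeal

namespace FracSystem

variable {k : Type u} [Field k] {n q : ℕ} [NeZero q] {r : ℕ} {y : RadicalBasis k n q r}
  {h : MvPolynomial (Fin (n + 1)) k} {T : Type u} [Ring T] [Algebra k T] {F : FracSystem y h T}

/-! ### Fractions with numerators in an ideal -/

/-- Stability of `N` under `diagHU` allows common denominators, so the span consists of single
fractions. -/
theorem mem_commLoc_iff {N : Submodule k (Sq k n q)} (hN : ∀ a ∈ N, diagHU n q h a ∈ N) {u : T} :
    u ∈ F.commLoc N ↔ ∃ l : ℕ, ∃ a ∈ N, (F.D ^ l) u = F.of a := by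
  have hN' : ∀ l : ℕ, ∀ a ∈ N, (diagHU n q h ^ l) a ∈ N := fun l a ha => by
    induction l with
    | zero => exact ha
    | succ l ih => rw [pow_succ', Module.End.mul_apply]; exact hN _ ih
  refine ⟨fun hu => ?_, fun hu => Submodule.subset_span hu⟩
  induction hu using Submodule.span_induction with
  | mem u hu => exact hu
  | zero => exact ⟨0, 0, zero_mem _, by rw [map_zero, map_zero]⟩
  | add u v _ _ hu hv =>
    obtain ⟨l, a, ha, hu⟩ := hu
    obtain ⟨l', b, hb, hv⟩ := hv
    refine ⟨l + l', _, add_mem (hN' l' a ha) (hN' l b hb), ?_⟩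
    rw [map_add, map_add, ← F.D_pow_of, ← F.D_pow_of, ← hu, ← hv, ← Module.End.mul_apply,
      ← Module.End.mul_apply, ← pow_add, ← pow_add, add_comm l' l]
  | smul c u _ hu =>
    obtain ⟨l, a, ha, hu⟩ := hu
    exact ⟨l, c • a, N.smul_mem c ha, by rw [map_smul, map_smul, hu]⟩

theorem D_pow_mem_commLoc_iff {N : Submodule k (Sq k n q)} (hN : ∀ a ∈ N, diagHU n q h a ∈ N)
    (l : ℕ) {u : T} : (F.D ^ l) u ∈ F.commLoc N ↔ u ∈ F.commLoc N := by
  rw [mem_commLoc_iff hN, mem_commLoc_iff hN]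
  constructor
  · rintro ⟨l', a, ha, hu⟩
    exact ⟨l' + l, a, ha, by rw [pow_add, Module.End.mul_apply, hu]⟩
  · rintro ⟨l', a, ha, hu⟩
    refine ⟨l', (diagHU n q h ^ l) a, ?_, ?_⟩
    · clear hu
      induction l with
      | zero => exact ha
      | succ l ih => rw [pow_succ', Module.End.mul_apply]; exact hN _ ih
    · rw [← Module.End.mul_apply, ← pow_add, add_comm, pow_add, Module.End.mul_apply, hu, F.D_pow_of]

/-- Ad-nilpotent operators extend to commutative fractions. -/
theorem apply_mem_commLoc {N N' : Submodule k (Sq k n q)} (hN : ∀ a ∈ N, diagHU n q h a ∈ N)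
    (hN' : ∀ a ∈ N', diagHU n q h a ∈ N') {P : Module.End k (Sq k n q) × Module.End k T}
    (hP : P ∈ F.compat) (hPN : ∀ a ∈ N, P.1 a ∈ N') (hPn : P ∈ adNil k (F.rep.D h)) {u : T}
    (hu : u ∈ F.commLoc N) : P.2 u ∈ F.commLoc N' := by
  obtain ⟨l, a, ha, hu⟩ := (mem_commLoc_iff hN).1 hu
  let S : Submodule k (Module.End k (Sq k n q) × Module.End k T) :=
    { carrier := {P | P ∈ F.compat ∧ ∀ a ∈ N, P.1 a ∈ N'}
      zero_mem' := ⟨zero_mem _, fun a _ => zero_mem _⟩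
      add_mem' := fun {P Q} hP hQ => ⟨add_mem hP.1 hQ.1, fun a ha => add_mem (hP.2 a ha) (hQ.2 a ha)⟩
      smul_mem' := fun c P hP => ⟨Subalgebra.smul_mem _ hP.1 c,
        fun a ha => Submodule.smul_mem _ c (hP.2 a ha)⟩ }
  have hD := F.rep_D_mem_compat
  -- The Ore identity $D^MP=P'D^l$ clears the denominator of `u`. Here `P'` still maps `N` to `N'`,
  -- because `S` is stable under multiplication by `D` on both sides.
  obtain ⟨M, P', hP', e⟩ := exists_pow_mul_eq_mul_pow (D := F.rep.D h) S
    (fun P hP => ⟨mul_mem hD hP.1, fun a ha => by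
      rw [rep_D]
      exact hN' _ (hP.2 a ha)⟩)
    (fun P hP => ⟨mul_mem hP.1 hD, fun a ha => by
      rw [rep_D]
      exact hP.2 _ (hN a ha)⟩) (P := P) ⟨hP, hPN⟩ hPn l
  refine (mem_commLoc_iff hN').2 ⟨M, P'.1 a, hP'.2 a ha, ?_⟩
  have h1 := LinearMap.congr_fun (congrArg Prod.snd e) u
  rw [rep_D] at h1
  change (F.D ^ M) (P.2 u) = P'.2 ((F.D ^ l) u) at h1
  rw [h1, hu]
  exact hP'.1 a

variable (F) in
/-- The right multiplications on `S_q` and on `T`. -/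
def repR : Sq k n q →ₗ[k] Module.End k (Sq k n q) × Module.End k T where
  toFun a := (LinearMap.mulRight k a, LinearMap.mulRight k (F.of a))
  map_add' a b := Prod.ext (LinearMap.ext fun c => mul_add c a b)
    (LinearMap.ext fun u => by
      change u * F.of (a + b) = u * F.of a + u * F.of b
      rw [map_add, mul_add])
  map_smul' s a := Prod.ext (LinearMap.ext fun c => mul_smul_comm s c a)
    (LinearMap.ext fun u => by
      change u * F.of (s • a) = s • (u * F.of a)
      rw [map_smul, mul_smul_comm])

theorem repR_mem_compat (a : Sq k n q) : F.repR a ∈ F.compat := fun b => (map_mul F.of b a).symm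

variable [CharZero k]

theorem repR_mem_adNil (a : Sq k n q) : F.repR a ∈ adNil k (F.rep.D h) := by
  refine F.rep.R_mem_adNil y h F.repR ?_ ?_ ?_ ?_ a
  · refine Prod.ext (LinearMap.ext fun c => mul_one c) (LinearMap.ext fun u => ?_)
    change u * F.of 1 = u
    rw [map_one, mul_one]
  · intro a b
    refine Prod.ext (LinearMap.ext fun c => (mul_assoc c a b).symm) (LinearMap.ext fun u => ?_)
    change u * F.of (a * b) = u * F.of a * F.of b
    rw [map_mul, mul_assoc]
  · intro a b
    exact Prod.ext (LinearMap.ext fun c => (mul_assoc a c b).symm)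
      (LinearMap.ext fun u => (mul_assoc (F.of a) u (F.of b)).symm)
  · intro j a
    refine Prod.ext (LinearMap.ext fun c => pd_mul j c a) (LinearMap.ext fun u => ?_)
    change F.d j (u * F.of a) = F.d j u * F.of a + u * F.of (pd k n q j a)
    rw [F.d_mul, F.d_of]

theorem rep_D_mem_adNil : F.rep.D h ∈ adNil k (F.rep.D h) := mem_adNil_of_commute (Commute.refl _)

variable {P : Submodule k (Sq k n q)}

theorem of_mul_mem_commLoc (hP : y.IsBigraded P) (a : Sq k n q) {t : ℕ} {u : T}
    (hu : u ∈ F.commLoc (P ⊓ y.J t)) : F.of a * u ∈ F.commLoc (P ⊓ y.J t) :=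
  apply_mem_commLoc (hP.diagHU_mem_inf h t) (hP.diagHU_mem_inf h t) (F.rep_L_mem_compat a)
    (fun _ hb => ⟨hP.mul_mem_left _ _ hb.1, y.mul_mem_J_left a hb.2⟩) (F.rep.L_mem_adNil y h a) hu

theorem mul_of_mem_commLoc (hP : y.IsBigraded P) (a : Sq k n q) {t : ℕ} {u : T}
    (hu : u ∈ F.commLoc (P ⊓ y.J t)) : u * F.of a ∈ F.commLoc (P ⊓ y.J t) :=
  apply_mem_commLoc (hP.diagHU_mem_inf h t) (hP.diagHU_mem_inf h t) (repR_mem_compat a)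
    (fun _ hb => ⟨hP.mul_mem_right _ _ hb.1, y.mul_mem_J_right a hb.2⟩) (repR_mem_adNil a) hu

/-- The operator $D-L_{h(\mathbf x)}$ is ad-nilpotent and on $S_q$ it maps $P\cap\mathcal J_t$ to
$P\cap\mathcal J_{t+1}$, so the extension to fractions applies. -/
theorem D_sub_left_mem_commLoc (hP : y.IsBigraded P) {t : ℕ} {u : T}
    (hu : u ∈ F.commLoc (P ⊓ y.J t)) :
    F.D u - F.of (hx h) * u ∈ F.commLoc (P ⊓ y.J (t + 1)) := by
  have := apply_mem_commLoc (P := F.rep.D h - F.rep.L (hx h)) (hP.diagHU_mem_inf h t)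
    (hP.diagHU_mem_inf h (t + 1)) (sub_mem F.rep_D_mem_compat (F.rep_L_mem_compat _))
    (fun b hb => by
      rw [rep_D]
      exact hP.diagHU_sub_left_mem h b hb)
    (sub_mem rep_D_mem_adNil (F.rep.L_mem_adNil y h _)) hu
  rw [rep_D] at this
  exact this

theorem D_sub_right_mem_commLoc (hP : y.IsBigraded P) {t : ℕ} {u : T}
    (hu : u ∈ F.commLoc (P ⊓ y.J t)) :
    F.D u - u * F.of (hx h) ∈ F.commLoc (P ⊓ y.J (t + 1)) := by
  have := apply_mem_commLoc (P := F.rep.D h - F.repR (hx h)) (hP.diagHU_mem_inf h t)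
    (hP.diagHU_mem_inf h (t + 1)) (sub_mem F.rep_D_mem_compat (repR_mem_compat _))
    (fun b hb => by
      rw [rep_D]
      exact hP.diagHU_sub_right_mem h b hb)
    (sub_mem rep_D_mem_adNil (repR_mem_adNil _)) hu
  rw [rep_D] at this
  exact this

theorem commLoc_inf_J_le_filt (P : Submodule k (Sq k n q)) (t : ℕ) :
    F.commLoc (P ⊓ y.J t) ≤ F.filt t := commLoc_le_filt inf_le_right

/-- The inverse of an operator that agrees with `D` to leading order agrees with the inverse of `D`
to leading order. -/
theorem inv_sub_mem (hP : y.IsBigraded P) {A A' : Module.End k T} (hA : A' * A = 1)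
    (hA' : A' ∈ filtEnd F.filt 0)
    (hD : ∀ t, ∀ u ∈ F.commLoc (P ⊓ y.J t), F.D u - A u ∈ F.commLoc (P ⊓ y.J (t + 1)))
    (N : ℕ) {t : ℕ} {w : T} (hw : w ∈ F.commLoc (P ⊓ y.J t)) :
    A' (F.D w) - w ∈ F.commLoc (P ⊓ y.J (t + 1)) ⊔ F.filt N := by
  have key : ∀ p t, N ≤ t + p → ∀ w ∈ F.commLoc (P ⊓ y.J t),
      A' (F.D w) - w ∈ F.commLoc (P ⊓ y.J (t + 1)) ⊔ F.filt N := by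
    intro p
    induction p with
    | zero =>
      intro t ht w hw
      have h1 := commLoc_inf_J_le_filt P t hw
      exact Submodule.mem_sup_right (F.anti ht (sub_mem (hA' t _ (F.D_mem_filtEnd t w h1)) h1))
    | succ p ih =>
      intro t ht w hw
      have h1 := hD t w hw
      have h2 : A' (F.D w) - w = A' (F.D w - A w) := by
        rw [map_sub, ← Module.End.mul_apply A' A, hA, Module.End.one_apply]
      -- Writing $Dw-Aw=Dv$, the element `v` is a fraction one step higher. Since $A'Dw-w=A'Dv$, the
      -- induction hypothesis for `v` finishes the step.
      obtain ⟨v, hv⟩ := F.D_bijective.surjective (F.D w - A w)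
      have h3 : v ∈ F.commLoc (P ⊓ y.J (t + 1)) := by
        rw [← D_pow_mem_commLoc_iff (hP.diagHU_mem_inf h (t + 1)) 1, pow_one, hv]
        exact h1
      have h4 := ih (t + 1) (by omega) v h3
      rw [h2, ← hv, ← sub_add_cancel (A' (F.D v)) v]
      refine add_mem (sup_le_sup_right (commLoc_mono ?_) _ h4) (Submodule.mem_sup_left h3)
      exact inf_le_inf_left _ (y.J_anti (Nat.le_succ _))
  exact key N t (Nat.le_add_left N t) w hw

theorem inv_mem (hP : y.IsBigraded P) {A A' : Module.End k T} (hA : A' * A = 1)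
    (hA' : A' ∈ filtEnd F.filt 0)
    (hD : ∀ t, ∀ u ∈ F.commLoc (P ⊓ y.J t), F.D u - A u ∈ F.commLoc (P ⊓ y.J (t + 1)))
    {N : ℕ} {t : ℕ} {v : T} (hv : v ∈ F.commLoc (P ⊓ y.J t) ⊔ F.filt N) :
    A' v ∈ F.commLoc (P ⊓ y.J t) ⊔ F.filt N := by
  obtain ⟨v, hv, v', hv', rfl⟩ := Submodule.mem_sup.1 hv
  rw [map_add]
  refine add_mem ?_ (Submodule.mem_sup_right (hA' _ _ hv'))
  obtain ⟨w, rfl⟩ := F.D_bijective.surjective v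
  have hw : w ∈ F.commLoc (P ⊓ y.J t) := by
    rwa [← D_pow_mem_commLoc_iff (hP.diagHU_mem_inf h t) 1, pow_one]
  rw [← sub_add_cancel (A' (F.D w)) w]
  refine add_mem (sup_le_sup_right (commLoc_mono ?_) _ (inv_sub_mem hP hA hA' hD N hw))
    (Submodule.mem_sup_left hw)
  exact inf_le_inf_left _ (y.J_anti (Nat.le_succ _))

theorem inv_mul_mem (hP : y.IsBigraded P) {N t : ℕ} {v : T}
    (hv : v ∈ F.commLoc (P ⊓ y.J t) ⊔ F.filt N) :
    F.inv * v ∈ F.commLoc (P ⊓ y.J t) ⊔ F.filt N :=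
  inv_mem hP F.lmul_inv_mul (F.mulLeft_mem_filtEnd _)
    (fun _ _ hu => D_sub_left_mem_commLoc hP hu) hv

theorem mulRight_inv_mul :
    LinearMap.mulRight k F.inv * LinearMap.mulRight k (F.of (hx h)) = 1 :=
  LinearMap.ext fun u => by
    change u * F.of (hx h) * F.inv = u
    rw [mul_assoc, F.of_mul_inv, mul_one]

theorem mul_inv_mem (hP : y.IsBigraded P) {N t : ℕ} {v : T}
    (hv : v ∈ F.commLoc (P ⊓ y.J t) ⊔ F.filt N) :
    v * F.inv ∈ F.commLoc (P ⊓ y.J t) ⊔ F.filt N :=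
  inv_mem hP mulRight_inv_mul (F.mulRight_mem_filtEnd _)
    (fun _ _ hu => D_sub_right_mem_commLoc hP hu) hv

theorem inv_pow_mul_mem (hP : y.IsBigraded P) (d : ℕ) {N t : ℕ} {v : T}
    (hv : v ∈ F.commLoc (P ⊓ y.J t) ⊔ F.filt N) :
    F.inv ^ d * v ∈ F.commLoc (P ⊓ y.J t) ⊔ F.filt N := by
  induction d with
  | zero => rwa [pow_zero, one_mul]
  | succ d ih => rw [pow_succ', mul_assoc]; exact inv_mul_mem hP ih

theorem mul_inv_pow_mem (hP : y.IsBigraded P) (d : ℕ) {N t : ℕ} {v : T}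
    (hv : v ∈ F.commLoc (P ⊓ y.J t) ⊔ F.filt N) :
    v * F.inv ^ d ∈ F.commLoc (P ⊓ y.J t) ⊔ F.filt N := by
  induction d with
  | zero => rwa [pow_zero, mul_one]
  | succ d ih => rw [pow_succ, ← mul_assoc]; exact mul_inv_mem hP ih

theorem mul_inv_pow_sub_mem (hP : y.IsBigraded P) (l N : ℕ) {t : ℕ} {w : T}
    (hw : w ∈ F.commLoc (P ⊓ y.J t)) :
    (F.D ^ l) w * F.inv ^ l - w ∈ F.commLoc (P ⊓ y.J (t + 1)) ⊔ F.filt N := by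
  induction l with
  | zero =>
    rw [pow_zero, pow_zero, mul_one, Module.End.one_apply, sub_self]
    exact zero_mem _
  | succ l ih =>
    have h1 : (F.D ^ l) w ∈ F.commLoc (P ⊓ y.J t) :=
      (D_pow_mem_commLoc_iff (hP.diagHU_mem_inf h t) l).2 hw
    have h2 := inv_sub_mem hP mulRight_inv_mul (F.mulRight_mem_filtEnd _)
      (fun _ _ hu => D_sub_right_mem_commLoc hP hu) N h1
    have h3 := add_mem (mul_inv_pow_mem hP l h2) ih
    rwa [LinearMap.mulRight_apply, sub_mul, mul_assoc, ← pow_succ', sub_add_sub_cancel,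
      ← Module.End.mul_apply, ← pow_succ'] at h3

/-- The closure of the space of the commutative fractions is a two-sided ideal. -/
theorem mul_mem_sup (hP : y.IsBigraded P) {N t : ℕ} (a : T) {u : T}
    (hu : u ∈ F.commLoc (P ⊓ y.J t) ⊔ F.filt N) :
    a * u ∈ F.commLoc (P ⊓ y.J t) ⊔ F.filt N ∧ u * a ∈ F.commLoc (P ⊓ y.J t) ⊔ F.filt N := by
  obtain ⟨u, hu₀, u', hu', rfl⟩ := Submodule.mem_sup.1 hu
  rw [mul_add, add_mul]
  suffices H : a * u ∈ F.commLoc (P ⊓ y.J t) ⊔ F.filt N ∧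
      u * a ∈ F.commLoc (P ⊓ y.J t) ⊔ F.filt N from
    ⟨add_mem H.1 (Submodule.mem_sup_right (F.mul_mem_left _ _ _ hu')),
      add_mem H.2 (Submodule.mem_sup_right (F.mul_mem_right _ _ _ hu'))⟩
  have hsup : ∀ (b : Sq k n q) {v : T}, v ∈ F.commLoc (P ⊓ y.J t) ⊔ F.filt N →
      F.of b * v ∈ F.commLoc (P ⊓ y.J t) ⊔ F.filt N := fun b v hv => by
    obtain ⟨w, hw, w', hw', rfl⟩ := Submodule.mem_sup.1 hv
    rw [mul_add]
    exact Submodule.add_mem_sup (of_mul_mem_commLoc hP b hw) (F.mul_mem_left _ _ _ hw')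
  -- Modulo `filt N` the multiplier `a` is a sum of right fractions, so multiplication by the image
  -- of $S_q$ and by powers of the inverse suffices.
  refine F.filt_le_of_frac (t := 0) (N := N)
    ((F.commLoc (P ⊓ y.J t) ⊔ F.filt N).comap (LinearMap.mulRight k u) ⊓
      (F.commLoc (P ⊓ y.J t) ⊔ F.filt N).comap (LinearMap.mulLeft k u))
    (fun v hv => ⟨Submodule.mem_sup_right (F.mul_mem_right N u v hv),
      Submodule.mem_sup_right (F.mul_mem_left N u v hv)⟩)
    (fun b _ d => ⟨?_, ?_⟩) (F.mem_filt_zero a)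
  · change F.of b * F.inv ^ d * u ∈ F.commLoc (P ⊓ y.J t) ⊔ F.filt N
    rw [mul_assoc]
    exact hsup b (inv_pow_mul_mem hP d (Submodule.mem_sup_left hu₀))
  · change u * (F.of b * F.inv ^ d) ∈ F.commLoc (P ⊓ y.J t) ⊔ F.filt N
    rw [← mul_assoc]
    exact mul_inv_pow_mem hP d (Submodule.mem_sup_left (mul_of_mem_commLoc hP b hu₀))

/-! ### The product of the localized pieces of an ideal -/

variable {e : ℕ}

variable (F P) in
/-- The product of the localized pieces of an ideal. -/
def prodPieces : Submodule k T := F.prodSub fun m => F.commLoc (⨆ c, P ⊓ y.bipiece c m)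

theorem commLoc_pieces_le (P : Submodule k (Sq k n q)) (m : ℕ) :
    F.commLoc (⨆ c, P ⊓ y.bipiece c m) ≤ F.commLoc (y.piece m) :=
  commLoc_mono (iSup_le fun c => inf_le_right.trans (y.bipiece_le_piece c m))

theorem inf_J_zero (P : Submodule k (Sq k n q)) : P ⊓ y.J 0 = P := by rw [y.J_zero, inf_top_eq]

/-- The product of the pieces is the closure of the space of commutative fractions with numerators
in `P`. Partial sums give one direction. The other uses that products are closed and that `P` is the
sum of its pieces. -/
theorem mem_prodPieces_iff (hh : h.IsHomogeneous e) (hP : y.IsBigraded P) {u : T} :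
    u ∈ F.prodPieces P ↔ ∀ N, u ∈ F.commLoc (P ⊓ y.J 0) ⊔ F.filt N := by
  rw [inf_J_zero]
  constructor
  · rintro ⟨f, hf, hfu⟩ N
    rw [← add_sub_cancel (∑ m ∈ Finset.range N, f m) u]
    exact Submodule.add_mem_sup (sum_mem fun m _ =>
      commLoc_mono (iSup_le fun c => inf_le_left) (hf m)) (hfu N)
  · intro H
    refine mem_prodSub_of_forall hh (commLoc_pieces_le P) fun s => ?_
    obtain ⟨v, hv, w, hw, rfl⟩ := Submodule.mem_sup.1 (H s)
    refine ⟨v, ?_, by rwa [add_sub_cancel_left]⟩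
    have h1 : P ≤ ⨆ m, ⨆ c, P ⊓ y.bipiece c m := hP.le_iSup.trans
      (iSup_le fun i => le_iSup_of_le i.2 (le_iSup (fun c => P ⊓ y.bipiece c i.2) i.1))
    refine (iSup_le fun m => ?_ : _ ≤ F.prodPieces P) ((commLoc_iSup_le _) (commLoc_mono h1 hv))
    exact fun v hv => F.mem_prodSub_of_mem
      (fun m => (commLoc_pieces_le P m).trans (F.commLoc_piece_le_filt m)) hv

theorem mul_mem_prodPieces (hh : h.IsHomogeneous e) (hP : y.IsBigraded P) (a : T) {u : T}
    (hu : u ∈ F.prodPieces P) : a * u ∈ F.prodPieces P ∧ u * a ∈ F.prodPieces P := by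
  rw [mem_prodPieces_iff hh hP] at hu
  rw [mem_prodPieces_iff hh hP, mem_prodPieces_iff hh hP]
  exact ⟨fun N => (mul_mem_sup hP a (hu N)).1, fun N => (mul_mem_sup hP a (hu N)).2⟩

/-- The product of the localized pieces is the closure of the space of right fractions. -/
theorem mem_prodPieces_iff_frac (hh : h.IsHomogeneous e) (hP : y.IsBigraded P) {u : T} :
    u ∈ F.prodPieces P ↔ ∀ s, ∃ v ∈ Submodule.span k
      {u | ∃ a ∈ P, ∃ d : ℕ, u = F.of a * F.inv ^ d}, u - v ∈ F.filt s := by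
  set W := Submodule.span k {u | ∃ a ∈ P, ∃ d : ℕ, u = F.of a * F.inv ^ d} with hW
  constructor
  · intro hu N
    -- Descending induction on `t`: replacing a commutative fraction by the right fraction with the
    -- same numerator leaves an error with numerators in $P\cap\mathcal J_{t+1}$, modulo `filt N`.
    have key : ∀ p t, N ≤ t + p → F.commLoc (P ⊓ y.J t) ≤ W ⊔ F.filt N := by
      intro p
      induction p with
      | zero => exact fun t ht =>
          (commLoc_inf_J_le_filt P t).trans ((F.complete.anti ht).trans le_sup_right)
      | succ p ih =>
        intro t ht w hw
        obtain ⟨l, a, ha, hl⟩ := (mem_commLoc_iff (hP.diagHU_mem_inf h t)).1 hw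
        have h1 := mul_inv_pow_sub_mem hP l N hw
        have h2 := sup_le (ih (t + 1) (by omega)) le_sup_right h1
        have h3 : F.of a * F.inv ^ l ∈ W ⊔ F.filt N :=
          Submodule.mem_sup_left (Submodule.subset_span ⟨a, ha.1, l, rfl⟩)
        rw [hl] at h2
        have := sub_mem h3 h2
        rwa [sub_sub_cancel] at this
    obtain ⟨v, hv, w, hw, rfl⟩ := Submodule.mem_sup.1
      (sup_le (key N 0 (by omega)) le_sup_right ((mem_prodPieces_iff hh hP).1 hu N))
    exact ⟨v, hv, by rwa [add_sub_cancel_left]⟩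
  · intro H
    refine mem_prodSub_of_forall hh (commLoc_pieces_le P) fun s => ?_
    obtain ⟨v, hv, huv⟩ := H s
    refine ⟨v, ?_, huv⟩
    refine (Submodule.span_le.2 ?_ : W ≤ F.prodPieces P) hv
    rintro _ ⟨a, ha, d, rfl⟩
    rw [SetLike.mem_coe, mem_prodPieces_iff hh hP]
    refine fun N => mul_inv_pow_mem hP d (Submodule.mem_sup_left (Submodule.subset_span
      ⟨0, a, ⟨ha, ?_⟩, rfl⟩))
    rw [y.J_zero]
    trivial

theorem commLoc_pieces_le_iSup (P : Submodule k (Sq k n q)) (e m : ℕ) :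
    F.commLoc (⨆ c, P ⊓ y.bipiece c m) ≤
      ⨆ c, F.commLoc (⨆ c, P ⊓ y.bipiece c m) ⊓ F.bip e c m :=
  (commLoc_iSup_le _).trans (iSup_le fun d => (commLoc_bipiece_le e P d m).trans
    (iSup_mono fun _ => inf_le_inf_right _
      (commLoc_mono (le_iSup (fun c => P ⊓ y.bipiece c m) d))))

variable (F P) in
/-- The homogeneous component of the product of the localized pieces of an ideal. -/
def prodPiecesComp (e : ℕ) (d : ℤ) : Submodule k T :=
  F.prodSub fun m => F.commLoc (⨆ c, P ⊓ y.bipiece c m) ⊓ F.bip e (d - m) m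

theorem prodPiecesComp_eq (hh : h.IsHomogeneous e) (d : ℤ) :
    F.prodPiecesComp P e d =
      F.prodPieces P ⊓ F.prodSub fun m => F.bip e (d - m) m :=
  prodSub_inf hh (commLoc_pieces_le P) fun m => bip_le_commLoc e _ m

theorem exists_mem_iSup_prodPiecesComp (e : ℕ) {u : T} (hu : u ∈ F.prodPieces P) (s : ℕ) :
    ∃ v ∈ ⨆ d, F.prodPiecesComp P e d, u - v ∈ F.filt s := by
  obtain ⟨f, hf, hfu⟩ := hu
  refine ⟨_, sum_mem fun m _ => ?_, hfu s⟩
  refine (iSup_le fun c => ?_ : _ ≤ ⨆ d, F.prodPiecesComp P e d)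
    (commLoc_pieces_le_iSup P e m (hf m))
  intro v hv
  refine Submodule.mem_iSup_of_mem (c + m) (F.mem_prodSub_of_mem (m := m) (fun m =>
    inf_le_left.trans ((commLoc_pieces_le P m).trans (F.commLoc_piece_le_filt m))) ?_)
  rwa [add_sub_cancel_right]

/-- Scaling is an algebra homomorphism, so the eigenvalues $2^t$ and $2^d$ multiply, and membership
in a component is detected by the eigenvalue. -/
theorem mul_mem_prodPiecesComp (hh : h.IsHomogeneous e) (hP : y.IsBigraded P) {t d : ℤ} {a u : T}
    (ha : a ∈ F.prodSub fun m => F.bip e (t - m) m) (hu : u ∈ F.prodPiecesComp P e d) :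
    a * u ∈ F.prodPiecesComp P e (t + d) ∧ u * a ∈ F.prodPiecesComp P e (t + d) := by
  rw [prodPiecesComp_eq hh] at hu
  have h1 := mul_mem_prodPieces hh hP a hu.1
  have h2 := scale_eq_of_mem_prodSub hh ha
  have h3 := scale_eq_of_mem_prodSub hh hu.2
  refine ⟨mem_prodSub_of_scale_eq hh (commLoc_pieces_le P) h1.1 ?_,
    mem_prodSub_of_scale_eq hh (commLoc_pieces_le P) h1.2 ?_⟩
  · rw [map_mul, h2, h3, smul_mul_smul_comm, ← zpow_add₀ two_ne_zero]
  · rw [map_mul, h2, h3, smul_mul_smul_comm, ← zpow_add₀ two_ne_zero, add_comm d t]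

end FracSystem

section Assembly

variable {k : Type u} [Field k] {n q : ℕ} [NeZero q] {r : ℕ} (y : RadicalBasis k n q r)

/-! ## NC-graded ideals are bigraded -/

theorem RadicalBasis.bipiece_le_comp (e m : ℕ) : y.bipiece e m ≤ y.comp (e + m) := by
  refine le_iSup₂_of_le m (Finset.mem_range.2 (by omega)) ?_
  rw [Nat.add_sub_cancel]

theorem RadicalBasis.idealPiece_eq (I : TwoSidedIdeal (Sq k n q)) (m : ℕ) :
    y.idealPiece I m = ⨆ e, idealSubspace I ⊓ y.bipiece e m :=
  iSup_congr fun e => by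
    rw [inf_assoc, inf_eq_right.2 (y.bipiece_le_comp e m)]

theorem mem_idealSubspace {I : TwoSidedIdeal (Sq k n q)} {a : Sq k n q} :
    a ∈ idealSubspace (k := k) I ↔ a ∈ I := TwoSidedIdeal.mem_asIdeal

theorem RadicalBasis.IsNCGraded.isBigraded {y : RadicalBasis k n q r}
    {I : TwoSidedIdeal (Sq k n q)} (hI : y.IsNCGraded I) : y.IsBigraded (idealSubspace I) where
  le_iSup := by
    conv_lhs => rw [hI.graded]
    refine iSup_le fun d => ?_
    rw [hI.nc_graded d]
    refine iSup₂_le fun m _ => ?_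
    refine le_iSup_of_le (d - m, m) ?_
    exact inf_le_inf_right _ inf_le_left
  mul_mem_left a b hb := mem_idealSubspace.2 (I.mul_mem_left a b (mem_idealSubspace.1 hb))
  mul_mem_right a b hb := mem_idealSubspace.2 (I.mul_mem_right b a (mem_idealSubspace.1 hb))

/-! ## The topological localization as a system of fractions -/

variable {h : MvPolynomial (Fin (n + 1)) k} [CharZero k]

/-- Degrees of fractions are measured with `h.totalDegree`, which can differ from `e` only for `h =
0`, and zero is homogeneous of every degree. -/
theorem isHomogeneous_totalDegree {e : ℕ} (hh : h.IsHomogeneous e) :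
    h.IsHomogeneous h.totalDegree := by
  by_cases h0 : h = 0
  · subst h0
    exact MvPolynomial.isHomogeneous_zero _ _ _
  · rwa [hh.totalDegree h0]

theorem topLoc.completeFiltration : CompleteFiltration (topLoc.filt y h) where
  anti := topLoc.filt_anti
  zero := topLoc.filt_zero
  eq_zero _ hu := topLoc.eq_zero_of_forall hu
  exists_lim f hf := by
    obtain ⟨u, hu⟩ := topLoc.exists_hasSum hf
    exact ⟨u, (topLoc.hasSum_iff hf).1 hu⟩

/-- The topological localization as a system of fractions. -/
def topLoc.system (hh : h.IsHomogeneous h.totalDegree) : FracSystem y h (topLoc y h) where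
  filt := topLoc.filt y h
  of := topLoc.of y h
  inv := topLoc.inv y h
  d := partialD y h
  scale := topLoc.scale y hh
  complete := topLoc.completeFiltration y
  mul_mem_left _ a _ hu := topLoc.mul_mem_filt_left a hu
  mul_mem_right _ a _ hu := topLoc.mul_mem_filt_right a hu
  of_mem _ _ ha := topLoc.of_mem_filt ha
  of_mul_inv := topLoc.of_mul_inv
  inv_mul_of := topLoc.inv_mul_of
  exists_frac _ _ hu := topLoc.exists_frac hu
  d_mul := partialD_mul y h
  d_of := partialD_of y h
  d_comm := partialD_comm y h
  d_mem j _ _ hu := partialD_mem_filt y h j hu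
  scale_of := topLoc.scale_of y hh
  scale_mem _ _ hu := topLoc.scale_mem_filt y hh hu
  d_scale := partialD_scale y hh

/-! ### Identification of the given subspaces with those of the system of fractions -/

variable (hh : h.IsHomogeneous h.totalDegree)

theorem diagH_eq : diagH y h = (topLoc.system y hh).D := by
  rw [diagH, FracSystem.D]
  congr 1

theorem commLoc_eq (N : Submodule k (Sq k n q)) :
    commLoc y h N = (topLoc.system y hh).commLoc N := by
  rw [commLoc, diagH_eq y hh]
  rfl

theorem locBipiece_eq (c : ℤ) (m : ℕ) :
    locBipiece y h c m = (topLoc.system y hh).bip h.totalDegree c m := by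
  rw [locBipiece, diagH_eq y hh]
  rfl

/-- For terms `f m` in the `m`-th step of the filtration, unconditional summability in the inverse
limit topology is the same as convergence of partial sums along the filtration. -/
theorem prodSubspace_eq {C : ℕ → Submodule k (topLoc y h)}
    (hC : ∀ m, C m ≤ topLoc.filt y h m) :
    prodSubspace y h C = (topLoc.system y hh).prodSub C :=
  Submodule.ext fun _ => exists_congr fun _ => and_congr_right fun hf =>
    topLoc.hasSum_iff fun m => hC m (hf m)

theorem idealPieceLoc_eq (I : TwoSidedIdeal (Sq k n q)) (m : ℕ) :
    idealPieceLoc y h I m =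
      (topLoc.system y hh).commLoc (⨆ c, idealSubspace I ⊓ y.bipiece c m) := by
  rw [idealPieceLoc, commLoc_eq y hh, y.idealPiece_eq]

theorem locComp_eq (d : ℤ) : locComp y h d =
    (topLoc.system y hh).prodSub fun m => (topLoc.system y hh).bip h.totalDegree (d - m) m := by
  rw [locComp, prodSubspace_eq y hh]
  · simp only [locBipiece_eq y hh]
  · intro m
    rw [locBipiece_eq y hh]
    exact (FracSystem.bip_le_commLoc _ _ _).trans ((topLoc.system y hh).commLoc_piece_le_filt m)

theorem prodIdeal_eq (I : TwoSidedIdeal (Sq k n q)) :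
    prodIdeal y h I = (topLoc.system y hh).prodPieces (idealSubspace I) := by
  rw [prodIdeal, prodSubspace_eq y hh, FracSystem.prodPieces]
  · exact congrArg _ (funext fun m => idealPieceLoc_eq y hh I m)
  · intro m
    rw [idealPieceLoc_eq y hh]
    exact (FracSystem.commLoc_pieces_le _ _).trans ((topLoc.system y hh).commLoc_piece_le_filt m)

theorem prodIdealComp_eq (I : TwoSidedIdeal (Sq k n q)) (d : ℤ) :
    prodIdealComp y h I d =
      (topLoc.system y hh).prodPiecesComp (idealSubspace I) h.totalDegree d := by
  rw [prodIdealComp, prodSubspace_eq y hh, FracSystem.prodPiecesComp]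
  · simp only [idealPieceLoc_eq y hh, locBipiece_eq y hh]
  · intro m
    refine inf_le_left.trans ?_
    rw [idealPieceLoc_eq y hh]
    exact (FracSystem.commLoc_pieces_le _ _).trans ((topLoc.system y hh).commLoc_piece_le_filt m)

theorem isClosed_prodSub (hh : h.IsHomogeneous h.totalDegree) {C : ℕ → Submodule k (topLoc y h)}
    (hC : ∀ m, C m ≤ (topLoc.system y hh).commLoc (y.piece m)) :
    IsClosed ((topLoc.system y hh).prodSub C : Set (topLoc y h)) :=
  topLoc.isClosed_iff.2 fun _ hu => FracSystem.mem_prodSub_of_forall hh hC hu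

theorem isClosed_prodIdeal (hh : h.IsHomogeneous h.totalDegree)
    (I : TwoSidedIdeal (Sq k n q)) :
    IsClosed (prodIdeal y h I : Set (topLoc y h)) :=
  (prodIdeal_eq y hh I).symm ▸ isClosed_prodSub y hh (FracSystem.commLoc_pieces_le _)

theorem isClosed_prodIdealComp (hh : h.IsHomogeneous h.totalDegree)
    (I : TwoSidedIdeal (Sq k n q)) (d : ℤ) :
    IsClosed (prodIdealComp y h I d : Set (topLoc y h)) :=
  (prodIdealComp_eq y hh I d).symm ▸ isClosed_prodSub y hh fun m =>
    inf_le_left.trans (FracSystem.commLoc_pieces_le _ m)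

theorem prodIdealComp_eq_inf (hh : h.IsHomogeneous h.totalDegree)
    (I : TwoSidedIdeal (Sq k n q)) (d : ℤ) :
    prodIdealComp y h I d = prodIdeal y h I ⊓ locComp y h d :=
  (prodIdealComp_eq y hh I d).trans ((FracSystem.prodPiecesComp_eq hh d).trans
    (congrArg₂ _ (prodIdeal_eq y hh I).symm (locComp_eq y hh d).symm))

theorem iSupIndep_locComp (hh : h.IsHomogeneous h.totalDegree) :
    iSupIndep fun d : ℤ => locComp y h d :=
  (funext (locComp_eq y hh) : (fun d : ℤ => locComp y h d) = _) ▸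
    FracSystem.iSupIndep_prodSub_bip (F := topLoc.system y hh) hh

theorem topologicalClosure_iSup_prodIdealComp (hh : h.IsHomogeneous h.totalDegree)
    (I : TwoSidedIdeal (Sq k n q)) :
    (⨆ d : ℤ, prodIdealComp y h I d).topologicalClosure = prodIdeal y h I := by
  refine le_antisymm (Submodule.topologicalClosure_minimal _ (iSup_le fun d => ?_)
    (isClosed_prodIdeal y hh I)) fun u hu => topLoc.mem_topologicalClosure_iff.2 fun s => ?_
  · rw [prodIdealComp_eq_inf y hh]
    exact inf_le_left
  · rw [prodIdeal_eq y hh] at hu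
    obtain ⟨v, hv, huv⟩ := FracSystem.exists_mem_iSup_prodPiecesComp h.totalDegree hu s
    exact ⟨v, (iSup_congr (prodIdealComp_eq y hh I)).symm ▸ hv, huv⟩

theorem mul_mem_prodIdeal (hh : h.IsHomogeneous h.totalDegree)
    {I : TwoSidedIdeal (Sq k n q)} (hI : y.IsNCGraded I) (a : topLoc y h)
    {u : topLoc y h} (hu : u ∈ prodIdeal y h I) :
    a * u ∈ prodIdeal y h I ∧ u * a ∈ prodIdeal y h I := by
  rw [prodIdeal_eq y hh] at hu ⊢
  exact FracSystem.mul_mem_prodPieces hh hI.isBigraded a hu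

theorem mul_mem_prodIdealComp (hh : h.IsHomogeneous h.totalDegree)
    {I : TwoSidedIdeal (Sq k n q)} (hI : y.IsNCGraded I) {t d : ℤ}
    {a u : topLoc y h} (ha : a ∈ locComp y h t) (hu : u ∈ prodIdealComp y h I d) :
    a * u ∈ prodIdealComp y h I (t + d) ∧ u * a ∈ prodIdealComp y h I (t + d) := by
  rw [locComp_eq y hh] at ha
  rw [prodIdealComp_eq y hh] at hu
  rw [prodIdealComp_eq y hh]
  exact FracSystem.mul_mem_prodPiecesComp hh hI.isBigraded ha hu

theorem prodIdeal_eq_idealTopLoc (hh : h.IsHomogeneous h.totalDegree)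
    {I : TwoSidedIdeal (Sq k n q)} (hI : y.IsNCGraded I) :
    prodIdeal y h I = idealTopLoc y h I := by
  rw [prodIdeal_eq y hh]
  exact Submodule.ext fun _ => (FracSystem.mem_prodPieces_iff_frac hh hI.isBigraded).trans
    topLoc.mem_topologicalClosure_iff.symm

end Assembly

end NCProj

theorem mainTheorem6 {k : Type*} [Field k] [IsAlgClosed k] [CharZero k] (n q : ℕ) [NeZero q]
    {r : ℕ} (y : NCProj.RadicalBasis k n q r)
    (I : TwoSidedIdeal (NCProj.Sq k n q)) (hI : y.IsNCGraded I)
    (h : MvPolynomial (Fin (n + 1)) k) (e : ℕ) (he : 0 < e) (hh : h.IsHomogeneous e) :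
    -- `M` is closed
    IsClosed (NCProj.prodIdeal y h I : Set (NCProj.topLoc y h)) ∧
    -- `M` is a two-sided ideal
    (∀ a u : NCProj.topLoc y h, u ∈ NCProj.prodIdeal y h I →
      a * u ∈ NCProj.prodIdeal y h I ∧ u * a ∈ NCProj.prodIdeal y h I) ∧
    -- `M` is graded: it is the topological direct sum of the closed subspaces `M^d = M ∩ S^d`,
    -- and multiplication is compatible with the degrees
    ((∀ d : ℤ, IsClosed (NCProj.prodIdealComp y h I d : Set (NCProj.topLoc y h))) ∧
      (∀ d : ℤ, NCProj.prodIdealComp y h I d =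
        NCProj.prodIdeal y h I ⊓ NCProj.locComp y h d) ∧
      iSupIndep (fun d : ℤ => NCProj.prodIdealComp y h I d) ∧
      (⨆ d : ℤ, NCProj.prodIdealComp y h I d).topologicalClosure = NCProj.prodIdeal y h I ∧
      (∀ t d : ℤ, ∀ a ∈ NCProj.locComp y h t, ∀ u ∈ NCProj.prodIdealComp y h I d,
        a * u ∈ NCProj.prodIdealComp y h I (t + d) ∧
        u * a ∈ NCProj.prodIdealComp y h I (t + d))) ∧
    -- `M` is the topological localization of `I`
    NCProj.prodIdeal y h I = NCProj.idealTopLoc y h I := by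
  have hh' := NCProj.isHomogeneous_totalDegree hh
  exact ⟨NCProj.isClosed_prodIdeal y hh' I,
    fun a _ hu => NCProj.mul_mem_prodIdeal y hh' hI a hu,
    ⟨NCProj.isClosed_prodIdealComp y hh' I, NCProj.prodIdealComp_eq_inf y hh' I,
      (NCProj.iSupIndep_locComp y hh').mono fun d =>
        (NCProj.prodIdealComp_eq_inf y hh' I d).le.trans inf_le_right,
      NCProj.topologicalClosure_iSup_prodIdealComp y hh' I,
      fun _ _ _ ha _ hu => NCProj.mul_mem_prodIdealComp y hh' hI ha hu⟩,
    NCProj.prodIdeal_eq_idealTopLoc y hh' hI⟩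

end
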